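/- Let $\mathbb K$ be a field of characteristic zero, $\mathcal O$ a commutative unital $\mathbb K$-algebra, and $(\mathcal A,[\cdot,\cdot]_{\mathcal A},\rho_{\mathcal A})$ a Lie-Rinehart algebra over $\mathcal O$. A (negatively graded) Lie $\infty$-algebroid over $\mathcal O$ is a family $\mathcal E=(\mathcal E_{-i})_{i\ge 1}$ of projective $\mathcal O$-modules with brackets $\ell_n\colon S^n_{\mathbb K}(\mathcal E)\to\mathcal E$ $(n\ge 1)$ of degree $+1$ satisfying the higher Jacobi identities, and an $\mathcal O$-linear anchor $\rho\colon\mathcal E_{-1}\to \mathrm{Der}(\mathcal O)$, such that $\ell_n$ is $\mathcal O$-multilinear for $n\neq 2$, $\ell_2(x,fy)=\rho(x)[f]\,y+f\,\ell_2(x,y)$ (with $\rho$ extended by zero to degrees $\le -2$), $\rho\circ\ell_1=0$ on $\mathcal E_{-2}$, and $\rho(\ell_2(x,y))=[\rho(x),\rho(y)]$ on $\mathcal E_{-1}$. It is acyclic if the complex $\cdots\xrightarrow{\ell_1}\mathcal E_{-2}\xrightarrow{\ell_1}\mathcal E_{-1}$ has no cohomology in degrees $\le -2$. It terminates in $\mathcal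 A$ through the hook $\pi\colon\mathcal E_{-1}\to\mathcal A$ if $\pi$ is $\mathcal O$-linear, $\pi(\ell_2(x,y))=[\pi(x),\pi(y)]_{\mathcal A}$ on $\mathcal E_{-1}$, $\rho_{\mathcal A}\circ\pi=\rho$ and $\pi\circ\ell_1=0$; it covers $\mathcal A$ through $\pi$ if moreover $\pi$ is surjective. A morphism of Lie $\infty$-algebroids from $\mathcal E'$ to $\mathcal E$ is a degree $0$ co-morphism $\Phi\colon S^\bullet_{\mathbb K}(\mathcal E')\to S^\bullet_{\mathbb K}(\mathcal E)$ of (reduced) graded symmetric coalgebras which intertwines the co-differentials corresponding to the brackets, whose Taylor coefficients $\Phi_r\colon S^{r+1}_{\mathbb K}(\mathcal E')\to S^\bullet_{\mathbb K}(\mathcal E)\to\mathcal E$ $(r\ge 0)$ are $\mathcal O$-multilinear, and with $\rho\circ\Phi_0=\rho'$ on $\mathcal E'_{-1}$; it is over $\mathcal A$ if $\pi\circ\Phi_0=\pi'$ on $\mathcal E'_{-1}$. **Proposition.** Let $(\mathcal E'_\bullet,\ell'_\bullet,\rho')$ be a Lie $\infty$-algebroid over $\mathcal O$ that terminates in $\mathcal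 A$ through a hook $\pi'$. Then there exist an acyclic Lie $\infty$-algebroid $(\mathcal E_\bullet,\ell_\bullet,\rho)$ that covers $\mathcal A$ through a hook $\pi$ with $\ker\pi=\ell_1(\mathcal E_{-2})$ (so that $\cdots\to\mathcal E_{-2}\to\mathcal E_{-1}\xrightarrow{\pi}\mathcal A\to 0$ is a projective resolution of $\mathcal A$), and injective $\mathcal O$-linear maps $\iota\colon\mathcal E'_{-i}\hookrightarrow\mathcal E_{-i}$ $(i\ge 1)$, such that 1. $\iota$ makes $\mathcal E'$ a subcomplex of $\mathcal E$ over $\mathcal A$, that is $\iota\circ\ell'_1=\ell_1\circ\iota$ and $\pi\circ\iota=\pi'$, and for every $i\ge 1$ there is a projective submodule $\mathcal V_{-i}\subseteq\mathcal E_{-i}$ with $\mathcal E_{-i}=\iota(\mathcal E'_{-i})\oplus\mathcal V_{-i}$; 2. there is a morphism of Lie $\infty$-algebroids $\Phi$ from $\mathcal E'$ to $\mathcal E$ over $\mathcal A$ with $\Phi_0=\iota$ and $\Phi_r=0$ for all $r\ge 1$. -/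

import Mathlib

open scoped DirectSum TensorProduct

universe k u v w w'

noncomputable section

namespace LieInfty

/-! ### The graded symmetric coalgebra

A negatively graded module `(E_{-1}, E_{-2}, …)` is given by `E : ℕ → Type*`, where `E i` stands
for the component of degree `-(i+1)`; the total space is `⨁ i, E i`. -/

/-- The degree `-(i+1)` of the elements of `E i`. -/
def deg (i : ℕ) : ℤ := -((i : ℤ) + 1)

section GSym

variable (K : Type k) [Field K] (E : ℕ → Type w) [∀ i, AddCommGroup (E i)] [∀ i, Module K (E i)]

/-- The relations `x ⊗ y = (-1)^{|x||y|} y ⊗ x` for homogeneous `x`, `y`, with tensor products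
over the field `K`. -/
inductive GSym.Rel :
    TensorAlgebra K (⨁ i, E i) → TensorAlgebra K (⨁ i, E i) → Prop
  | comm (i j : ℕ) (x : E i) (y : E j) :
    GSym.Rel
      (TensorAlgebra.ι K (DirectSum.lof K ℕ E i x) * TensorAlgebra.ι K (DirectSum.lof K ℕ E j y))
      ((-1 : K) ^ ((i + 1) * (j + 1)) •
        (TensorAlgebra.ι K (DirectSum.lof K ℕ E j y) *
          TensorAlgebra.ι K (DirectSum.lof K ℕ E i x)))

/-- The (unital) graded symmetric algebra over `K` of `⨁ i, E i`. It is the direct sum of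
`K · 1` and of the reduced graded symmetric algebra. -/
abbrev GSym : Type (max k w) := RingQuot (GSym.Rel K E)

namespace GSym

/-- The inclusion of the total space as the part of polynomial-degree one. -/
def ι : (⨁ i, E i) →ₗ[K] GSym K E :=
  (RingQuot.mkAlgHom K (GSym.Rel K E)).toLinearMap ∘ₗ TensorAlgebra.ι K

/-- The inclusion of the component of degree `-(i+1)`. -/
def gen (i : ℕ) : E i →ₗ[K] GSym K E := ι K E ∘ₗ DirectSum.lof K ℕ E i

variable {E}

/-- The monomial `x₁ ⋯ xₙ` (equal to `1` for the empty list). -/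
def mono (l : List (⨁ i, E i)) : GSym K E := (l.map (ι K E)).prod

variable {K}

theorem gen_mul_gen (i j : ℕ) (x : E i) (y : E j) :
    gen K E i x * gen K E j y
      = (-1 : K) ^ ((i + 1) * (j + 1)) • (gen K E j y * gen K E i x) := by
  have h := RingQuot.mkAlgHom_rel K (GSym.Rel.comm (K := K) (E := E) i j x y)
  rw [map_mul, map_smul, map_mul] at h
  exact h

/-- The universal property of the graded symmetric algebra. -/
def lift {B : Type*} [Semiring B] [Algebra K B] (f : (⨁ i, E i) →ₗ[K] B)
    (hf : ∀ (i j : ℕ) (x : E i) (y : E j),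
      f (DirectSum.lof K ℕ E i x) * f (DirectSum.lof K ℕ E j y)
        = (-1 : K) ^ ((i + 1) * (j + 1)) •
          (f (DirectSum.lof K ℕ E j y) * f (DirectSum.lof K ℕ E i x))) :
    GSym K E →ₐ[K] B :=
  RingQuot.liftAlgHom K ⟨TensorAlgebra.lift K f, by
    rintro _ _ ⟨i, j, x, y⟩
    simp only [map_mul, map_smul, TensorAlgebra.lift_ι_apply]
    exact hf i j x y⟩

theorem lift_ι {B : Type*} [Semiring B] [Algebra K B] (f : (⨁ i, E i) →ₗ[K] B) (hf)
    (x : ⨁ i, E i) : lift f hf (ι K E x) = f x := by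
  simp only [lift, ι, LinearMap.comp_apply, AlgHom.toLinearMap_apply]
  rw [RingQuot.liftAlgHom_mkAlgHom_apply, TensorAlgebra.lift_ι_apply]

theorem lift_gen {B : Type*} [Semiring B] [Algebra K B] (f : (⨁ i, E i) →ₗ[K] B) (hf)
    (i : ℕ) (x : E i) : lift f hf (gen K E i x) = f (DirectSum.lof K ℕ E i x) :=
  lift_ι f hf _

theorem algHom_ext {B : Type*} [Semiring B] [Algebra K B] {f g : GSym K E →ₐ[K] B}
    (h : ∀ i x, f (gen K E i x) = g (gen K E i x)) : f = g := by
  refine RingQuot.ringQuot_ext' K f g ?_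
  refine TensorAlgebra.hom_ext ?_
  refine DirectSum.linearMap_ext K fun i => ?_
  ext x
  exact h i x

variable (K E)

/-- The part of degree `d`: the span of the products `x₁ ⋯ xₙ` of homogeneous elements with
`|x₁| + ⋯ + |xₙ| = d`. -/
def degreePart (d : ℤ) : Submodule K (GSym K E) :=
  Submodule.span K {a | ∃ l : List (Σ i, E i),
    (l.map fun p => deg p.1).sum = d ∧ (l.map fun p => gen K E p.1 p.2).prod = a}

theorem gen_mem (i : ℕ) (x : E i) : gen K E i x ∈ degreePart K E (deg i) :=
  Submodule.subset_span ⟨[⟨i, x⟩], by simp, by simp⟩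

instance gradedMonoid : SetLike.GradedMonoid (degreePart K E) where
  one_mem := Submodule.subset_span ⟨[], by simp, by simp⟩
  mul_mem i j a b ha hb := by
    have h := Submodule.mul_mem_mul ha hb
    rw [degreePart, degreePart, Submodule.span_mul_span] at h
    refine Submodule.span_mono ?_ h
    rintro _ ⟨_, ⟨l, rfl, rfl⟩, _, ⟨m, rfl, rfl⟩, rfl⟩
    exact ⟨l ++ m, by simp, by simp⟩

/-- The inclusion of the generators, with values in the sum of the homogeneous parts. -/
def gradedι : (⨁ i, E i) →ₗ[K] ⨁ d, degreePart K E d :=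
  DirectSum.toModule K ℕ _ fun i =>
    DirectSum.lof K ℤ (fun d => degreePart K E d) (deg i) ∘ₗ
      (gen K E i).codRestrict _ (gen_mem K E i)

theorem gradedι_lof (i : ℕ) (x : E i) :
    gradedι K E (DirectSum.lof K ℕ E i x)
      = DirectSum.of (fun d => degreePart K E d) (deg i) ⟨gen K E i x, gen_mem K E i x⟩ := by
  simp only [gradedι, DirectSum.toModule_lof]
  rfl

theorem gradedι_comm (i j : ℕ) (x : E i) (y : E j) :
    gradedι K E (DirectSum.lof K ℕ E i x) * gradedι K E (DirectSum.lof K ℕ E j y)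
      = (-1 : K) ^ ((i + 1) * (j + 1)) •
        (gradedι K E (DirectSum.lof K ℕ E j y) * gradedι K E (DirectSum.lof K ℕ E i x)) := by
  rw [gradedι_lof, gradedι_lof, DirectSum.of_mul_of, DirectSum.of_mul_of,
    ← DirectSum.lof_eq_of K, ← DirectSum.lof_eq_of K, ← map_smul, DirectSum.lof_eq_of,
    DirectSum.lof_eq_of]
  exact DirectSum.of_eq_of_gradedMonoid_eq
    (Sigma.subtype_ext (add_comm _ _) (gen_mul_gen i j x y))

theorem prod_gen_mem (l : List (Σ i, E i)) :
    (l.map fun p => gen K E p.1 p.2).prod ∈ degreePart K E (l.map fun p => deg p.1).sum :=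
  Submodule.subset_span ⟨l, rfl, rfl⟩

theorem lift_gradedι_prod (l : List (Σ i, E i)) :
    lift (gradedι K E) (gradedι_comm K E) (l.map fun p => gen K E p.1 p.2).prod
      = DirectSum.of (fun d => degreePart K E d) (l.map fun p => deg p.1).sum
          ⟨_, prod_gen_mem K E l⟩ := by
  induction l with
  | nil =>
    simp only [List.map_nil, List.prod_nil, map_one]
    rfl
  | cons p l ih =>
    simp only [List.map_cons, List.prod_cons, map_mul]
    rw [ih, lift_gen, gradedι_lof, DirectSum.of_mul_of]
    rfl

/-- The graded symmetric algebra is a `ℤ`-graded algebra. -/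
instance gradedAlgebra : GradedAlgebra (degreePart K E) :=
  GradedAlgebra.ofAlgHom _ (lift (gradedι K E) (gradedι_comm K E))
    (algHom_ext fun i x => by
      rw [AlgHom.comp_apply, lift_gen, gradedι_lof, DirectSum.coeAlgHom_of]
      rfl)
    (by
      rintro d ⟨a, ha⟩
      dsimp only
      induction ha using Submodule.span_induction with
      | mem a h =>
        obtain ⟨l, rfl, rfl⟩ := h
        exact lift_gradedι_prod K E l
      | zero => rw [map_zero]; exact (map_zero _).symm
      | add a b ha hb iha ihb => rw [map_add, iha, ihb, ← map_add]; rfl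
      | smul c a ha ih =>
        rw [map_smul, ih, ← DirectSum.lof_eq_of K, ← map_smul]; rfl)

/-- The map `x ↦ x ⊗ 1 + 1 ⊗ x` on generators. -/
def primitive : (⨁ i, E i) →ₗ[K] degreePart K E ᵍ⊗[K] degreePart K E :=
  (GradedTensorProduct.includeLeft (degreePart K E) (degreePart K E)).toLinearMap ∘ₗ ι K E +
    (GradedTensorProduct.includeRight (degreePart K E) (degreePart K E)).toLinearMap ∘ₗ ι K E

theorem koszul_sign (i j : ℕ) :
    (((-1 : ℤˣ) ^ (deg j * deg i) : ℤˣ) : ℤ) = (-1) ^ ((i + 1) * (j + 1)) := by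
  have h : deg j * deg i = (((i + 1) * (j + 1) : ℕ) : ℤ) := by
    simp only [deg]; push_cast; ring
  rw [h, uzpow_natCast]
  simp

theorem primitive_comm (i j : ℕ) (x : E i) (y : E j) :
    primitive K E (DirectSum.lof K ℕ E i x) * primitive K E (DirectSum.lof K ℕ E j y)
      = (-1 : K) ^ ((i + 1) * (j + 1)) •
        (primitive K E (DirectSum.lof K ℕ E j y) * primitive K E (DirectSum.lof K ℕ E i x)) := by
  have key : ∀ (i j : ℕ) (x : E i) (y : E j),
      primitive K E (DirectSum.lof K ℕ E i x) * primitive K E (DirectSum.lof K ℕ E j y)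
        = (gen K E i x * gen K E j y) ᵍ⊗ₜ[K] 1 + gen K E i x ᵍ⊗ₜ[K] gen K E j y
          + ((-1 : K) ^ ((i + 1) * (j + 1)) • (gen K E j y ᵍ⊗ₜ[K] gen K E i x)
          + 1 ᵍ⊗ₜ[K] (gen K E i x * gen K E j y)) := by
    intro i j x y
    have h1 : ∀ (i : ℕ) (x : E i), primitive K E (DirectSum.lof K ℕ E i x)
        = (gen K E i x ᵍ⊗ₜ[K] 1 + 1 ᵍ⊗ₜ[K] gen K E i x :
          degreePart K E ᵍ⊗[K] degreePart K E) := fun _ _ => rfl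
    have h2 := GradedTensorProduct.tmul_coe_mul_coe_tmul (R := K) (𝒜 := degreePart K E)
      (ℬ := degreePart K E) 1 ⟨gen K E i x, gen_mem K E i x⟩ ⟨gen K E j y, gen_mem K E j y⟩ 1
    have h3 := GradedTensorProduct.tmul_one_mul_coe_tmul (R := K) (𝒜 := degreePart K E)
      (ℬ := degreePart K E) (gen K E i x) ⟨gen K E j y, gen_mem K E j y⟩ 1
    have h4 := GradedTensorProduct.tmul_coe_mul_one_tmul (R := K) (𝒜 := degreePart K E)
      (ℬ := degreePart K E) 1 ⟨gen K E i x, gen_mem K E i x⟩ (gen K E j y)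
    have h5 := GradedTensorProduct.tmul_one_mul_one_tmul (R := K) (𝒜 := degreePart K E)
      (ℬ := degreePart K E) (gen K E i x) (gen K E j y)
    dsimp only at h2 h3 h4 h5
    rw [Units.smul_def, koszul_sign, one_mul, mul_one] at h2
    rw [h1, h1, add_mul, mul_add, mul_add, h2, h3, h4, h5, ← Int.cast_smul_eq_zsmul K,
      mul_comm (j + 1) (i + 1)]
    push_cast
    rfl
  have hs : (-1 : K) ^ ((i + 1) * (j + 1)) * (-1 : K) ^ ((i + 1) * (j + 1)) = 1 := by
    rw [← mul_pow]; simp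
  have hl : ∀ (c : K) (a b : GSym K E),
      ((c • a) ᵍ⊗ₜ[K] b : degreePart K E ᵍ⊗[K] degreePart K E) = c • a ᵍ⊗ₜ[K] b := fun c a b => by
    rw [← map_smul, TensorProduct.smul_tmul']
  have hr : ∀ (c : K) (a b : GSym K E),
      (a ᵍ⊗ₜ[K] (c • b) : degreePart K E ᵍ⊗[K] degreePart K E) = c • a ᵍ⊗ₜ[K] b := fun c a b => by
    rw [← map_smul, ← TensorProduct.tmul_smul]
  rw [key, key, gen_mul_gen i j x y, mul_comm (j + 1) (i + 1), hl, hr, smul_add, smul_add,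
    smul_add, smul_smul, hs, one_smul]
  abel

/-- The coproduct of the graded symmetric algebra as an algebra morphism: the tensor square
carries the product `(a ⊗ b)(a' ⊗ b') = (-1)^{|b||a'|} aa' ⊗ bb'`, and generators are primitive.
Thus `x₁ ⋯ xₙ` is sent to the sum over all `0 ≤ i ≤ n` and all `(i, n-i)`-shuffles `σ` of
`ε(σ) x_{σ(1)} ⋯ x_{σ(i)} ⊗ x_{σ(i+1)} ⋯ x_{σ(n)}`. The coproduct of the reduced symmetric
algebra is obtained by leaving out the terms with `i = 0` and `i = n`. -/
def comulAlgHom : GSym K E →ₐ[K] degreePart K E ᵍ⊗[K] degreePart K E :=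
  lift (primitive K E) (primitive_comm K E)

/-- The coproduct and the counit (the projection to `K · 1`). -/
instance coalgebraStruct : CoalgebraStruct K (GSym K E) where
  comul := (GradedTensorProduct.of K (degreePart K E) (degreePart K E)).symm.toLinearMap ∘ₗ
    (comulAlgHom K E).toLinearMap
  counit := (lift (B := K) (0 : (⨁ i, E i) →ₗ[K] K) (by simp)).toLinearMap

/-- The projection onto the part of polynomial-degree one. It is zero on `1` and on all products
of at least two generators. -/
def pr : GSym K E →ₗ[K] ⨁ i, E i :=
  letI : Module Kᵐᵒᵖ (⨁ i, E i) := Module.compHom _ ((RingHom.id K).fromOpposite mul_comm)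
  haveI : IsCentralScalar K (⨁ i, E i) := ⟨fun _ _ => rfl⟩
  TrivSqZeroExt.sndHom K (⨁ i, E i) ∘ₗ
    (lift (TrivSqZeroExt.inrHom K (⨁ i, E i)) (by simp)).toLinearMap

variable {K E}

/-- The co-derivation of the graded symmetric coalgebra with Taylor coefficients `H`:
`x₁ ⋯ xₙ` is sent to the sum over all `i` and all `(i, n-i)`-shuffles `σ` of
`ε(σ) H(x_{σ(1)} ⋯ x_{σ(i)}) · x_{σ(i+1)} ⋯ x_{σ(n)}`. -/
def coderivation (H : GSym K E →ₗ[K] ⨁ i, E i) : GSym K E →ₗ[K] GSym K E :=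
  LinearMap.mul' K (GSym K E) ∘ₗ TensorProduct.map (ι K E ∘ₗ H) LinearMap.id ∘ₗ
    CoalgebraStruct.comul

end GSym

end GSym

/-! ### Lie ∞-algebroids -/

/-- A negatively graded Lie ∞-algebroid over the `K`-algebra `O`, on the `O`-modules
`E_{-(i+1)} = E i`. -/
structure LieInftyAlgebroid (K : Type k) [Field K] (O : Type u) [CommRing O] [Algebra K O]
    (E : ℕ → Type w) [∀ i, AddCommGroup (E i)] [∀ i, Module O (E i)] [∀ i, Module K (E i)]
    [∀ i, IsScalarTower K O (E i)] where
  projective : ∀ i, Module.Projective O (E i)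
  /-- All brackets at once: the `n`-ary bracket is the restriction to polynomial-degree `n`. -/
  bracket : GSym K E →ₗ[K] ⨁ i, E i
  /-- There is no bracket without arguments. -/
  bracket_one : bracket 1 = 0
  /-- The brackets have degree `+1`. -/
  bracket_degree : ∀ (d : ℤ), ∀ a ∈ GSym.degreePart K E d, ∀ i, bracket a i ≠ 0 → deg i = d + 1
  /-- The anchor map. -/
  anchor : E 0 →ₗ[O] Derivation K O O
  /-- The higher Jacobi identities: on `x₁ ⋯ xₙ` the left-hand side is the sum over `i` and over
  all `(i, n-i)`-shuffles `σ` of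
  `ε(σ) ℓ_{n-i+1}(ℓ_i(x_{σ(1)}, …, x_{σ(i)}), x_{σ(i+1)}, …, x_{σ(n)})`. -/
  jacobi : bracket ∘ₗ GSym.coderivation bracket = 0
  /-- The `n`-ary brackets with `n ≠ 2` are `O`-multilinear. -/
  bracket_smul : ∀ (l m : List (⨁ i, E i)) (f : O) (x : ⨁ i, E i), l.length + 1 + m.length ≠ 2 →
    bracket (GSym.mono K (l ++ (f • x) :: m)) = f • bracket (GSym.mono K (l ++ x :: m))
  /-- The Leibniz identity, the anchor being extended by zero to degrees `≤ -2`. -/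
  leibniz : ∀ (x y : ⨁ i, E i) (f : O),
    bracket (GSym.mono K [x, f • y]) = anchor (x 0) f • y + f • bracket (GSym.mono K [x, y])
  anchor_bracket_unary : ∀ x : E 1,
    anchor (bracket (GSym.mono K [DirectSum.lof K ℕ E 1 x]) 0) = 0
  anchor_bracket_binary : ∀ x y : E 0,
    anchor (bracket (GSym.mono K [DirectSum.lof K ℕ E 0 x, DirectSum.lof K ℕ E 0 y]) 0)
      = ⁅anchor x, anchor y⁆

namespace LieInftyAlgebroid

section Basic

variable {K : Type k} [Field K] {O : Type u} [CommRing O] [Algebra K O]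
  {E : ℕ → Type w} [∀ i, AddCommGroup (E i)] [∀ i, Module O (E i)] [∀ i, Module K (E i)]
  [∀ i, IsScalarTower K O (E i)]

/-- The co-differential of the graded symmetric coalgebra that corresponds to the brackets. -/
def Q (L : LieInftyAlgebroid K O E) : GSym K E →ₗ[K] GSym K E := GSym.coderivation L.bracket

/-- The unary bracket `ℓ₁ : E_{-(i+2)} → E_{-(i+1)}`. -/
def d (L : LieInftyAlgebroid K O E) (i : ℕ) : E (i + 1) →ₗ[O] E i where
  toFun x := L.bracket (GSym.mono K [DirectSum.lof K ℕ E (i + 1) x]) i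
  map_add' x y := by simp [GSym.mono]
  map_smul' f x := by
    have h := L.bracket_smul [] [] f (DirectSum.lof O ℕ E (i + 1) x) (by simp)
    rw [← map_smul] at h
    exact congrArg (fun v => v i) h

/-- The restriction of the binary bracket to `E_{-1}`. -/
def binary (L : LieInftyAlgebroid K O E) (x y : E 0) : E 0 :=
  L.bracket (GSym.mono K [DirectSum.lof K ℕ E 0 x, DirectSum.lof K ℕ E 0 y]) 0

/-- The complex `⋯ → E_{-3} → E_{-2} → E_{-1}` has no cohomology in degrees `≤ -2`. -/
def Acyclic (L : LieInftyAlgebroid K O E) : Prop :=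
  ∀ i, Function.Exact (L.d (i + 1)) (L.d i)

variable {A : Type v} [LieRing A] [Module O A] [LieRingModule A O] [LieRinehartRing O A]
  [LieAlgebra K A] [LieRinehartAlgebra K O A]

/-- `L` terminates in the Lie-Rinehart algebra `A` through the hook `π`: the `O`-linear map `π` is
compatible with brackets and anchors, and `⋯ → E_{-2} → E_{-1} → A` is a complex. -/
structure TerminatesIn (L : LieInftyAlgebroid K O E) (π : E 0 →ₗ[O] A) : Prop where
  map_bracket : ∀ x y, π (L.binary x y) = ⁅π x, π y⁆
  anchor_comp : ∀ x, LieRinehartAlgebra.anchor K O A (π x) = L.anchor x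
  comp_d : ∀ x, π (L.d 0 x) = 0

/-- `L` covers the Lie-Rinehart algebra `A` through the hook `π`. -/
structure Covers (L : LieInftyAlgebroid K O E) (π : E 0 →ₗ[O] A) : Prop
    extends L.TerminatesIn π where
  surjective : Function.Surjective π

end Basic

section Hom

variable {K : Type k} [Field K] {O : Type u} [CommRing O] [Algebra K O]
  {E' : ℕ → Type w'} [∀ i, AddCommGroup (E' i)] [∀ i, Module O (E' i)] [∀ i, Module K (E' i)]
  [∀ i, IsScalarTower K O (E' i)]
  {E : ℕ → Type w} [∀ i, AddCommGroup (E i)] [∀ i, Module O (E i)] [∀ i, Module K (E i)]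
  [∀ i, IsScalarTower K O (E i)]

/-- The Taylor coefficients of a linear map between graded symmetric coalgebras; the `r`-th one is
the case of lists of length `r + 1`. -/
def taylor (Φ : GSym K E' →ₗ[K] GSym K E) (l : List (⨁ i, E' i)) : ⨁ i, E i :=
  GSym.pr K E (Φ (GSym.mono K l))

/-- A Lie ∞-algebroid morphism: a co-morphism of degree zero (coaugmented, so that it is the same
thing as a co-morphism of the reduced coalgebras) that intertwines the co-differentials, has
`O`-multilinear Taylor coefficients, and is compatible with the anchors. -/
structure Hom (L' : LieInftyAlgebroid K O E') (L : LieInftyAlgebroid K O E) where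
  toCoalgHom : GSym K E' →ₗc[K] GSym K E
  map_one : toCoalgHom 1 = 1
  map_degree : ∀ (d : ℤ), ∀ a ∈ GSym.degreePart K E' d, toCoalgHom a ∈ GSym.degreePart K E d
  comp_Q : toCoalgHom.toLinearMap ∘ₗ L'.Q = L.Q ∘ₗ toCoalgHom.toLinearMap
  taylor_smul : ∀ (l m : List (⨁ i, E' i)) (f : O) (x : ⨁ i, E' i),
    taylor toCoalgHom.toLinearMap (l ++ (f • x) :: m)
      = f • taylor toCoalgHom.toLinearMap (l ++ x :: m)
  anchor_comp : ∀ x : E' 0,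
    L.anchor (taylor toCoalgHom.toLinearMap [DirectSum.lof K ℕ E' 0 x] 0) = L'.anchor x

/-- The Taylor coefficients of a Lie ∞-algebroid morphism. -/
def Hom.coeff {L' : LieInftyAlgebroid K O E'} {L : LieInftyAlgebroid K O E} (Φ : L'.Hom L)
    (l : List (⨁ i, E' i)) : ⨁ i, E i :=
  taylor Φ.toCoalgHom.toLinearMap l

/-- The morphism `Φ` is over `A` with respect to the hooks `π'` and `π`. -/
def Hom.IsOver {A : Type v} [AddCommGroup A] [Module O A]
    {L' : LieInftyAlgebroid K O E'} {L : LieInftyAlgebroid K O E} (Φ : L'.Hom L)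
    (π' : E' 0 →ₗ[O] A) (π : E 0 →ₗ[O] A) : Prop :=
  ∀ x : E' 0, π (Φ.coeff [DirectSum.lof K ℕ E' 0 x] 0) = π' x

end Hom

end LieInftyAlgebroid

end LieInfty

end

/-! The complex of `E'` is enlarged to a resolution of `A` by free modules: generators indexed by
the elements of `A` make the hook surjective, and then each degree receives one generator for every
cycle of the step before (`resolution`). Thus `E'` is a direct summand with free complement in each
degree, and only the brackets remain to be extended.

All brackets together are one linear map `H` on the graded symmetric coalgebra, and the higher
Jacobi identities say that the Jacobiator `jac H = H ∘ₗ coderivation H` vanishes. The start is an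
`H` that extends the brackets of `E'`, satisfies the Leibniz identity, has the differential as unary
part and lifts the bracket of `A` (`exists_isAlmost`). Its Jacobiator is `O`-multilinear
(`isMultilinear_jac`), lies in the kernel of the hook by the Jacobi identity of `A` (`aug_jac`), and
is a cocycle in degree `d` once it vanishes above `d` (`D_jac`, which rests on `coderivation_sq`).
Exactness then gives a primitive, and subtracting it kills the Jacobiator in degree `d` without
touching higher degrees (`jac_improve`). There are no positive degrees, so the induction starts for
free; it becomes stationary in every degree and has a limit (`exists_jac_eq_zero`).

Primitives come from a contraction `σ` that is only `K`-linear. Projectivity repairs this: the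
action `O ⊗ E i → E i` splits, and a splitting yields an operator `multilin` that makes any
`K`-linear map multilinear, fixes multilinear maps and commutes with `O`-linear maps. In the degree
to be corrected, `D ∘ σ ∘ jac H = jac H` therefore becomes `D ∘ multilin (σ ∘ jac H) = multilin (jac
H) = jac H`. If the splittings are compatible with the inclusion of `E'`, all corrections vanish on
`E'`, because the Jacobiator does (`exists_extension`). So the inclusion stays compatible with all
brackets and is a strict morphism.

Sums over shuffles never appear: identities are proved by peeling off one generator at a time, by
means of `comul_gen_mul` and `coderivation_gen_mul`. -/

open scoped DirectSum TensorProduct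

noncomputable section

set_option linter.unusedSectionVars false

namespace LieInfty

namespace GSym

/-! ### Koszul signs with integer exponents. -/

section Sign

variable (K : Type k) [Field K]

/-- The sign `(-1)ⁿ`. -/
def sgn (n : ℤ) : K := (-1 : K) ^ n

@[simp] theorem sgn_zero : sgn K 0 = 1 := zpow_zero _

theorem sgn_add (m n : ℤ) : sgn K (m + n) = sgn K m * sgn K n :=
  zpow_add₀ (neg_ne_zero.2 one_ne_zero) m n

theorem sgn_neg (n : ℤ) : sgn K (-n) = sgn K n := by
  rw [sgn, sgn, zpow_neg, ← inv_zpow, inv_neg_one]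

@[simp] theorem sgn_mul_self (n : ℤ) : sgn K n * sgn K n = 1 := by
  rw [← sgn_add, ← two_mul, sgn, zpow_mul]; simp

@[simp] theorem sgn_one : sgn K 1 = -1 := zpow_one _

@[simp] theorem sgn_neg_one : sgn K (-1) = -1 := by rw [sgn_neg, sgn_one]

theorem neg_one_pow_eq_sgn (i j : ℕ) : (-1 : K) ^ ((i + 1) * (j + 1)) = sgn K (deg i * deg j) := by
  have h : deg i * deg j = (((i + 1) * (j + 1) : ℕ) : ℤ) := by
    simp only [deg]; push_cast; ring
  rw [h, sgn, zpow_natCast]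

theorem units_smul_eq_sgn_smul {M : Type*} [AddCommGroup M] [Module K M] (n : ℤ) (x : M) :
    ((-1 : ℤˣ) ^ n) • x = sgn K n • x := by
  rcases Int.even_or_odd n with h | h
  · rw [sgn, h.neg_one_zpow, h.neg_one_zpow, one_smul, one_smul]
  · rw [sgn, h.neg_one_zpow, h.neg_one_zpow, neg_smul, one_smul, Units.neg_smul, one_smul]

end Sign

variable {K : Type k} [Field K] {E : ℕ → Type w} [∀ i, AddCommGroup (E i)] [∀ i, Module K (E i)]

theorem deg_injective : Function.Injective deg := fun i j h => by
  simp only [deg] at h; omega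

/-! #### Induction principles -/

/-- Letting the motive depend on the degree keeps the degree of the remaining factor available.
Since generators are multiplied on the left, the induction matches the recursions for the coproduct
and for co-derivations. -/
theorem degreePart_induction {P : ℤ → GSym K E → Prop} (zero : ∀ d, P d 0) (one : P 0 1)
    (gen_mul : ∀ d i x a, a ∈ degreePart K E d → P d a → P (deg i + d) (gen K E i x * a))
    (add : ∀ d a b, P d a → P d b → P d (a + b)) (smul : ∀ d (c : K) a, P d a → P d (c • a))
    {d : ℤ} {a : GSym K E} (ha : a ∈ degreePart K E d) : P d a := by
  induction ha using Submodule.span_induction with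
  | mem a h =>
    obtain ⟨l, rfl, rfl⟩ := h
    induction l with
    | nil => exact one
    | cons p l ih =>
      rw [List.map_cons, List.map_cons, List.sum_cons, List.prod_cons]
      exact gen_mul _ _ _ _ (prod_gen_mem K E l) ih
  | zero => exact zero d
  | add a b _ _ iha ihb => exact add d a b iha ihb
  | smul c a _ ih => exact smul d c a ih

theorem homogeneous_induction {P : GSym K E → Prop} (zero : P 0)
    (mem : ∀ d, ∀ a ∈ degreePart K E d, P a) (add : ∀ a b, P a → P b → P (a + b))
    (a : GSym K E) : P a :=
  DirectSum.Decomposition.inductionOn (degreePart K E) zero (fun m => mem _ m m.2) add a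

theorem gen_induction {P : GSym K E → Prop} (one : P 1)
    (gen_mul : ∀ i x a, P a → P (gen K E i x * a))
    (add : ∀ a b, P a → P b → P (a + b)) (smul : ∀ (c : K) a, P a → P (c • a))
    (a : GSym K E) : P a := by
  have zero : P 0 := by simpa using smul 0 1 one
  exact homogeneous_induction zero
    (fun d a ha => degreePart_induction (P := fun _ a => P a) (fun _ => zero) one
      (fun _ i x a _ => gen_mul i x a) (fun _ => add) (fun _ => smul) ha) add a

theorem linearMap_ext {M : Type*} [AddCommMonoid M] [Module K M] {f g : GSym K E →ₗ[K] M}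
    (h : ∀ d, ∀ a ∈ degreePart K E d, f a = g a) : f = g :=
  LinearMap.ext fun a => homogeneous_induction (by simp) h
    (fun a b ha hb => by rw [map_add, map_add, ha, hb]) a

/-- All generators have negative degree. This is what makes the first step of the later
degree-by-degree correction trivial. -/
theorem eq_zero_of_mem_degreePart {d : ℤ} (hd : 0 < d) {a : GSym K E}
    (ha : a ∈ degreePart K E d) : a = 0 := by
  -- The alternative `a = 0` is needed because zero belongs to every degree, so that `d ≤ 0` alone
  -- cannot be proved.
  have := degreePart_induction (P := fun d a => d ≤ 0 ∧ (0 < d → a = 0) ∨ a = 0) (K := K) (E := E)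
    (fun _ => Or.inr rfl) (Or.inl ⟨le_rfl, fun h => absurd h (lt_irrefl _)⟩)
    (fun d i x a _ h => by
      rcases h with h | rfl
      · have : deg i < 0 := by simp only [deg]; omega
        exact Or.inl ⟨by omega, fun h' => by omega⟩
      · exact Or.inr (mul_zero _))
    (fun d a b ha hb => by
      rcases ha with ha | rfl
      · exact Or.inl ⟨ha.1, fun h => by omega⟩
      · simpa using hb)
    (fun d c a ha => by
      rcases ha with ha | rfl
      · exact Or.inl ⟨ha.1, fun h => by omega⟩
      · exact Or.inr (smul_zero _)) ha
  rcases this with h | h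
  · omega
  · exact h

/-! #### The parity automorphisms and graded commutativity -/

variable (K E) in
/-- The algebra automorphism `a ↦ (-1)^{m |a|} a`. -/
def signAut (m : ℤ) : GSym K E →ₐ[K] GSym K E :=
  lift (DirectSum.toModule K ℕ _ fun j => sgn K (m * deg j) • gen K E j) (by
    intro i j x y
    simp only [DirectSum.toModule_lof, LinearMap.smul_apply, smul_mul_smul_comm]
    rw [gen_mul_gen i j x y, smul_comm, mul_comm (sgn K _)])

theorem signAut_gen (m : ℤ) (i : ℕ) (x : E i) :
    signAut K E m (gen K E i x) = sgn K (m * deg i) • gen K E i x := by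
  rw [signAut, lift_gen, DirectSum.toModule_lof, LinearMap.smul_apply]

theorem signAut_of_mem (m : ℤ) {d : ℤ} {a : GSym K E} (ha : a ∈ degreePart K E d) :
    signAut K E m a = sgn K (m * d) • a := by
  refine degreePart_induction (P := fun d a => signAut K E m a = sgn K (m * d) • a) ?_ ?_ ?_ ?_ ?_
    ha
  · intro d; rw [map_zero, smul_zero]
  · rw [map_one, mul_zero, sgn_zero, one_smul]
  · intro d i x a _ h
    rw [map_mul, h, signAut_gen, smul_mul_smul_comm, mul_add, sgn_add]
  · intro d a b ha hb; rw [map_add, ha, hb, smul_add]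
  · intro d c a h; rw [map_smul, h, smul_comm]

/-- `signAut` records the Koszul sign of moving a generator past `a` without splitting `a` into
homogeneous parts. -/
theorem mul_gen (i : ℕ) (x : E i) (a : GSym K E) :
    a * gen K E i x = gen K E i x * signAut K E (deg i) a := by
  induction a using gen_induction with
  | one => rw [map_one, one_mul, mul_one]
  | gen_mul j y a ih =>
    rw [mul_assoc, ih, map_mul, signAut_gen, ← mul_assoc, ← mul_assoc, gen_mul_gen j i y x,
      neg_one_pow_eq_sgn, mul_comm (deg j), smul_mul_assoc, mul_smul_comm, smul_mul_assoc]
  | add a b ha hb => rw [add_mul, ha, hb, map_add, mul_add]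
  | smul c a h => rw [smul_mul_assoc, h, map_smul, mul_smul_comm]

/-! #### Recursion for the coproduct -/

/-- Left multiplication by a generator. -/
abbrev mulGen (i : ℕ) (x : E i) : GSym K E →ₗ[K] GSym K E := LinearMap.mulLeft K (gen K E i x)

theorem comul_one : CoalgebraStruct.comul (R := K) (1 : GSym K E) = 1 ⊗ₜ 1 := by
  change (GradedTensorProduct.of K (degreePart K E) (degreePart K E)).symm (comulAlgHom K E 1) = _
  rw [_root_.map_one]; rfl

/-- In `(x ⊗ 1 + 1 ⊗ x)(b ⊗ c)` the second summand moves `x` past `b`; this sign is absorbed by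
`signAut` on the left factor. -/
theorem primitive_mul (i : ℕ) (x : E i) (t : GSym K E ⊗[K] GSym K E) :
    (GradedTensorProduct.of K (degreePart K E) (degreePart K E)).symm
      (primitive K E (DirectSum.lof K ℕ E i x) *
        GradedTensorProduct.of K (degreePart K E) (degreePart K E) t)
      = TensorProduct.map (mulGen i x) LinearMap.id t
        + TensorProduct.map (signAut K E (deg i)).toLinearMap (mulGen i x) t := by
  induction t using TensorProduct.induction_on with
  | zero => simp only [map_zero, mul_zero, add_zero]
  | add s t hs ht =>
    rw [map_add, mul_add, map_add, hs, ht, map_add, map_add]; abel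
  | tmul b c =>
    induction b using homogeneous_induction with
    | zero => simp only [TensorProduct.zero_tmul, map_zero, mul_zero, add_zero]
    | add a b ha hb =>
      rw [TensorProduct.add_tmul, map_add, mul_add, map_add, ha, hb, map_add, map_add]; abel
    | mem d b hb =>
      have h1 : primitive K E (DirectSum.lof K ℕ E i x)
        = (gen K E i x ᵍ⊗ₜ[K] 1 + 1 ᵍ⊗ₜ[K] gen K E i x :
          degreePart K E ᵍ⊗[K] degreePart K E) := rfl
      have h2 := GradedTensorProduct.tmul_coe_mul_coe_tmul (R := K) (𝒜 := degreePart K E)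
        (ℬ := degreePart K E) 1 ⟨gen K E i x, gen_mem K E i x⟩ ⟨b, hb⟩ c
      have h3 := GradedTensorProduct.tmul_one_mul_coe_tmul (R := K) (𝒜 := degreePart K E)
        (ℬ := degreePart K E) (gen K E i x) ⟨b, hb⟩ c
      dsimp only at h2 h3
      have h4 : GradedTensorProduct.of K (degreePart K E) (degreePart K E) (b ⊗ₜ[K] c)
        = b ᵍ⊗ₜ[K] c := rfl
      rw [h1, h4, add_mul, h2, h3, units_smul_eq_sgn_smul K, map_add, map_smul,
        TensorProduct.map_tmul, TensorProduct.map_tmul, AlgHom.toLinearMap_apply,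
        signAut_of_mem _ hb, ← TensorProduct.smul_tmul', one_mul]
      rfl

/-- The coproduct is an algebra morphism and `x` is primitive. This recursion replaces all sums over
shuffles in what follows. -/
theorem comul_gen_mul (i : ℕ) (x : E i) (a : GSym K E) :
    CoalgebraStruct.comul (R := K) (gen K E i x * a)
      = TensorProduct.map (mulGen i x) LinearMap.id (CoalgebraStruct.comul (R := K) a)
        + TensorProduct.map (signAut K E (deg i)).toLinearMap (mulGen i x)
          (CoalgebraStruct.comul (R := K) a) := by
  rw [← primitive_mul]
  change (GradedTensorProduct.of K (degreePart K E) (degreePart K E)).symm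
    (comulAlgHom K E (gen K E i x * a)) = _
  rw [map_mul, comulAlgHom, lift_gen]
  rfl

end GSym
end LieInfty

namespace LieInfty

namespace GSym

variable {K : Type k} [Field K] {E : ℕ → Type w} [∀ i, AddCommGroup (E i)] [∀ i, Module K (E i)]
  {M N P P' : Type*} [AddCommGroup M] [Module K M] [AddCommGroup N] [Module K N]
  [AddCommGroup P] [Module K P] [AddCommGroup P'] [Module K P']

/-! #### Counit and projection to the generators -/

variable (K E) in
/-- The augmentation, as an algebra morphism. -/
def aug : GSym K E →ₐ[K] K := lift (B := K) (0 : (⨁ i, E i) →ₗ[K] K) (by simp)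

theorem aug_gen (i : ℕ) (x : E i) : aug K E (gen K E i x) = 0 := by
  rw [aug, lift_gen, LinearMap.zero_apply]

theorem aug_gen_mul (i : ℕ) (x : E i) (a : GSym K E) : aug K E (gen K E i x * a) = 0 := by
  rw [map_mul, aug_gen, zero_mul]

theorem aug_signAut (m : ℤ) (a : GSym K E) : aug K E (signAut K E m a) = aug K E a := by
  have : (aug K E).comp (signAut K E m) = aug K E := algHom_ext fun i x => by
    rw [AlgHom.comp_apply, signAut_gen, map_smul, aug_gen, smul_zero]
  exact DFunLike.congr_fun this a

theorem pr_one : pr K E 1 = 0 := by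
  let _ : Module Kᵐᵒᵖ (⨁ i, E i) := Module.compHom _ ((RingHom.id K).fromOpposite mul_comm)
  have : IsCentralScalar K (⨁ i, E i) := ⟨fun _ _ => rfl⟩
  change TrivSqZeroExt.snd (lift (TrivSqZeroExt.inrHom K (⨁ i, E i)) (by simp) 1) = 0
  rw [_root_.map_one, TrivSqZeroExt.snd_one]

/-- In the trivial square-zero extension a generator has scalar part zero, so only the scalar part
of `a` survives in the product; that part is the augmentation. -/
theorem pr_gen_mul (i : ℕ) (x : E i) (a : GSym K E) :
    pr K E (gen K E i x * a) = aug K E a • DirectSum.lof K ℕ E i x := by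
  let _ : Module Kᵐᵒᵖ (⨁ i, E i) := Module.compHom _ ((RingHom.id K).fromOpposite mul_comm)
  have : IsCentralScalar K (⨁ i, E i) := ⟨fun _ _ => rfl⟩
  have h : (TrivSqZeroExt.fstHom K K (⨁ i, E i)).comp
      (lift (TrivSqZeroExt.inrHom K (⨁ i, E i)) (by simp)) = aug K E :=
    algHom_ext fun i x => by rw [AlgHom.comp_apply, lift_gen, aug_gen]; simp
  change TrivSqZeroExt.snd (lift (TrivSqZeroExt.inrHom K (⨁ i, E i)) (by simp)
    (gen K E i x * a)) = _
  rw [← h, map_mul, lift_gen, TrivSqZeroExt.snd_mul]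
  simp

theorem pr_gen (i : ℕ) (x : E i) : pr K E (gen K E i x) = DirectSum.lof K ℕ E i x := by
  have := pr_gen_mul (K := K) i x 1
  rwa [mul_one, map_one, one_smul] at this

theorem ι_lof (i : ℕ) (x : E i) : ι K E (DirectSum.lof K ℕ E i x) = gen K E i x := rfl

theorem pr_ι_mul (x : ⨁ i, E i) (a : GSym K E) : pr K E (ι K E x * a) = aug K E a • x := by
  induction x using DirectSum.induction_on with
  | zero => simp
  | of i x => exact pr_gen_mul i x a
  | add x y hx hy => rw [map_add, add_mul, map_add, hx, hy, smul_add]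

theorem pr_ι (x : ⨁ i, E i) : pr K E (ι K E x) = x := by
  have := pr_ι_mul (K := K) x 1
  rwa [mul_one, map_one, one_smul] at this

/-! #### Homogeneous elements and maps -/

/-- The element `x` of the total space is homogeneous of degree `n`. -/
def IsHomog (n : ℤ) (x : ⨁ i, E i) : Prop := ∀ i, x i ≠ 0 → deg i = n

/-- As `deg` is injective, each degree belongs to at most one component. -/
theorem IsHomog.eq_lof {n : ℤ} {x : ⨁ i, E i} (hx : IsHomog n x) :
    x = 0 ∨ ∃ i, deg i = n ∧ x = DirectSum.lof K ℕ E i (x i) := by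
  classical
  by_cases h : ∃ i, deg i = n
  · obtain ⟨i, hi⟩ := h
    refine Or.inr ⟨i, hi, ?_⟩
    ext j
    by_cases hij : j = i
    · subst hij; rw [DirectSum.lof_apply]
    · rw [DirectSum.lof_eq_of, DirectSum.of_eq_of_ne _ _ _ hij]
      by_contra hj
      exact hij (deg_injective ((hx j hj).trans hi.symm))
  · left
    ext j
    by_contra hj
    exact h ⟨j, hx j hj⟩

theorem isHomog_lof (i : ℕ) (x : E i) : IsHomog (deg i) (DirectSum.lof K ℕ E i x) := by
  classical
  intro j hj
  by_contra h
  refine hj ?_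
  rw [DirectSum.lof_eq_of, DirectSum.of_eq_of_ne]
  rintro rfl; exact h rfl

theorem IsHomog.zero (n : ℤ) : IsHomog n (0 : ⨁ i, E i) := fun _ h => absurd rfl h

theorem IsHomog.add {n : ℤ} {x y : ⨁ i, E i} (hx : IsHomog n x) (hy : IsHomog n y) :
    IsHomog n (x + y) := fun i h => by
  by_cases hxi : x i = 0
  · exact hy i fun hyi => h (by rw [DirectSum.add_apply, hxi, hyi, add_zero])
  · exact hx i hxi

theorem IsHomog.smul {R : Type*} [Semiring R] [∀ i, Module R (E i)] {n : ℤ} {x : ⨁ i, E i}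
    (hx : IsHomog n x) (c : R) : IsHomog n (c • x) :=
  fun i h => hx i fun h' => h (by rw [DirectSum.smul_apply, h', smul_zero])

theorem IsHomog.ι_mem {n : ℤ} {x : ⨁ i, E i} (hx : IsHomog n x) :
    ι K E x ∈ degreePart K E n := by
  rcases hx.eq_lof (K := K) with rfl | ⟨i, rfl, h⟩
  · rw [map_zero]; exact Submodule.zero_mem _
  · rw [h]; exact gen_mem K E i _

/-- The linear map `H` is homogeneous of degree `h`. -/
def HasDeg (h : ℤ) (H : GSym K E →ₗ[K] ⨁ i, E i) : Prop :=
  ∀ (d : ℤ), ∀ a ∈ degreePart K E d, IsHomog (d + h) (H a)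

theorem gen_mul_mem {d : ℤ} {a : GSym K E} (ha : a ∈ degreePart K E d) (i : ℕ) (x : E i) :
    gen K E i x * a ∈ degreePart K E (deg i + d) :=
  SetLike.mul_mem_graded (gen_mem K E i x) ha

theorem HasDeg.comp_mulGen {h : ℤ} {H : GSym K E →ₗ[K] ⨁ i, E i} (hH : HasDeg h H) (i : ℕ)
    (x : E i) : HasDeg (h + deg i) (H ∘ₗ mulGen i x) := fun d a ha => by
  have := hH _ _ (gen_mul_mem ha i x)
  rwa [show d + (h + deg i) = deg i + d + h by ring]

theorem HasDeg.add {h : ℤ} {H G : GSym K E →ₗ[K] ⨁ i, E i} (hH : HasDeg h H) (hG : HasDeg h G) :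
    HasDeg h (H + G) := fun d a ha => (hH d a ha).add (hG d a ha)

theorem HasDeg.smul {h : ℤ} {H : GSym K E →ₗ[K] ⨁ i, E i} (hH : HasDeg h H) (c : K) :
    HasDeg h (c • H) := fun d a ha => (hH d a ha).smul c

theorem hasDeg_pr : HasDeg 0 (pr K E) := fun d a ha => by
  -- The projection of `x * a` involves the augmentation of `a`, so the claim is strengthened by the
  -- vanishing of the augmentation outside degree zero.
  refine degreePart_induction (P := fun d a => IsHomog (d + 0) (pr K E a) ∧
    (d ≠ 0 → aug K E a = 0)) ?_ ?_ ?_ ?_ ?_ ha |>.1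
  · intro d; rw [map_zero, map_zero]; exact ⟨IsHomog.zero _, fun _ => rfl⟩
  · rw [pr_one]; exact ⟨IsHomog.zero _, fun h => absurd rfl h⟩
  · intro d i x a _ h
    rw [pr_gen_mul, aug_gen_mul]
    refine ⟨?_, fun _ => rfl⟩
    by_cases hd : d = 0
    · subst hd; rw [add_zero, add_zero]; exact (isHomog_lof i x).smul _
    · rw [h.2 hd, zero_smul]; exact IsHomog.zero _
  · intro d a b ha hb
    rw [map_add, map_add]
    exact ⟨ha.1.add hb.1, fun h => by rw [ha.2 h, hb.2 h, add_zero]⟩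
  · intro d c a h
    rw [map_smul, map_smul]
    exact ⟨h.1.smul c, fun h' => by rw [h.2 h', smul_zero]⟩

theorem signAut_signAut (m : ℤ) (a : GSym K E) : signAut K E m (signAut K E m a) = a := by
  have : (signAut K E m).comp (signAut K E m) = AlgHom.id K _ := algHom_ext fun i x => by
    rw [AlgHom.comp_apply, signAut_gen, map_smul, signAut_gen, smul_smul, sgn_mul_self, one_smul,
      AlgHom.id_apply]
  exact DFunLike.congr_fun this a

theorem pr_signAut (m : ℤ) {n : ℤ} (ψ : (⨁ i, E i) →ₗ[K] P)
    (hψ : ∀ i x, deg i ≠ n → ψ (DirectSum.lof K ℕ E i x) = 0) (a : GSym K E) :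
    ψ (pr K E (signAut K E m a)) = sgn K (m * n) • ψ (pr K E a) := by
  induction a using gen_induction with
  | one => rw [map_one, pr_one, map_zero, smul_zero]
  | gen_mul i x a _ =>
    rw [map_mul, signAut_gen, smul_mul_assoc, map_smul, pr_gen_mul, pr_gen_mul, aug_signAut,
      map_smul, map_smul]
    by_cases h : deg i = n
    · rw [h]
    · rw [hψ i x h, smul_zero, smul_zero, smul_zero]
  | add a b ha hb => rw [map_add, map_add, map_add, ha, hb, map_add, map_add, smul_add]
  | smul c a h => rw [map_smul, map_smul, map_smul, h, map_smul, map_smul, smul_comm]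

/-! #### Convolutions -/

/-- The convolution `a ↦ μ(φ(a'), ψ(a''))` for the coproduct `a ↦ a' ⊗ a''`. -/
def conv (μ : M →ₗ[K] N →ₗ[K] P) (φ : GSym K E →ₗ[K] M) (ψ : GSym K E →ₗ[K] N) :
    GSym K E →ₗ[K] P :=
  TensorProduct.lift (μ.compl₁₂ φ ψ) ∘ₗ CoalgebraStruct.comul

theorem conv_one (μ : M →ₗ[K] N →ₗ[K] P) (φ : GSym K E →ₗ[K] M) (ψ : GSym K E →ₗ[K] N) :
    conv μ φ ψ 1 = μ (φ 1) (ψ 1) := by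
  rw [conv, LinearMap.comp_apply, comul_one, TensorProduct.lift.tmul]; rfl

theorem conv_gen_mul (μ : M →ₗ[K] N →ₗ[K] P) (φ : GSym K E →ₗ[K] M) (ψ : GSym K E →ₗ[K] N)
    (i : ℕ) (x : E i) (a : GSym K E) :
    conv μ φ ψ (gen K E i x * a) = conv μ (φ ∘ₗ mulGen i x) ψ a
      + conv μ (φ ∘ₗ (signAut K E (deg i)).toLinearMap) (ψ ∘ₗ mulGen i x) a := by
  simp only [conv, LinearMap.comp_apply]
  rw [comul_gen_mul, map_add]
  congr 1 <;>
  · rw [← LinearMap.comp_apply]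
    congr 1
    ext b c
    rfl

/-- Only homogeneous left entries have to be tested, which makes the Koszul signs constants; the
coefficient modules may differ on the two sides. -/
theorem conv_congr {M' N' : Type*} [AddCommGroup M'] [Module K M'] [AddCommGroup N'] [Module K N']
    {μ : M →ₗ[K] N →ₗ[K] P} {φ : GSym K E →ₗ[K] M} {ψ : GSym K E →ₗ[K] N}
    {μ' : M' →ₗ[K] N' →ₗ[K] P} {φ' : GSym K E →ₗ[K] M'} {ψ' : GSym K E →ₗ[K] N'}
    (h : ∀ d, ∀ b ∈ degreePart K E d, ∀ c, μ (φ b) (ψ c) = μ' (φ' b) (ψ' c)) :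
    conv μ φ ψ = conv μ' φ' ψ' := by
  have : μ.compl₁₂ φ ψ = μ'.compl₁₂ φ' ψ' :=
    linearMap_ext fun d b hb => LinearMap.ext fun c => h d b hb c
  rw [conv, conv, this]

theorem comp_conv (g : P →ₗ[K] P') (μ : M →ₗ[K] N →ₗ[K] P) (φ : GSym K E →ₗ[K] M)
    (ψ : GSym K E →ₗ[K] N) : g ∘ₗ conv μ φ ψ = conv (μ.compr₂ g) φ ψ := by
  rw [conv, conv, ← LinearMap.comp_assoc]
  congr 1
  ext b c
  rfl

theorem conv_add_left (μ : M →ₗ[K] N →ₗ[K] P) (φ φ' : GSym K E →ₗ[K] M) (ψ : GSym K E →ₗ[K] N) :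
    conv μ (φ + φ') ψ = conv μ φ ψ + conv μ φ' ψ := by
  have : μ.compl₁₂ (φ + φ') ψ = μ.compl₁₂ φ ψ + μ.compl₁₂ φ' ψ := by ext; simp
  rw [conv, conv, conv, this, TensorProduct.lift_add, LinearMap.add_comp]
where
  TensorProduct.lift_add {A B C : Type _} [AddCommGroup A] [Module K A] [AddCommGroup B]
    [Module K B] [AddCommGroup C] [Module K C] (f g : A →ₗ[K] B →ₗ[K] C) :
    TensorProduct.lift (f + g) = TensorProduct.lift f + TensorProduct.lift g := by
    ext; simp

theorem conv_smul_left (μ : M →ₗ[K] N →ₗ[K] P) (φ : GSym K E →ₗ[K] M) (ψ : GSym K E →ₗ[K] N)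
    (c : K) : conv μ (c • φ) ψ = c • conv μ φ ψ := by
  rw [show c • conv μ φ ψ = (c • LinearMap.id) ∘ₗ conv μ φ ψ from rfl, comp_conv]
  exact conv_congr fun d b _ e => by simp

theorem conv_zero_left (μ : M →ₗ[K] N →ₗ[K] P) (ψ : GSym K E →ₗ[K] N) :
    conv μ 0 ψ = (0 : GSym K E →ₗ[K] P) := by
  have := conv_smul_left μ 0 ψ 0
  rwa [smul_zero, zero_smul] at this

theorem conv_zero_right (μ : M →ₗ[K] N →ₗ[K] P) (φ : GSym K E →ₗ[K] M) :
    conv μ φ 0 = (0 : GSym K E →ₗ[K] P) := by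
  have : μ.compl₁₂ φ (0 : GSym K E →ₗ[K] N) = 0 := by ext; simp
  have h : TensorProduct.lift (0 : GSym K E →ₗ[K] GSym K E →ₗ[K] P) = 0 :=
    TensorProduct.ext' fun b c => by rw [TensorProduct.lift.tmul]; rfl
  rw [conv, this, h, LinearMap.zero_comp]

/-- This is the counit axiom: `aug` kills every term of the coproduct whose right factor contains a
generator. -/
theorem conv_aug_right (μ : M →ₗ[K] K →ₗ[K] P) (φ : GSym K E →ₗ[K] M) (a : GSym K E) :
    conv μ φ (aug K E).toLinearMap a = μ (φ a) 1 := by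
  induction a using gen_induction generalizing φ with
  | one => rw [conv_one, AlgHom.toLinearMap_apply, _root_.map_one (aug K E)]
  | gen_mul i x a ih =>
    have : (aug K E).toLinearMap ∘ₗ mulGen i x = 0 := LinearMap.ext fun b => aug_gen_mul i x b
    rw [conv_gen_mul, ih, this, conv_zero_right]
    simp
  | add a b ha hb => rw [map_add, ha, hb, map_add, map_add, LinearMap.add_apply]
  | smul c a h => rw [map_smul, h, map_smul, map_smul, LinearMap.smul_apply]

theorem conv_aug_left (μ : K →ₗ[K] N →ₗ[K] P) (ψ : GSym K E →ₗ[K] N) (a : GSym K E) :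
    conv μ (aug K E).toLinearMap ψ a = μ 1 (ψ a) := by
  induction a using gen_induction generalizing ψ with
  | one => rw [conv_one, AlgHom.toLinearMap_apply, _root_.map_one (aug K E)]
  | gen_mul i x a ih =>
    have h1 : (aug K E).toLinearMap ∘ₗ mulGen i x = 0 := LinearMap.ext fun b => aug_gen_mul i x b
    have h2 : (aug K E).toLinearMap ∘ₗ (signAut K E (deg i)).toLinearMap = (aug K E).toLinearMap :=
      LinearMap.ext fun b => aug_signAut _ b
    rw [conv_gen_mul, h1, h2, ih, conv_zero_left]
    simp
  | add a b ha hb => rw [map_add, ha, hb, map_add, map_add]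
  | smul c a h => rw [map_smul, h, map_smul, map_smul]

/-- The first step in the computation of a convolution whose left factor is a multiple of the
projection to the generators. -/
theorem conv_pr_left_gen_mul (μ : M →ₗ[K] N →ₗ[K] P) (φ : (⨁ i, E i) →ₗ[K] M)
    (ψ : GSym K E →ₗ[K] N) {n : ℤ} (hφ : ∀ i x, deg i ≠ n → φ (DirectSum.lof K ℕ E i x) = 0)
    (i : ℕ) (x : E i) (a : GSym K E) :
    conv μ (φ ∘ₗ pr K E) ψ (gen K E i x * a) = μ (φ (DirectSum.lof K ℕ E i x)) (ψ a)
      + sgn K (deg i * n) • conv μ (φ ∘ₗ pr K E) (ψ ∘ₗ mulGen i x) a := by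
  have h1 : conv μ ((φ ∘ₗ pr K E) ∘ₗ mulGen i x) ψ
      = conv ((LinearMap.lsmul K P).flip ∘ₗ μ (φ (DirectSum.lof K ℕ E i x))).flip
          (aug K E).toLinearMap ψ :=
    conv_congr fun d b _ c => by simp [pr_gen_mul]
  have h2 : (φ ∘ₗ pr K E) ∘ₗ (signAut K E (deg i)).toLinearMap
      = sgn K (deg i * n) • (φ ∘ₗ pr K E) :=
    LinearMap.ext fun b => pr_signAut _ φ hφ b
  rw [conv_gen_mul, h1, h2, conv_aug_left, conv_smul_left]
  simp

theorem conv_pr_right_gen_mul (μ : M →ₗ[K] N →ₗ[K] P) (φ : GSym K E →ₗ[K] M)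
    (ψ : (⨁ i, E i) →ₗ[K] N) (i : ℕ) (x : E i) (a : GSym K E) :
    conv μ φ (ψ ∘ₗ pr K E) (gen K E i x * a) = conv μ (φ ∘ₗ mulGen i x) (ψ ∘ₗ pr K E) a
      + μ (φ (signAut K E (deg i) a)) (ψ (DirectSum.lof K ℕ E i x)) := by
  have h1 : conv μ (φ ∘ₗ (signAut K E (deg i)).toLinearMap) ((ψ ∘ₗ pr K E) ∘ₗ mulGen i x)
      = conv ((LinearMap.lsmul K P).flip ∘ₗ μ.flip (ψ (DirectSum.lof K ℕ E i x)))
          (φ ∘ₗ (signAut K E (deg i)).toLinearMap) (aug K E).toLinearMap :=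
    conv_congr fun d b _ c => by simp [pr_gen_mul]
  rw [conv_gen_mul, h1, conv_aug_right]
  simp

/-- Graded cocommutativity, for a left factor that factors through the projection to the part of
odd degree `n`. -/
theorem conv_pr_comm (μ : M →ₗ[K] N →ₗ[K] P) (φ : (⨁ i, E i) →ₗ[K] M) {n : ℤ}
    (hφ : ∀ i x, deg i ≠ n → φ (DirectSum.lof K ℕ E i x) = 0) (ψ : GSym K E →ₗ[K] N)
    (a : GSym K E) :
    conv μ (φ ∘ₗ pr K E) ψ a
      = conv μ.flip (ψ ∘ₗ (signAut K E n).toLinearMap) (φ ∘ₗ pr K E) a := by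
  induction a using gen_induction generalizing ψ with
  | one => simp [conv_one, pr_one]
  | gen_mul i x a ih =>
    have h : (ψ ∘ₗ (signAut K E n).toLinearMap) ∘ₗ mulGen i x
        = sgn K (deg i * n) • ((ψ ∘ₗ mulGen i x) ∘ₗ (signAut K E n).toLinearMap) :=
      LinearMap.ext fun b => by
        simp only [LinearMap.comp_apply, AlgHom.toLinearMap_apply, LinearMap.mulLeft_apply,
          LinearMap.smul_apply, map_mul, signAut_gen, mul_comm n, smul_mul_assoc, map_smul]
    rw [conv_pr_left_gen_mul μ φ ψ hφ, conv_pr_right_gen_mul, ih, h, conv_smul_left, add_comm,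
      LinearMap.smul_apply]
    congr 1
    by_cases hi : deg i = n
    · simp [hi, signAut_signAut]
    · simp [hφ i x hi]
  | add a b ha hb => rw [map_add, ha, hb, map_add]
  | smul c a h => rw [map_smul, h, map_smul]

/-! #### Co-derivations -/

theorem coderivation_eq_conv (H : GSym K E →ₗ[K] ⨁ i, E i) :
    coderivation H = conv (LinearMap.mul K (GSym K E)) (ι K E ∘ₗ H) LinearMap.id := by
  rw [coderivation, conv, ← LinearMap.comp_assoc]
  congr 1
  ext b c
  rfl

theorem coderivation_one (H : GSym K E →ₗ[K] ⨁ i, E i) : coderivation H 1 = ι K E (H 1) := by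
  rw [coderivation_eq_conv, conv_one]
  simp

/-- In the coproduct of `x * a` the generator `x` is either among the arguments of `H`, which
contracts `H` with `x`, or stays outside and is moved past the value of `H`. -/
theorem coderivation_gen_mul {h : ℤ} {H : GSym K E →ₗ[K] ⨁ i, E i} (hH : HasDeg h H) (i : ℕ)
    (x : E i) (a : GSym K E) :
    coderivation H (gen K E i x * a) = coderivation (H ∘ₗ mulGen i x) a
      + sgn K (deg i * h) • (gen K E i x * coderivation H a) := by
  rw [coderivation_eq_conv, conv_gen_mul, coderivation_eq_conv]
  congr 1
  have h1 : sgn K (deg i * h) • (gen K E i x * conv (LinearMap.mul K (GSym K E)) (ι K E ∘ₗ H)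
      LinearMap.id a) = ((sgn K (deg i * h) • mulGen i x) ∘ₗ conv (LinearMap.mul K (GSym K E))
      (ι K E ∘ₗ H) LinearMap.id) a := rfl
  rw [h1, comp_conv]
  congr 1
  refine conv_congr fun d b hb c => ?_
  have h2 : ι K E (H b) * gen K E i x = sgn K (deg i * (d + h)) • (gen K E i x * ι K E (H b)) := by
    rw [mul_gen, signAut_of_mem _ (hH d b hb).ι_mem, mul_smul_comm]
  simp only [LinearMap.comp_apply, LinearMap.mul_apply', AlgHom.toLinearMap_apply,
    LinearMap.mulLeft_apply, LinearMap.id_apply, LinearMap.compr₂_apply, LinearMap.smul_apply]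
  rw [signAut_of_mem _ hb, map_smul, map_smul, smul_mul_assoc, ← mul_assoc, h2, smul_mul_assoc,
    -- The generator passes `b`, of degree `d`, and `H b`, of degree `d + h`; the two contributions
    -- `deg i * d` cancel modulo two.
    smul_smul, ← sgn_add, mul_add, ← add_assoc, ← two_mul, sgn_add, mul_assoc]
  rw [show sgn K (2 * (deg i * d)) = 1 by rw [sgn, zpow_mul]; simp, one_mul]

theorem coderivation_add (H G : GSym K E →ₗ[K] ⨁ i, E i) :
    coderivation (H + G) = coderivation H + coderivation G := by
  rw [coderivation_eq_conv, LinearMap.comp_add, conv_add_left, ← coderivation_eq_conv,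
    ← coderivation_eq_conv]

theorem coderivation_smul (c : K) (H : GSym K E →ₗ[K] ⨁ i, E i) :
    coderivation (c • H) = c • coderivation H := by
  rw [coderivation_eq_conv, LinearMap.comp_smul, conv_smul_left, ← coderivation_eq_conv]

/-- Only the terms whose right factor is a scalar land in polynomial-degree one, so `H` is recovered
as the family of Taylor coefficients. -/
theorem pr_coderivation (H : GSym K E →ₗ[K] ⨁ i, E i) (a : GSym K E) :
    pr K E (coderivation H a) = H a := by
  rw [coderivation_eq_conv, ← LinearMap.comp_apply, comp_conv]
  rw [show conv ((LinearMap.mul K (GSym K E)).compr₂ (pr K E)) (ι K E ∘ₗ H) LinearMap.id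
    = conv (LinearMap.lsmul K (⨁ i, E i)).flip H (aug K E).toLinearMap from
    conv_congr fun d b _ c => by simp [pr_ι_mul], conv_aug_right]
  simp

theorem coderivation_mem {h : ℤ} {H : GSym K E →ₗ[K] ⨁ i, E i} (hH : HasDeg h H) {d : ℤ}
    {a : GSym K E} (ha : a ∈ degreePart K E d) : coderivation H a ∈ degreePart K E (d + h) := by
  refine degreePart_induction (P := fun d a => ∀ h H, HasDeg h H →
    coderivation H a ∈ degreePart K E (d + h)) ?_ ?_ ?_ ?_ ?_ ha h H hH
  · intro d h H _; rw [map_zero]; exact Submodule.zero_mem _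
  · intro h H hH
    rw [coderivation_one]
    exact (hH 0 1 (SetLike.GradedOne.one_mem)).ι_mem
  · intro d i x a _ ih h H hH
    rw [coderivation_gen_mul hH]
    refine Submodule.add_mem _ ?_ (Submodule.smul_mem _ _ ?_)
    · have := ih _ _ (hH.comp_mulGen i x)
      rwa [show d + (h + deg i) = deg i + d + h by ring] at this
    · rw [add_assoc]; exact gen_mul_mem (ih h H hH) i x
  · intro d a b ha hb h H hH; rw [map_add]; exact Submodule.add_mem _ (ha h H hH) (hb h H hH)
  · intro d c a ha h H hH; rw [map_smul]; exact Submodule.smul_mem _ _ (ha h H hH)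

/-- A co-derivation whose coefficients vanish in degrees `> d` is given in degree `d` by its
coefficients. -/
theorem coderivation_eq_ι {h : ℤ} {H : GSym K E →ₗ[K] ⨁ i, E i} (hH : HasDeg h H) {d : ℤ}
    {a : GSym K E} (ha : a ∈ degreePart K E d)
    (hv : ∀ e, d < e → ∀ b ∈ degreePart K E e, H b = 0) :
    coderivation H a = ι K E (H a) := by
  refine degreePart_induction (P := fun d a => ∀ h H, HasDeg h H →
    -- Both `H` and its degree vary in the induction, because peeling off a generator replaces `H`
    -- by a contraction. The vanishing range shifts accordingly, as generators have negative degree.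
    (∀ e, d < e → ∀ b ∈ degreePart K E e, H b = 0) → coderivation H a = ι K E (H a))
    ?_ ?_ ?_ ?_ ?_ ha h H hH hv
  · intro d h H _ _; simp
  · intro h H _ _; exact coderivation_one H
  · intro d i x a ha ih h H hH hv
    have hi : deg i < 0 := by simp only [deg]; omega
    rw [coderivation_gen_mul hH, ih _ _ (hH.comp_mulGen i x), ih h H hH, hv d (by omega) a ha]
    · simp
    · intro e he b hb; exact hv e (by omega) b hb
    · intro e he b hb; exact hv _ (by omega) _ (gen_mul_mem hb i x)
  · intro d a b ha hb h H hH hv; rw [map_add, ha h H hH hv, hb h H hH hv, map_add, map_add]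
  · intro d c a ha h H hH hv; rw [map_smul, ha h H hH hv, map_smul, map_smul]

theorem coderivation_eq_of_eq {h : ℤ} {H G : GSym K E →ₗ[K] ⨁ i, E i} (hH : HasDeg h H)
    (hG : HasDeg h G) {d : ℤ} {a : GSym K E} (ha : a ∈ degreePart K E d)
    (hv : ∀ e, d ≤ e → ∀ b ∈ degreePart K E e, H b = G b) :
    coderivation H a = coderivation G a := by
  have key : coderivation (H + (-1 : K) • G) a = 0 := by
    rw [coderivation_eq_ι (hH.add (hG.smul (-1))) ha fun e he b hb => by simp [hv e he.le b hb]]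
    simp [hv d le_rfl a ha]
  rw [coderivation_add, coderivation_smul, LinearMap.add_apply, LinearMap.smul_apply, neg_smul,
    one_smul, add_neg_eq_zero] at key
  exact key

/-- The graded commutator of two co-derivations. -/
theorem coderivation_comm {h g : ℤ} {H G : GSym K E →ₗ[K] ⨁ i, E i} (hH : HasDeg h H)
    (hG : HasDeg g G) (a : GSym K E) :
    coderivation H (coderivation G a) + (-sgn K (h * g)) • coderivation G (coderivation H a)
      = coderivation (H ∘ₗ coderivation G + (-sgn K (h * g)) • (G ∘ₗ coderivation H)) a := by
  -- The maps have to be arbitrary here: the inductive step uses the statement for `H` and `G`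
  -- contracted with the new generator.
  induction a using gen_induction generalizing h g H G with
  | one =>
    have key : ∀ {h g : ℤ} {H G : GSym K E →ₗ[K] ⨁ i, E i}, HasDeg h H → HasDeg g G →
        coderivation H (coderivation G 1)
          = ι K E (H (ι K E (G 1))) + sgn K (g * h) • (ι K E (G 1) * ι K E (H 1)) := by
      intro h g H G hH hG
      rw [coderivation_one]
      have hG1 := hG 0 1 (SetLike.GradedOne.one_mem)
      rw [zero_add] at hG1
      rcases hG1.eq_lof (K := K) with h0 | ⟨i, hi, h0⟩
      · rw [h0]; simp
      · rw [h0, ι_lof]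
        have := coderivation_gen_mul hH i (G 1 i) 1
        rw [mul_one, coderivation_one, coderivation_one, hi] at this
        rw [this, LinearMap.comp_apply, LinearMap.mulLeft_apply, mul_one]
    have hcomm : ι K E (H 1) * ι K E (G 1) = sgn K (h * g) • (ι K E (G 1) * ι K E (H 1)) := by
      have hG1 := hG 0 1 (SetLike.GradedOne.one_mem)
      have hH1 := hH 0 1 (SetLike.GradedOne.one_mem)
      rw [zero_add] at hG1 hH1
      rcases hG1.eq_lof (K := K) with h0 | ⟨i, hi, h0⟩
      · rw [h0]; simp
      · rw [h0, ι_lof, mul_gen, signAut_of_mem _ hH1.ι_mem, hi, mul_smul_comm, mul_comm h]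
    rw [key hH hG, key hG hH, coderivation_one, hcomm]
    simp only [LinearMap.add_apply, LinearMap.smul_apply, LinearMap.comp_apply, coderivation_one,
      map_add, map_smul, smul_add, smul_smul, sgn_mul_self, mul_comm g h, neg_smul, map_neg,
      one_smul]
    abel
  | gen_mul i x a ih =>
    have h1 := ih hH (hG.comp_mulGen i x)
    have h2 := ih (hH.comp_mulGen i x) hG
    have h3 := ih hH hG
    have e1 := coderivation_gen_mul hH i x
    have e2 := coderivation_gen_mul hG i x
    have hdeg : HasDeg (h + g)
        (H ∘ₗ coderivation G + (-sgn K (h * g)) • (G ∘ₗ coderivation H)) := by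
      refine HasDeg.add ?_ (HasDeg.smul ?_ _)
      · intro d b hb
        have := hH _ _ (coderivation_mem hG hb)
        rwa [show d + (h + g) = d + g + h by ring]
      · intro d b hb
        have := hG _ _ (coderivation_mem hH hb)
        rwa [show d + (h + g) = d + h + g by ring]
    rw [coderivation_gen_mul hdeg, ← h3]
    -- Contraction with `x` is a graded derivation of the commutator: the coefficients split into
    -- those of the commutators with `G` contracted and with `H` contracted.
    have hc : (H ∘ₗ coderivation G + (-sgn K (h * g)) • (G ∘ₗ coderivation H)) ∘ₗ mulGen i x
        = (H ∘ₗ coderivation (G ∘ₗ mulGen i x)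
            + (-sgn K (h * (g + deg i))) • ((G ∘ₗ mulGen i x) ∘ₗ coderivation H))
          + sgn K (deg i * g) • ((H ∘ₗ mulGen i x) ∘ₗ coderivation G
            + (-sgn K ((h + deg i) * g)) • (G ∘ₗ coderivation (H ∘ₗ mulGen i x))) := by
      ext1 b
      simp only [LinearMap.comp_apply, LinearMap.add_apply, LinearMap.smul_apply,
        LinearMap.mulLeft_apply, e1, e2, map_add, map_smul, smul_add, smul_smul, add_mul, mul_add,
        sgn_add, neg_mul, mul_neg, mul_comm h (deg i)]
      rw [show sgn K (deg i * g) * (sgn K (h * g) * sgn K (deg i * g)) = sgn K (h * g) by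
        rw [mul_left_comm, sgn_mul_self, mul_one]]
      abel
    rw [hc, coderivation_add, coderivation_smul, LinearMap.add_apply, LinearMap.smul_apply, ← h1,
      ← h2]
    simp only [e1, e2, map_add, map_smul, smul_add, smul_smul, add_mul, mul_add,
        sgn_add, neg_mul, mul_neg, mul_comm h (deg i), mul_smul_comm]
    rw [show sgn K (deg i * g) * (sgn K (h * g) * sgn K (deg i * g)) = sgn K (h * g) by
        rw [mul_left_comm, sgn_mul_self, mul_one]]
    rw [show sgn K (h * g) * (sgn K (deg i * h) * sgn K (deg i * g))
      = sgn K (deg i * h) * sgn K (deg i * g) * sgn K (h * g) by ring]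
    rw [show sgn K (deg i * g) * sgn K (deg i * h) = sgn K (deg i * h) * sgn K (deg i * g)
      from mul_comm _ _]
    abel
  | add a b ha hb => simp only [map_add, smul_add, ← ha hH hG, ← hb hH hG]; abel
  | smul c a ha => simp only [map_smul, ← ha hH hG, smul_add, smul_comm c]

/-- The square of a co-derivation of degree one. -/
theorem coderivation_sq [CharZero K] {H : GSym K E →ₗ[K] ⨁ i, E i} (hH : HasDeg 1 H)
    (a : GSym K E) :
    coderivation H (coderivation H a) = coderivation (H ∘ₗ coderivation H) a := by
  -- In odd degree the graded commutator of a co-derivation with itself is twice its square;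
  -- characteristic zero allows division by two.
  have h := coderivation_comm hH hH a
  rw [mul_one, sgn_one, neg_neg, one_smul, one_smul, ← two_smul K, ← two_smul K,
    coderivation_smul, LinearMap.smul_apply] at h
  exact smul_right_injective _ (two_ne_zero (α := K)) h

end GSym
end LieInfty

namespace LieInfty

namespace GSym

/-! #### Functoriality -/

section Map

variable {K : Type k} [Field K] {E' : ℕ → Type w'} [∀ i, AddCommGroup (E' i)]
  [∀ i, Module K (E' i)] {E : ℕ → Type w} [∀ i, AddCommGroup (E i)] [∀ i, Module K (E i)]

/-- The algebra morphism induced by a graded linear map. -/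
def map (f : ∀ i, E' i →ₗ[K] E i) : GSym K E' →ₐ[K] GSym K E :=
  lift (DirectSum.toModule K ℕ _ fun i => gen K E i ∘ₗ f i) fun i j x y => by
    simp only [DirectSum.toModule_lof, LinearMap.comp_apply]
    exact gen_mul_gen i j _ _

variable (f : ∀ i, E' i →ₗ[K] E i)

@[simp] theorem map_gen (i : ℕ) (x : E' i) : map f (gen K E' i x) = gen K E i (f i x) := by
  rw [map, lift_gen, DirectSum.toModule_lof]; rfl

theorem map_ι (x : ⨁ i, E' i) : map f (ι K E' x) = ι K E (DirectSum.lmap f x) := by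
  induction x using DirectSum.induction_on with
  | zero => simp
  | of i x =>
    have := map_gen f i x
    rw [← ι_lof, ← ι_lof, ← DirectSum.lmap_lof] at this
    exact this
  | add x y hx hy => rw [map_add, map_add, hx, hy, map_add, map_add]

theorem map_mem {d : ℤ} {a : GSym K E'} (ha : a ∈ degreePart K E' d) :
    map f a ∈ degreePart K E d := by
  refine degreePart_induction (P := fun d a => map f a ∈ degreePart K E d) ?_ ?_ ?_ ?_ ?_ ha
  · intro d; rw [map_zero]; exact Submodule.zero_mem _
  · rw [_root_.map_one]; exact SetLike.GradedOne.one_mem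
  · intro d i x a _ h
    rw [map_mul, map_gen]; exact gen_mul_mem h i _
  · intro d a b ha hb; rw [map_add]; exact Submodule.add_mem _ ha hb
  · intro d c a h; rw [map_smul]; exact Submodule.smul_mem _ _ h

theorem aug_map (a : GSym K E') : aug K E (map f a) = aug K E' a := by
  have : (aug K E).comp (map f) = aug K E' := algHom_ext fun i x => by
    rw [AlgHom.comp_apply, map_gen, aug_gen, aug_gen]
  exact DFunLike.congr_fun this a

theorem pr_map (a : GSym K E') : pr K E (map f a) = DirectSum.lmap f (pr K E' a) := by
  induction a using gen_induction with
  | one => rw [_root_.map_one, pr_one, pr_one, map_zero]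
  | gen_mul i x a _ =>
    rw [map_mul, map_gen, pr_gen_mul, pr_gen_mul, aug_map, map_smul, DirectSum.lmap_lof]
  | add a b ha hb => simp only [map_add, ha, hb]
  | smul c a h => simp only [map_smul, h]

theorem map_signAut (m : ℤ) (a : GSym K E') :
    map f (signAut K E' m a) = signAut K E m (map f a) := by
  have : (map f).comp (signAut K E' m) = (signAut K E m).comp (map f) := algHom_ext fun i x => by
    simp [AlgHom.comp_apply, signAut_gen]
  exact DFunLike.congr_fun this a

theorem comul_map (a : GSym K E') :
    CoalgebraStruct.comul (R := K) (map f a)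
      = TensorProduct.map (map f).toLinearMap (map f).toLinearMap
          (CoalgebraStruct.comul (R := K) a) := by
  induction a using gen_induction with
  | one => rw [_root_.map_one, comul_one, comul_one]; simp
  | gen_mul i x a ih =>
    rw [map_mul, map_gen, comul_gen_mul, comul_gen_mul, map_add, ih]
    have h1 : ∀ t, TensorProduct.map (mulGen i (f i x)) LinearMap.id
        (TensorProduct.map (map f).toLinearMap (map f).toLinearMap t)
        = TensorProduct.map (map f).toLinearMap (map f).toLinearMap
          (TensorProduct.map (mulGen i x) LinearMap.id t) := fun t =>
      LinearMap.congr_fun (TensorProduct.ext' (g := TensorProduct.map (mulGen i (f i x))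
        LinearMap.id ∘ₗ TensorProduct.map (map f).toLinearMap (map f).toLinearMap)
        (h := TensorProduct.map (map f).toLinearMap (map f).toLinearMap ∘ₗ
          TensorProduct.map (mulGen i x) LinearMap.id) fun b c => by simp) t
    have h2 : ∀ t, TensorProduct.map (signAut K E (deg i)).toLinearMap (mulGen i (f i x))
        (TensorProduct.map (map f).toLinearMap (map f).toLinearMap t)
        = TensorProduct.map (map f).toLinearMap (map f).toLinearMap
          (TensorProduct.map (signAut K E' (deg i)).toLinearMap (mulGen i x) t) := fun t =>
      LinearMap.congr_fun (TensorProduct.ext' (g := TensorProduct.map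
        (signAut K E (deg i)).toLinearMap (mulGen i (f i x)) ∘ₗ
          TensorProduct.map (map f).toLinearMap (map f).toLinearMap)
        (h := TensorProduct.map (map f).toLinearMap (map f).toLinearMap ∘ₗ
          TensorProduct.map (signAut K E' (deg i)).toLinearMap (mulGen i x))
          fun b c => by simp [map_signAut]) t
    rw [h1, h2]
  | add a b ha hb => simp only [map_add, ha, hb]
  | smul c a h => simp only [map_smul, h]

/-- The coalgebra morphism induced by a graded linear map. -/
def mapCoalgHom : GSym K E' →ₗc[K] GSym K E where
  toLinearMap := (map f).toLinearMap
  counit_comp := LinearMap.ext fun a => aug_map f a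
  map_comp_comul := LinearMap.ext fun a => (comul_map f a).symm

theorem coderivation_map {h : ℤ} {H' : GSym K E' →ₗ[K] ⨁ i, E' i} {H : GSym K E →ₗ[K] ⨁ i, E i}
    (hH' : HasDeg h H') (hH : HasDeg h H)
    (hf : ∀ a, H (map f a) = DirectSum.lmap f (H' a)) (a : GSym K E') :
    coderivation H (map f a) = map f (coderivation H' a) := by
  induction a using gen_induction generalizing h H' H with
  | one =>
    rw [_root_.map_one, coderivation_one, coderivation_one, map_ι, ← hf,
      _root_.map_one (map f)]
  | gen_mul i x a ih =>
    rw [map_mul, map_gen, coderivation_gen_mul hH, coderivation_gen_mul hH',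
      ih (hH'.comp_mulGen i x) (hH.comp_mulGen i (f i x)), ih hH' hH hf, map_add, map_smul, map_mul,
      map_gen]
    intro b
    rw [LinearMap.comp_apply, LinearMap.comp_apply, LinearMap.mulLeft_apply,
      LinearMap.mulLeft_apply, ← hf, map_mul (map f), map_gen]
  | add a b ha hb => simp only [map_add, ha hH' hH hf, hb hH' hH hf]
  | smul c a ha => simp only [map_smul, ha hH' hH hf]

end Map

/-! #### Monomials -/

section Mono

variable {K : Type k} [Field K] {E : ℕ → Type w} [∀ i, AddCommGroup (E i)] [∀ i, Module K (E i)]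

theorem mono_nil : mono K ([] : List (⨁ i, E i)) = 1 := rfl

theorem mono_cons (x : ⨁ i, E i) (l : List (⨁ i, E i)) : mono K (x :: l) = ι K E x * mono K l := by
  rw [mono, List.map_cons, List.prod_cons]; rfl

theorem mono_append (l m : List (⨁ i, E i)) : mono K (l ++ m) = mono K l * mono K m := by
  rw [mono, List.map_append, List.prod_append]; rfl

theorem mono_induction {P : GSym K E → Prop} (mono : ∀ l, P (mono K l))
    (add : ∀ a b, P a → P b → P (a + b)) (smul : ∀ (c : K) a, P a → P (c • a))
    (a : GSym K E) : P a := by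
  have zero : P 0 := by simpa using smul 0 1 (mono [])
  refine homogeneous_induction zero (fun d a ha => ?_) add a
  induction ha using Submodule.span_induction with
  | mem a h =>
    obtain ⟨l, _, rfl⟩ := h
    have := mono (l.map fun p => DirectSum.lof K ℕ E p.1 p.2)
    rw [GSym.mono, List.map_map] at this
    exact this
  | zero => exact zero
  | add a b _ _ iha ihb => exact add a b iha ihb
  | smul c a _ ih => exact smul c a ih

theorem aug_mono {l : List (⨁ i, E i)} (hl : l ≠ []) : aug K E (mono K l) = 0 := by
  cases l with
  | nil => exact absurd rfl hl
  | cons x l =>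
    have : aug K E (ι K E x) = 0 := by
      rw [aug]; exact (lift_ι _ _ _).trans (LinearMap.zero_apply _)
    rw [mono_cons, map_mul, this, zero_mul]

theorem pr_mono_of_length_ne_one {l : List (⨁ i, E i)} (hl : l.length ≠ 1) :
    pr K E (mono K l) = 0 := by
  cases l with
  | nil => exact pr_one
  | cons x l =>
    rw [mono_cons, pr_ι_mul, aug_mono, zero_smul]
    rintro rfl
    exact hl rfl

/-- The signs are absorbed into the list entries. Hence an argument can be moved to the front of a
monomial, leaving a monomial of the same length behind. -/
theorem exists_signAut_mono (m : ℤ) (l : List (⨁ i, E i)) :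
    ∃ l' : List (⨁ i, E i), l'.length = l.length ∧ signAut K E m (mono K l) = mono K l' := by
  have hι : ∀ x, ∃ y, signAut K E m (ι K E x) = ι K E y := fun x => by
    induction x using DirectSum.induction_on with
    | zero => exact ⟨0, by simp⟩
    | of i x =>
      refine ⟨sgn K (m * deg i) • DirectSum.lof K ℕ E i x, ?_⟩
      rw [map_smul]; exact signAut_gen m i x
    | add x y hx hy =>
      obtain ⟨x', hx⟩ := hx
      obtain ⟨y', hy⟩ := hy
      exact ⟨x' + y', by rw [map_add, map_add, hx, hy, map_add]⟩
  induction l with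
  | nil => exact ⟨[], rfl, _root_.map_one _⟩
  | cons x l ih =>
    obtain ⟨l', h1, h2⟩ := ih
    obtain ⟨y, hy⟩ := hι x
    exact ⟨y :: l', by simp [h1], by rw [mono_cons, map_mul, hy, h2, mono_cons]⟩

end Mono

/-! #### Multilinear and Leibniz maps -/

section Multilinear

variable {K : Type k} [Field K] {O : Type u} [CommRing O] [Algebra K O]
  {E : ℕ → Type w} [∀ i, AddCommGroup (E i)] [∀ i, Module O (E i)] [∀ i, Module K (E i)]
  [∀ i, IsScalarTower K O (E i)]
  {M N : Type*} [AddCommGroup M] [Module O M] [Module K M] [IsScalarTower K O M]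
  [AddCommGroup N] [Module O N] [Module K N] [IsScalarTower K O N]

variable (O) in
/-- The map `φ` is `O`-linear in each of its arguments. -/
def IsMultilinear (φ : GSym K E →ₗ[K] M) : Prop :=
  ∀ i (x : E i) (f : O) a, φ (gen K E i (f • x) * a) = f • φ (gen K E i x * a)

/-- The map `φ` is multilinear up to a Leibniz term that involves the anchor `ρ`. -/
def IsLeibniz (ρ : E 0 →ₗ[O] Derivation K O O) (p : (⨁ i, E i) →ₗ[O] M)
    (φ : GSym K E →ₗ[K] M) : Prop :=
  ∀ i (x : E i) (f : O) a, φ (gen K E i (f • x) * a) = f • φ (gen K E i x * a)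
    + sgn K (deg i) • ρ (pr K E a 0) f • p (DirectSum.lof K ℕ E i x)

/-- The Leibniz term depends only on `ρ` and `p` and cancels. Leibniz maps thus form an affine space
over the multilinear ones, which is why brackets may be corrected by multilinear maps. -/
theorem IsLeibniz.sub {ρ : E 0 →ₗ[O] Derivation K O O} {p : (⨁ i, E i) →ₗ[O] M}
    {φ ψ : GSym K E →ₗ[K] M} (hφ : IsLeibniz ρ p φ) (hψ : IsLeibniz ρ p ψ) :
    IsMultilinear O (φ - ψ) := fun i x f a => by
  rw [LinearMap.sub_apply, LinearMap.sub_apply, hφ, hψ, smul_sub]; abel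

theorem IsLeibniz.add {ρ : E 0 →ₗ[O] Derivation K O O} {p : (⨁ i, E i) →ₗ[O] M}
    {φ ψ : GSym K E →ₗ[K] M} (hφ : IsLeibniz ρ p φ) (hψ : IsMultilinear O ψ) :
    IsLeibniz ρ p (φ + ψ) := fun i x f a => by
  rw [LinearMap.add_apply, LinearMap.add_apply, hφ, hψ, smul_add]; abel

theorem IsLeibniz.comp {ρ : E 0 →ₗ[O] Derivation K O O} {p : (⨁ i, E i) →ₗ[O] M}
    {φ : GSym K E →ₗ[K] M} (hφ : IsLeibniz ρ p φ) (g : M →ₗ[O] N) :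
    IsLeibniz ρ (g ∘ₗ p) (g.restrictScalars K ∘ₗ φ) := fun i x f a => by
  rw [LinearMap.comp_apply, LinearMap.comp_apply, hφ, map_add, map_smul (g.restrictScalars K)]
  simp

theorem IsMultilinear.neg {φ : GSym K E →ₗ[K] M} (hφ : IsMultilinear O φ) :
    IsMultilinear O (-φ) := fun i x f a => by
  rw [LinearMap.neg_apply, LinearMap.neg_apply, hφ, smul_neg]

/-- Exchanging two generators costs only a sign, so linearity in the first argument passes to the
next one. -/
theorem IsMultilinear.comp_mulGen {φ : GSym K E →ₗ[K] M} (hφ : IsMultilinear O φ) (i : ℕ)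
    (x : E i) : IsMultilinear O (φ ∘ₗ mulGen i x) := fun j y f a => by
  have h : ∀ y : E j, gen K E i x * (gen K E j y * a)
      = sgn K (deg i * deg j) • (gen K E j y * (gen K E i x * a)) := fun y => by
    rw [← mul_assoc, gen_mul_gen, neg_one_pow_eq_sgn, smul_mul_assoc, mul_assoc]
  simp only [LinearMap.comp_apply, LinearMap.mulLeft_apply]
  rw [h, h, map_smul φ, map_smul φ, hφ, smul_comm]

/-! #### Multilinearization

For a splitting `s : E i → O ⊗ E i` of the action maps, every `K`-linear map on the graded symmetric
algebra gives an `O`-multilinear one. -/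

variable (s : ∀ i, E i →ₗ[O] O ⊗[K] E i)

theorem lTensor_gen_comm (i j : ℕ) (p : O ⊗[K] E i) (q : O ⊗[K] E j) :
    (gen K E i).lTensor O p * (gen K E j).lTensor O q
      = (-1 : K) ^ ((i + 1) * (j + 1)) •
        ((gen K E j).lTensor O q * (gen K E i).lTensor O p) := by
  induction p using TensorProduct.induction_on with
  | zero => simp
  | add p p' h h' =>
    rw [map_add, add_mul, h, h', mul_add (LinearMap.lTensor O (gen K E j) q), smul_add]
  | tmul c x =>
    induction q using TensorProduct.induction_on with
    | zero => simp
    | add q q' h h' =>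
      rw [map_add, mul_add, h, h', add_mul (LinearMap.lTensor O (gen K E j) q), smul_add]
    | tmul d y =>
      rw [LinearMap.lTensor_tmul, LinearMap.lTensor_tmul, Algebra.TensorProduct.tmul_mul_tmul,
        Algebra.TensorProduct.tmul_mul_tmul, gen_mul_gen, mul_comm c, TensorProduct.tmul_smul]

/-- The algebra morphism that extends the splittings. -/
def spread : GSym K E →ₐ[K] O ⊗[K] GSym K E :=
  lift (DirectSum.toModule K ℕ _ fun i => (gen K E i).lTensor O ∘ₗ (s i).restrictScalars K)
    fun i j x y => by
      simp only [DirectSum.toModule_lof, LinearMap.comp_apply]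
      exact lTensor_gen_comm i j _ _

theorem spread_gen (i : ℕ) (x : E i) :
    spread s (gen K E i x) = (gen K E i).lTensor O (s i x) := by
  rw [spread, lift_gen, DirectSum.toModule_lof]; rfl

/-- The multilinearization of a linear map on the graded symmetric algebra. -/
def multilin (φ : GSym K E →ₗ[K] M) : GSym K E →ₗ[K] M :=
  (φ.liftBaseChange O).restrictScalars K ∘ₗ (spread s).toLinearMap

variable {s}

theorem multilin_apply (φ : GSym K E →ₗ[K] M) (a : GSym K E) :
    multilin s φ a = φ.liftBaseChange O (spread s a) := rfl

theorem multilin_one (φ : GSym K E →ₗ[K] M) : multilin s φ 1 = φ 1 := by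
  rw [multilin_apply, _root_.map_one, Algebra.TensorProduct.one_def,
    LinearMap.liftBaseChange_tmul, one_smul]

theorem liftBaseChange_tmul_gen_mul (φ : GSym K E →ₗ[K] M) (i : ℕ) (c : O) (x : E i)
    (t : O ⊗[K] GSym K E) :
    φ.liftBaseChange O ((c ⊗ₜ gen K E i x) * t)
      = c • (φ ∘ₗ mulGen i x).liftBaseChange O t := by
  induction t using TensorProduct.induction_on with
  | zero => simp
  | add t t' h h' => rw [mul_add, map_add, h, h', map_add, smul_add]
  | tmul d b =>
    rw [Algebra.TensorProduct.tmul_mul_tmul, LinearMap.liftBaseChange_tmul,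
      LinearMap.liftBaseChange_tmul, mul_smul]
    rfl

/-- To compute the multilinearization, one can pretend that the splitting of an element is a pure
tensor. -/
theorem multilin_gen_mul_induction {φ : GSym K E →ₗ[K] M} {i : ℕ} {a : GSym K E}
    {P : O ⊗[K] E i → M → Prop} (zero : P 0 0)
    (tmul : ∀ c x, P (c ⊗ₜ x) (c • multilin s (φ ∘ₗ mulGen i x) a))
    (add : ∀ p q y z, P p y → P q z → P (p + q) (y + z)) (x : E i) :
    P (s i x) (multilin s φ (gen K E i x * a)) := by
  rw [multilin_apply, map_mul, spread_gen]
  induction s i x using TensorProduct.induction_on with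
  | zero => rw [map_zero, zero_mul, map_zero]; exact zero
  | add p q h h' => rw [map_add, add_mul, map_add]; exact add _ _ _ _ h h'
  | tmul c x =>
    rw [LinearMap.lTensor_tmul, liftBaseChange_tmul_gen_mul]
    exact tmul c x

/-- The splittings are `O`-linear, so a factor `f` moves into the coefficient ring `O` of `spread`
and from there out of the map. -/
theorem isMultilinear_multilin (φ : GSym K E →ₗ[K] M) : IsMultilinear O (multilin s φ) := by
  intro i x f a
  have h : ∀ (p : O ⊗[K] E i), (gen K E i).lTensor O (f • p) = f • (gen K E i).lTensor O p :=
    fun p => by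
      induction p using TensorProduct.induction_on with
      | zero => simp
      | add p q hp hq => rw [smul_add, map_add, hp, hq, map_add, smul_add]
      | tmul c x => simp [TensorProduct.smul_tmul']
  rw [multilin_apply, multilin_apply, map_mul (spread s), map_mul (spread s), spread_gen,
    spread_gen, map_smul, h, smul_mul_assoc, map_smul]

theorem comp_multilin (g : M →ₗ[O] N) (φ : GSym K E →ₗ[K] M) :
    g.restrictScalars K ∘ₗ multilin s φ = multilin s (g.restrictScalars K ∘ₗ φ) := by
  ext a
  rw [LinearMap.comp_apply, multilin_apply, multilin_apply]
  induction spread s a using TensorProduct.induction_on with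
  | zero => simp
  | add p q hp hq => simp only [map_add, hp, hq]
  | tmul c x => simp

/-- A multilinear map can take the coefficient `c` of each pure tensor `c ⊗ x` back to its argument,
where the splitting property reassembles the original element. -/
theorem multilin_eq_self (hs : ∀ i x, (LinearMap.id (R := K)).liftBaseChange O (s i x) = x)
    {φ : GSym K E →ₗ[K] M} (hφ : IsMultilinear O φ) (a : GSym K E) : multilin s φ a = φ a := by
  induction a using gen_induction generalizing φ with
  | one => exact multilin_one φ
  | gen_mul i x a ih =>
    have := multilin_gen_mul_induction (s := s) (φ := φ) (a := a)
      (P := fun p y => y = φ (gen K E i ((LinearMap.id (R := K)).liftBaseChange O p) * a))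
      (by simp) (fun c x => by
        rw [ih (hφ.comp_mulGen i x), LinearMap.liftBaseChange_tmul, LinearMap.id_apply, hφ]; rfl)
      (fun p q y z hy hz => by rw [hy, hz, map_add, map_add, add_mul, map_add]) x
    rwa [hs] at this
  | add a b ha hb => rw [map_add, ha hφ, hb hφ, map_add]
  | smul c a ha => rw [map_smul, ha hφ, map_smul]

/-- The map `spread` changes only coefficients in `O`, which carry no degree; the value in degree
`d` is therefore determined by `φ` in degree `d`. -/
theorem multilin_eq_zero {φ : GSym K E →ₗ[K] M} {d : ℤ} (hφ : ∀ a ∈ degreePart K E d, φ a = 0)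
    {a : GSym K E} (ha : a ∈ degreePart K E d) : multilin s φ a = 0 := by
  refine degreePart_induction (P := fun d a => ∀ φ : GSym K E →ₗ[K] M,
    (∀ a ∈ degreePart K E d, φ a = 0) → multilin s φ a = 0) ?_ ?_ ?_ ?_ ?_ ha φ hφ
  · intro d φ _; rw [map_zero]
  · intro φ hφ; rw [multilin_one]; exact hφ 1 SetLike.GradedOne.one_mem
  · intro d i x a _ ih φ hφ
    exact multilin_gen_mul_induction (s := s) (φ := φ) (a := a) (P := fun _ y => y = 0) rfl
      (fun c x => by
        rw [ih (φ ∘ₗ mulGen i x) fun b hb => hφ _ (gen_mul_mem hb i x), smul_zero])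
      (fun _ _ _ _ hy hz => by rw [hy, hz, add_zero]) x
  · intro d a b ha hb φ hφ; rw [map_add, ha φ hφ, hb φ hφ, add_zero]
  · intro d c a ha φ hφ; rw [map_smul, ha φ hφ, smul_zero]

theorem multilin_sub (φ ψ : GSym K E →ₗ[K] M) :
    multilin s (φ - ψ) = multilin s φ - multilin s ψ := by
  ext a
  rw [LinearMap.sub_apply, multilin_apply, multilin_apply, multilin_apply]
  induction spread s a using TensorProduct.induction_on with
  | zero => simp
  | add p q hp hq => simp only [map_add, hp, hq]; abel
  | tmul c x => simp

theorem multilin_congr {φ ψ : GSym K E →ₗ[K] M} {d : ℤ}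
    (h : ∀ a ∈ degreePart K E d, φ a = ψ a) {a : GSym K E} (ha : a ∈ degreePart K E d) :
    multilin s φ a = multilin s ψ a := by
  have := multilin_eq_zero (s := s) (φ := φ - ψ)
    (fun b hb => by rw [LinearMap.sub_apply, h b hb, sub_self]) ha
  rwa [multilin_sub, LinearMap.sub_apply, sub_eq_zero] at this

theorem HasDeg.multilin {h : ℤ} {H : GSym K E →ₗ[K] ⨁ i, E i} (hH : HasDeg h H) :
    HasDeg h (multilin s H) := fun d a ha i hi => by
  by_contra hdi
  refine hi ?_
  have := congrArg (fun g => g a) (comp_multilin (s := s) (DirectSum.component O ℕ E i) H)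
  refine this.trans (multilin_eq_zero (fun b hb => ?_) ha)
  by_contra hb'
  exact hdi (hH d b hb i hb')

section MultilinMap

variable {E' : ℕ → Type w'} [∀ i, AddCommGroup (E' i)] [∀ i, Module O (E' i)]
  [∀ i, Module K (E' i)] [∀ i, IsScalarTower K O (E' i)]
  {s' : ∀ i, E' i →ₗ[O] O ⊗[K] E' i} (f : ∀ i, E' i →ₗ[K] E i)

/-- Compatible splittings give compatible maps `spread`. This is how corrections are seen to vanish
on the direct summand `E'`. -/
theorem multilin_map (hs : ∀ i x, s i (f i x) = (f i).lTensor O (s' i x))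
    (φ : GSym K E →ₗ[K] M) (a : GSym K E') :
    multilin s φ (map f a) = multilin s' (φ ∘ₗ (map f).toLinearMap) a := by
  have h : (spread s).comp (map f)
      = (Algebra.TensorProduct.map (AlgHom.id K O) (map f)).comp (spread s') :=
    algHom_ext fun i x => by
      rw [AlgHom.comp_apply, AlgHom.comp_apply, map_gen, spread_gen, spread_gen, hs]
      induction s' i x using TensorProduct.induction_on with
      | zero => simp
      | add p q hp hq => simp only [map_add, hp, hq]
      | tmul c x => simp
  have h' := DFunLike.congr_fun h a
  rw [AlgHom.comp_apply, AlgHom.comp_apply] at h'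
  rw [multilin_apply, multilin_apply, h']
  induction spread s' a using TensorProduct.induction_on with
  | zero => simp
  | add p q hp hq => simp only [map_add, hp, hq]
  | tmul c x => simp

end MultilinMap

end Multilinear

end GSym
end LieInfty

namespace LieInfty

namespace GSym

/-! ### Binary convolutions, limits, and the unary part of multilinearizations. -/

section

variable {K : Type k} [Field K] {E : ℕ → Type w} [∀ i, AddCommGroup (E i)] [∀ i, Module K (E i)]
  {M N P : Type*} [AddCommGroup M] [Module K M] [AddCommGroup N] [Module K N]
  [AddCommGroup P] [Module K P]

theorem conv_pr_pr_gen_mul (μ : M →ₗ[K] N →ₗ[K] P) (φ : (⨁ i, E i) →ₗ[K] M)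
    (ψ : (⨁ i, E i) →ₗ[K] N) {n : ℤ} (hφ : ∀ i x, deg i ≠ n → φ (DirectSum.lof K ℕ E i x) = 0)
    (i : ℕ) (x : E i) (a : GSym K E) :
    conv μ (φ ∘ₗ pr K E) (ψ ∘ₗ pr K E) (gen K E i x * a)
      = μ (φ (DirectSum.lof K ℕ E i x)) (ψ (pr K E a))
        + sgn K (deg i * n) • μ (φ (pr K E a)) (ψ (DirectSum.lof K ℕ E i x)) := by
  have h1 : conv μ ((φ ∘ₗ pr K E) ∘ₗ mulGen i x) (ψ ∘ₗ pr K E)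
      = conv ((LinearMap.lsmul K P).flip ∘ₗ μ (φ (DirectSum.lof K ℕ E i x))).flip
          (aug K E).toLinearMap (ψ ∘ₗ pr K E) :=
    conv_congr fun d b _ c => by simp [pr_gen_mul]
  have h2 : (φ ∘ₗ pr K E) (signAut K E (deg i) a) = sgn K (deg i * n) • φ (pr K E a) :=
    pr_signAut _ φ hφ a
  rw [conv_pr_right_gen_mul, h1, conv_aug_left, h2]
  simp

theorem conv_eq_add {M₁ N₁ M₂ N₂ : Type*} [AddCommGroup M₁] [Module K M₁] [AddCommGroup N₁]
    [Module K N₁] [AddCommGroup M₂] [Module K M₂] [AddCommGroup N₂] [Module K N₂]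
    {μ : M →ₗ[K] N →ₗ[K] P} {φ : GSym K E →ₗ[K] M} {ψ : GSym K E →ₗ[K] N}
    {μ₁ : M₁ →ₗ[K] N₁ →ₗ[K] P} {φ₁ : GSym K E →ₗ[K] M₁} {ψ₁ : GSym K E →ₗ[K] N₁}
    {μ₂ : M₂ →ₗ[K] N₂ →ₗ[K] P} {φ₂ : GSym K E →ₗ[K] M₂} {ψ₂ : GSym K E →ₗ[K] N₂}
    (h : ∀ d, ∀ b ∈ degreePart K E d, ∀ c,
      μ (φ b) (ψ c) = μ₁ (φ₁ b) (ψ₁ c) + μ₂ (φ₂ b) (ψ₂ c)) :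
    conv μ φ ψ = conv μ₁ φ₁ ψ₁ + conv μ₂ φ₂ ψ₂ := by
  have h1 : μ.compl₁₂ φ ψ = μ₁.compl₁₂ φ₁ ψ₁ + μ₂.compl₁₂ φ₂ ψ₂ :=
    linearMap_ext fun d b hb => LinearMap.ext fun c => h d b hb c
  have h2 : TensorProduct.lift (μ₁.compl₁₂ φ₁ ψ₁ + μ₂.compl₁₂ φ₂ ψ₂)
      = TensorProduct.lift (μ₁.compl₁₂ φ₁ ψ₁) + TensorProduct.lift (μ₂.compl₁₂ φ₂ ψ₂) :=
    TensorProduct.ext' fun b c => by simp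
  rw [conv, conv, conv, h1, h2, LinearMap.add_comp]

theorem comp_coderivation (g : GSym K E →ₗ[K] P) (H : GSym K E →ₗ[K] ⨁ i, E i) :
    g ∘ₗ coderivation H = conv ((LinearMap.mul K (GSym K E) ∘ₗ ι K E).compr₂ g) H LinearMap.id := by
  rw [coderivation_eq_conv, comp_conv]
  exact conv_congr fun d b _ c => by simp

/-- A sequence of linear maps that becomes stationary in every degree has a limit. -/
theorem exists_limit {H : ℕ → GSym K E →ₗ[K] M}
    (h : ∀ (n : ℕ) d, -(n : ℤ) < d → ∀ a ∈ degreePart K E d, H (n + 1) a = H n a) :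
    ∃ G : GSym K E →ₗ[K] M, ∀ (n : ℕ) d, -(n : ℤ) < d → ∀ a ∈ degreePart K E d, G a = H n a := by
  have h' : ∀ (n m : ℕ) d, -(n : ℤ) < d → ∀ a ∈ degreePart K E d, H (n + m) a = H n a := by
    intro n m d hd a ha
    induction m with
    | zero => rfl
    | succ m ih => rw [← add_assoc, h _ d (by push_cast; omega) a ha, ih]
  -- In degree `d` the limit is read off at index `(-d).toNat + 1`; for `d ≤ 0` this is the first
  -- `n` with `-n < d`.
  refine ⟨DirectSum.toModule K ℤ M (fun d => H ((-d).toNat + 1) ∘ₗ (degreePart K E d).subtype) ∘ₗ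
    (DirectSum.decomposeLinearEquiv (degreePart K E)).toLinearMap, fun n d hd a ha => ?_⟩
  have : DirectSum.decomposeLinearEquiv (degreePart K E) a
      = DirectSum.lof K ℤ (fun d => degreePart K E d) d ⟨a, ha⟩ :=
    DirectSum.decompose_of_mem _ ha
  rw [LinearMap.comp_apply, LinearEquiv.coe_coe, this, DirectSum.toModule_lof]
  change H ((-d).toNat + 1) a = _
  rcases le_total n ((-d).toNat + 1) with hn | hn
  · obtain ⟨m, hm⟩ := Nat.exists_eq_add_of_le hn
    rw [hm, h' n m d hd a ha]
  · obtain ⟨m, hm⟩ := Nat.exists_eq_add_of_le hn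
    rw [hm, h' _ m d (by push_cast; omega) a ha]

end

section

variable {K : Type k} [Field K] {O : Type u} [CommRing O] [Algebra K O]
  {E : ℕ → Type w} [∀ i, AddCommGroup (E i)] [∀ i, Module O (E i)] [∀ i, Module K (E i)]
  [∀ i, IsScalarTower K O (E i)]
  {M : Type*} [AddCommGroup M] [Module O M] [Module K M] [IsScalarTower K O M]

/-- Multilinearization in polynomial-degree one sees only the restriction of `φ` to that part, so
linearity is needed there only. -/
theorem multilin_ι {s : ∀ i, E i →ₗ[O] O ⊗[K] E i}
    (hs : ∀ i x, (LinearMap.id (R := K)).liftBaseChange O (s i x) = x)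
    {φ : GSym K E →ₗ[K] M} {g : (⨁ i, E i) →ₗ[O] M} (hφ : ∀ y, φ (ι K E y) = g y)
    (y : ⨁ i, E i) : multilin s φ (ι K E y) = g y := by
  induction y using DirectSum.induction_on with
  | zero => simp
  | add x y hx hy => rw [map_add, map_add, hx, hy, map_add]
  | of i x =>
    have := multilin_gen_mul_induction (s := s) (φ := φ) (a := 1)
      (P := fun p y => y = g (DirectSum.lof O ℕ E i
        ((LinearMap.id (R := K)).liftBaseChange O p)))
      (by simp) (fun c x => by
        rw [multilin_one, LinearMap.liftBaseChange_tmul, LinearMap.id_apply, LinearMap.comp_apply,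
          LinearMap.mulLeft_apply, mul_one, ← ι_lof, hφ, map_smul, map_smul]; rfl)
      (fun p q y z hy hz => by rw [hy, hz, map_add, map_add, map_add]) x
    rw [hs, mul_one] at this
    exact this

theorem IsLeibniz.ι_mul {ρ : E 0 →ₗ[O] Derivation K O O} {H : GSym K E →ₗ[K] ⨁ i, E i}
    (hH : IsLeibniz ρ LinearMap.id H) {n : ℤ} {y : ⨁ i, E i} (hy : IsHomog n y) (f : O)
    (c : GSym K E) :
    H (ι K E (f • y) * c) = f • H (ι K E y * c) + sgn K n • ρ (pr K E c 0) f • y := by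
  rcases hy.eq_lof (K := K) with rfl | ⟨i, rfl, h⟩
  · simp
  · have h1 : f • y = DirectSum.lof K ℕ E i (f • y i) := by
      conv_lhs => rw [h]
      exact ((DirectSum.lof O ℕ E i).map_smul f (y i)).symm
    rw [h1, ι_lof, hH]
    conv_rhs => rw [h]
    rw [ι_lof, LinearMap.id_apply]

end

end GSym

/-! ### Resolutions of Lie-Rinehart algebras -/

/-- A resolution of `A` by the modules `E i`. -/
structure Resolution (O : Type u) [CommRing O] (A : Type v) [AddCommGroup A] [Module O A]
    (E : ℕ → Type w) [∀ i, AddCommGroup (E i)] [∀ i, Module O (E i)] where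
  /-- The differential. -/
  d : ∀ i, E (i + 1) →ₗ[O] E i
  /-- The augmentation. -/
  hook : E 0 →ₗ[O] A
  surjective : Function.Surjective hook
  exact_zero : Function.Exact (d 0) hook
  exact_succ : ∀ i, Function.Exact (d (i + 1)) (d i)

namespace Resolution

open GSym

section Complex

variable {O : Type u} [CommRing O] {A : Type v} [AddCommGroup A] [Module O A]
  {E : ℕ → Type w} [∀ i, AddCommGroup (E i)] [∀ i, Module O (E i)] (R : Resolution O A E)

/-- The differential on the total space. -/
def D : (⨁ i, E i) →ₗ[O] ⨁ i, E i :=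
  DirectSum.toModule O ℕ _ fun
    | 0 => 0
    | i + 1 => DirectSum.lof O ℕ E i ∘ₗ R.d i

theorem D_apply (y : ⨁ i, E i) (i : ℕ) : R.D y i = R.d i (y (i + 1)) := by
  induction y using DirectSum.induction_on with
  | zero => simp
  | add x y hx hy => rw [map_add, DirectSum.add_apply, hx, hy, DirectSum.add_apply, map_add]
  | of j x =>
    rw [← DirectSum.lof_eq_of O, D, DirectSum.toModule_lof]
    cases j with
    | zero => simp [DirectSum.lof_eq_of, DirectSum.of_eq_of_ne]
    | succ j =>
      by_cases h : i = j
      · subst h; simp [DirectSum.lof_apply]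
      · rw [LinearMap.comp_apply, DirectSum.lof_eq_of, DirectSum.lof_eq_of,
          DirectSum.of_eq_of_ne _ _ _ h, DirectSum.of_eq_of_ne _ _ _ (by omega), map_zero]

theorem D_lof_succ (i : ℕ) (x : E (i + 1)) :
    R.D (DirectSum.lof O ℕ E (i + 1) x) = DirectSum.lof O ℕ E i (R.d i x) := by
  rw [D, DirectSum.toModule_lof]; rfl

/-- The augmentation of the total space. -/
def aug : (⨁ i, E i) →ₗ[O] A := R.hook ∘ₗ DirectSum.component O ℕ E 0

theorem aug_apply (y : ⨁ i, E i) : R.aug y = R.hook (y 0) := rfl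

theorem aug_D (y : ⨁ i, E i) : R.aug (R.D y) = 0 := by
  rw [aug_apply, D_apply]; exact R.exact_zero.apply_apply_eq_zero _

theorem D_isHomog {n : ℤ} {y : ⨁ i, E i} (hy : IsHomog n y) : IsHomog (n + 1) (R.D y) :=
  fun i hi => by
    rw [D_apply] at hi
    have := hy (i + 1) fun h => hi (by rw [h, map_zero])
    rw [← this]; simp only [deg]; push_cast; ring

variable (K : Type k) [Field K] [Algebra K O] [∀ i, Module K (E i)] [∀ i, IsScalarTower K O (E i)]
  [Module K A] [IsScalarTower K O A]

/-- There is a contraction over the field `K`. -/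
theorem exists_contraction : ∃ σ : (⨁ i, E i) →ₗ[K] ⨁ i, E i,
    (∀ n y, IsHomog n y → IsHomog (n - 1) (σ y)) ∧ (∀ y, R.aug (σ y) = 0) ∧
    ∀ y, R.D y = 0 → R.aug y = 0 → R.D (σ y) = y := by
  have h : ∀ i, ∃ g : E i →ₗ[K] E (i + 1), ∀ x ∈ LinearMap.range (R.d i), R.d i (g x) = x := by
    intro i
    -- Over a field the differential has a right inverse on its image, and this extends to the whole
    -- space. Neither step is available over `O`.
    obtain ⟨g, hg⟩ := LinearMap.exists_rightInverse_of_surjective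
      ((R.d i).restrictScalars K).rangeRestrict (LinearMap.range_rangeRestrict _)
    obtain ⟨g', hg'⟩ := LinearMap.exists_extend g
    refine ⟨g', fun x hx => ?_⟩
    have h1 := LinearMap.congr_fun hg ⟨x, hx⟩
    have h2 := LinearMap.congr_fun hg' ⟨x, hx⟩
    have h3 : R.d i (g ⟨x, hx⟩) = x := congrArg Subtype.val h1
    rwa [← h2] at h3
  choose g hg using h
  let σ : (⨁ i, E i) →ₗ[K] ⨁ i, E i :=
    DirectSum.toModule K ℕ _ fun i => DirectSum.lof K ℕ E (i + 1) ∘ₗ g i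
  have hσ : ∀ y i, σ y (i + 1) = g i (y i) := fun y i => by
    induction y using DirectSum.induction_on with
    | zero => simp
    | add x y hx hy => rw [map_add, DirectSum.add_apply, hx, hy, DirectSum.add_apply, map_add]
    | of j x =>
      rw [← DirectSum.lof_eq_of K, DirectSum.toModule_lof, LinearMap.comp_apply]
      by_cases h : i = j
      · subst h; simp [DirectSum.lof_apply]
      · rw [DirectSum.lof_eq_of, DirectSum.lof_eq_of,
          DirectSum.of_eq_of_ne _ _ _ h, DirectSum.of_eq_of_ne _ _ _ (by omega), map_zero]
  have hσ0 : ∀ y, σ y 0 = 0 := fun y => by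
    induction y using DirectSum.induction_on with
    | zero => simp
    | add x y hx hy => rw [map_add, DirectSum.add_apply, hx, hy, add_zero]
    | of j x =>
      rw [← DirectSum.lof_eq_of K, DirectSum.toModule_lof, LinearMap.comp_apply,
        DirectSum.lof_eq_of, DirectSum.of_eq_of_ne _ _ _ (by omega)]
  refine ⟨σ, fun n y hy i hi => ?_, fun y => ?_, fun y hy hy' => ?_⟩
  · cases i with
    | zero => exact absurd (hσ0 y) hi
    | succ i =>
      rw [hσ] at hi
      have := hy i fun h => hi (by rw [h, map_zero])
      rw [← this]; simp only [deg]; push_cast; ring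
  · rw [aug_apply, hσ0, map_zero]
  · ext i
    rw [D_apply, hσ]
    apply hg
    -- Exactness is applied in two forms: in degree `-1` it requires the vanishing of the
    -- augmentation, below that the vanishing of `D y`.
    cases i with
    | zero => exact (R.exact_zero _).1 hy'
    | succ i =>
      refine (R.exact_succ i _).1 ?_
      rw [← D_apply, hy, DirectSum.zero_apply]

end Complex

/-! ### The bracket of the Lie-Rinehart algebra on the graded symmetric algebra. -/

section Bracket

variable {K : Type k} [Field K] [CharZero K] {O : Type u} [CommRing O] [Algebra K O]
  {A : Type v} [LieRing A] [Module O A] [LieRingModule A O] [LieRinehartRing O A]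
  [LieAlgebra K A] [LieRinehartAlgebra K O A]
  {E : ℕ → Type w} [∀ i, AddCommGroup (E i)] [∀ i, Module O (E i)] [∀ i, Module K (E i)]
  [∀ i, IsScalarTower K O (E i)] (R : Resolution O A E)

variable (K) in
/-- The anchor map that is induced by the anchor map of `A`. -/
def anchor : E 0 →ₗ[O] Derivation K O O where
  toFun x := LieRinehartAlgebra.anchor K O A (R.hook x)
  map_add' x y := by rw [map_add, map_add]
  map_smul' f x := by
    rw [map_smul]; exact (LieRinehartAlgebra.anchor K O A).map_smul_apply f _

theorem anchor_apply (x : E 0) (f : O) : R.anchor K x f = ⁅R.hook x, f⁆ := rfl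

theorem anchor_eq_aug (y : ⨁ i, E i) (f : O) : R.anchor K (y 0) f = ⁅R.aug y, f⁆ := rfl

variable (K) in
/-- The augmentation of the total space, as a `K`-linear map. -/
def augK : (⨁ i, E i) →ₗ[K] A := R.aug.restrictScalars K

theorem augK_apply (y : ⨁ i, E i) : R.augK K y = R.aug y := rfl

theorem apply_zero_lof (i : ℕ) (x : E i) (hi : deg i ≠ -1) :
    DirectSum.lof K ℕ E i x 0 = 0 := by
  by_contra h
  exact hi (isHomog_lof i x 0 h).symm

theorem augK_lof (i : ℕ) (x : E i) (hi : deg i ≠ -1) :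
    R.augK K (DirectSum.lof K ℕ E i x) = 0 := by
  rw [augK_apply, aug_apply, apply_zero_lof i x hi, map_zero]

variable (K) in
/-- The bracket of `A`, as a map on the graded symmetric algebra. -/
def lie : GSym K E →ₗ[K] A :=
  -- The coproduct of `x * y` contains both orders; in degree `-1` the Koszul sign and the skew
  -- symmetry of the bracket make the two contributions equal.
  conv ((2⁻¹ : K) • (LieModule.toEnd K A A : A →ₗ[K] Module.End K A))
    (R.augK K ∘ₗ pr K E) (R.augK K ∘ₗ pr K E)

theorem lie_one : R.lie K 1 = 0 := by
  rw [lie, conv_one, LinearMap.comp_apply, pr_one]; simp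

theorem lie_gen_mul (i : ℕ) (x : E i) (a : GSym K E) :
    R.lie K (gen K E i x * a) = ⁅R.aug (DirectSum.lof K ℕ E i x), R.aug (pr K E a)⁆ := by
  rw [lie, conv_pr_pr_gen_mul _ _ _ R.augK_lof]
  by_cases hi : deg i = -1
  · rw [hi, show (-1 : ℤ) * -1 = 1 by norm_num, sgn_one, neg_smul, one_smul]
    change (2⁻¹ : K) • ⁅R.augK K (DirectSum.lof K ℕ E i x), R.augK K (pr K E a)⁆
      + -((2⁻¹ : K) • ⁅R.augK K (pr K E a), R.augK K (DirectSum.lof K ℕ E i x)⁆) = _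
    rw [← lie_skew (R.augK K (pr K E a)), smul_neg, neg_neg, ← add_smul, ← two_mul,
      mul_inv_cancel₀ two_ne_zero, one_smul]
    rfl
  · rw [R.augK_lof i x hi, ← augK_apply (K := K), R.augK_lof i x hi]; simp

theorem lie_ι_mul (y : ⨁ i, E i) (a : GSym K E) :
    R.lie K (ι K E y * a) = ⁅R.aug y, R.aug (pr K E a)⁆ := by
  induction y using DirectSum.induction_on with
  | zero => simp
  | of i x => exact R.lie_gen_mul i x a
  | add x y hx hy => rw [map_add, add_mul, map_add, hx, hy, map_add, add_lie]

theorem lie_ι (y : ⨁ i, E i) : R.lie K (ι K E y) = 0 := by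
  have := R.lie_ι_mul (K := K) y 1
  rwa [mul_one, pr_one, map_zero, lie_zero] at this

/-- Only products of two elements of `E 0` contribute, and these have degree `-2`. -/
theorem lie_eq_zero {d : ℤ} (hd : d ≠ -2) {a : GSym K E} (ha : a ∈ degreePart K E d) :
    R.lie K a = 0 := by
  refine degreePart_induction (P := fun d a => d ≠ -2 → R.lie K a = 0) ?_ ?_ ?_ ?_ ?_ ha hd
  · intro d _; rw [map_zero]
  · intro _; exact R.lie_one
  · intro d i x a ha _ hd
    rw [lie_gen_mul]
    by_cases hi : deg i = -1
    · have : pr K E a 0 = 0 := by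
        by_contra h
        have := hasDeg_pr d a ha 0 h
        simp only [deg] at this
        omega
      rw [R.aug_apply (pr K E a), this, map_zero, lie_zero]
    · rw [← augK_apply (K := K), R.augK_lof i x hi, zero_lie]
  · intro d a b ha hb hd; rw [map_add, ha hd, hb hd, add_zero]
  · intro d c a ha hd; rw [map_smul, ha hd, smul_zero]

theorem isLeibniz_lie : IsLeibniz (R.anchor K) R.aug (R.lie K) := by
  intro i x f a
  rw [lie_gen_mul, lie_gen_mul, anchor_eq_aug]
  have h : DirectSum.lof K ℕ E i (f • x) = f • DirectSum.lof K ℕ E i x :=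
    (DirectSum.lof O ℕ E i).map_smul f x
  rw [h, map_smul]
  by_cases hi : deg i = -1
  · rw [hi, sgn_neg_one, neg_smul, one_smul, ← lie_skew, LieRinehartRing.leibniz_smul_right,
      ← lie_skew (R.aug (pr K E a)), smul_neg]
    abel
  · rw [← augK_apply (K := K) R (DirectSum.lof K ℕ E i x), R.augK_lof i x hi]; simp

/-- The Jacobi identity of `A`. -/
theorem lie_coderivation {H : GSym K E →ₗ[K] ⨁ i, E i}
    (hH : ∀ a, R.aug (H a) = R.lie K a) (a : GSym K E) : R.lie K (coderivation H a) = 0 := by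
  let μ : A →ₗ[K] A →ₗ[K] A := (LieModule.toEnd K A A : A →ₗ[K] Module.End K A)
  have hμ : ∀ u v, μ u v = ⁅u, v⁆ := fun _ _ => rfl
  have h1 : R.lie K ∘ₗ coderivation H = conv μ (R.lie K) (R.augK K ∘ₗ pr K E) := by
    rw [comp_coderivation]
    refine conv_congr fun d b _ c => ?_
    rw [hμ, ← hH]
    exact R.lie_ι_mul (H b) c
  -- In the form that `⁅u, ·⁆` is a derivation, the Jacobi identity evaluates the double bracket.
  have h2 : ∀ u a, conv (μ ∘ₗ μ u) (R.augK K ∘ₗ pr K E) (R.augK K ∘ₗ pr K E) a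
      = ⁅u, R.lie K a⁆ := fun u a => by
    induction a using gen_induction with
    | one =>
      rw [conv_one, LinearMap.comp_apply, LinearMap.comp_apply, pr_one, map_zero, map_zero,
        R.lie_one, lie_zero]
    | gen_mul i x a _ =>
      rw [conv_pr_pr_gen_mul _ _ _ R.augK_lof, lie_gen_mul]
      simp only [LinearMap.comp_apply, hμ, augK_apply]
      by_cases hi : deg i = -1
      · rw [hi, show (-1 : ℤ) * -1 = 1 by norm_num, sgn_one, neg_smul, one_smul,
          leibniz_lie u, ← lie_skew (R.aug _) ⁅u, R.aug (pr K E a)⁆]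
      · rw [← augK_apply (K := K) R (DirectSum.lof K ℕ E i x), R.augK_lof i x hi]; simp
    | add a b ha hb => rw [map_add, ha, hb, map_add, lie_add]
    | smul c a ha => rw [map_smul, ha, map_smul, lie_smul]
  have h3 : R.lie K (coderivation H a) = conv μ (R.lie K) (R.augK K ∘ₗ pr K E) a :=
    LinearMap.congr_fun h1 a
  rw [h3]
  clear h3 h1
  induction a using gen_induction with
  | one => rw [conv_one, R.lie_one, map_zero, LinearMap.zero_apply]
  | gen_mul i x a _ =>
    have h4 : conv μ (R.lie K ∘ₗ mulGen i x) (R.augK K ∘ₗ pr K E)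
        = conv (μ ∘ₗ μ (R.aug (DirectSum.lof K ℕ E i x))) (R.augK K ∘ₗ pr K E)
          (R.augK K ∘ₗ pr K E) := conv_congr fun d b _ c => by
      simp only [LinearMap.comp_apply, LinearMap.mulLeft_apply, hμ, lie_gen_mul, augK_apply]
    -- The map `lie` is supported in the even degree `-2`, where `signAut` is the identity.
    have h5 : ∀ a, R.lie K (signAut K E (deg i) a) = R.lie K a := fun a => by
      induction a using homogeneous_induction with
      | zero => rw [map_zero]
      | mem d a ha =>
        rw [signAut_of_mem _ ha, map_smul]
        by_cases hd : d = -2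
        · rw [hd, mul_comm, sgn, zpow_mul]; simp
        · rw [R.lie_eq_zero hd ha, smul_zero]
      | add a b ha hb => rw [map_add, map_add, ha, hb, map_add]
    rw [conv_pr_right_gen_mul, h4, h2, h5, hμ, augK_apply, ← lie_skew, neg_add_cancel]
  | add a b ha hb => rw [map_add, ha, hb, add_zero]
  | smul c a ha => rw [map_smul, ha, smul_zero]

end Bracket

end Resolution
end LieInfty

namespace LieInfty

namespace Resolution

open GSym

/-! ### Almost brackets and the removal of their Jacobiator. -/

section Approx

variable {K : Type k} [Field K] [CharZero K] {O : Type u} [CommRing O] [Algebra K O]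
  {A : Type v} [LieRing A] [Module O A] [LieRingModule A O] [LieRinehartRing O A]
  [LieAlgebra K A] [LieRinehartAlgebra K O A]
  {E : ℕ → Type w} [∀ i, AddCommGroup (E i)] [∀ i, Module O (E i)] [∀ i, Module K (E i)]
  [∀ i, IsScalarTower K O (E i)] (R : Resolution O A E)

/-- The map `H` has all the properties of the brackets of a Lie ∞-algebroid that covers `A`, with
the exception of the higher Jacobi identities. -/
structure IsAlmost (H : GSym K E →ₗ[K] ⨁ i, E i) : Prop where
  hasDeg : HasDeg 1 H
  one : H 1 = 0
  unary : ∀ y, H (ι K E y) = R.D y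
  leibniz : IsLeibniz (R.anchor K) LinearMap.id H
  aug : ∀ a, R.aug (H a) = R.lie K a

/-- The value of the anchor on a vector, applied to a function, as a linear map in the vector. -/
def anchorAt (f : O) : (⨁ i, E i) →ₗ[K] O where
  toFun y := R.anchor K (y 0) f
  map_add' x y := by rw [DirectSum.add_apply, map_add, Derivation.add_apply]
  map_smul' c y := by
    rw [DirectSum.smul_apply, ← algebraMap_smul O c (y 0), map_smul, Derivation.smul_apply,
      algebraMap_smul, RingHom.id_apply]

theorem anchorAt_lof (f : O) (i : ℕ) (x : E i)
    (hi : deg i ≠ -1) : R.anchorAt (K := K) f (DirectSum.lof K ℕ E i x) = 0 := by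
  change R.anchor K (DirectSum.lof K ℕ E i x 0) f = 0
  rw [apply_zero_lof i x hi, map_zero, Derivation.zero_apply]

/-- The action `(f, y) ↦ ρ(y)[f]`. -/
def act : O →ₗ[K] (⨁ i, E i) →ₗ[K] O where
  toFun f := R.anchorAt f
  map_add' f g := by
    exact LinearMap.ext fun y => map_add (R.anchor K (y 0)) f g
  map_smul' c f := by
    exact LinearMap.ext fun y => (R.anchor K (y 0)).map_smul c f

theorem act_apply (f : O) (y : ⨁ i, E i) : R.act (K := K) f y = R.anchor K (y 0) f := rfl

variable {R} {H : GSym K E →ₗ[K] ⨁ i, E i}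

/-- The Jacobiator. -/
abbrev jac (H : GSym K E →ₗ[K] ⨁ i, E i) : GSym K E →ₗ[K] ⨁ i, E i := H ∘ₗ coderivation H

namespace IsAlmost

theorem hasDeg_jac (hH : R.IsAlmost H) : HasDeg 2 (jac H) := fun d a ha => by
  have := hH.hasDeg _ _ (coderivation_mem hH.hasDeg ha)
  rwa [add_assoc] at this

theorem jac_one (hH : R.IsAlmost H) : jac H 1 = 0 := by
  rw [LinearMap.comp_apply, coderivation_one, hH.one, map_zero, map_zero]

theorem coderivation_ι (hH : R.IsAlmost H) (y : ⨁ i, E i) :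
    coderivation H (ι K E y) = ι K E (R.D y) := by
  rw [← hH.unary]
  induction y using DirectSum.induction_on with
  | zero => simp
  | add x y hx hy => simp only [map_add, hx, hy]
  | of i x =>
    have := coderivation_gen_mul hH.hasDeg i x 1
    rw [mul_one, coderivation_one, coderivation_one, hH.one, map_zero, mul_zero, smul_zero,
      add_zero, LinearMap.comp_apply, LinearMap.mulLeft_apply, mul_one] at this
    exact this

/-- The hook carries the Jacobiator to that of `A`, which is zero. In degree `-1` this is the
condition under which exactness gives a primitive. -/
theorem aug_jac (hH : R.IsAlmost H) (a : GSym K E) : R.aug (jac H a) = 0 := by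
  rw [LinearMap.comp_apply, hH.aug]
  exact R.lie_coderivation hH.aug a

/-- On a single argument the Jacobiator is the square of the differential. -/
theorem jac_ι (hH : R.IsAlmost H) (y : ⨁ i, E i) : jac H (ι K E y) = 0 := by
  rw [LinearMap.comp_apply, hH.coderivation_ι, hH.unary]
  ext i
  rw [R.D_apply, R.D_apply, (R.exact_succ i).apply_apply_eq_zero, DirectSum.zero_apply]

/-- The anchor is compatible with the binary brackets. -/
theorem conv_act (hH : R.IsAlmost H) (f : O) (a : GSym K E) :
    conv R.act (R.anchorAt f ∘ₗ pr K E) (LinearMap.id ∘ₗ pr K E) a = -R.anchor K (H a 0) f := by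
  induction a using gen_induction with
  | one => rw [conv_one, LinearMap.comp_apply, pr_one, hH.one]; simp
  | gen_mul i x a _ =>
    rw [conv_pr_pr_gen_mul _ _ _ (R.anchorAt_lof f), anchor_eq_aug, hH.aug, lie_gen_mul]
    simp only [act_apply, LinearMap.id_apply, anchor_eq_aug, lie_lie]
    have h1 : ∀ y, R.anchorAt (K := K) f y = ⁅R.aug y, f⁆ := fun _ => rfl
    rw [h1, h1]
    by_cases hi : deg i = -1
    · rw [hi, show (-1 : ℤ) * -1 = 1 by norm_num, sgn_one, neg_smul, one_smul]
      abel
    · rw [← augK_apply (K := K) R (DirectSum.lof K ℕ E i x), R.augK_lof i x hi]; simp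
  | add a b ha hb =>
    rw [map_add, ha, hb, map_add, DirectSum.add_apply, map_add, Derivation.add_apply, neg_add]
  | smul c a ha =>
    rw [map_smul (conv _ _ _), ha, map_smul H, anchor_eq_aug, anchor_eq_aug,
      ← augK_apply (K := K), ← augK_apply (K := K), map_smul (R.augK K), smul_neg, ← smul_lie]

/-- The Jacobiator is multilinear. -/
theorem isMultilinear_jac (hH : R.IsAlmost H) : IsMultilinear O (jac H) := by
  intro i x f a
  let S : (⨁ i, E i) →ₗ[K] GSym K E →ₗ[K] ⨁ i, E i :=
    (LinearMap.mul K (GSym K E) ∘ₗ ι K E).compr₂ H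
  have hS : ∀ y c, S y c = H (ι K E y * c) := fun _ _ => rfl
  have hQ : ∀ (G : GSym K E →ₗ[K] ⨁ i, E i) b, H (coderivation G b) = conv S G LinearMap.id b :=
    fun G b => LinearMap.congr_fun (comp_coderivation H G) b
  let sm : O →ₗ[K] (⨁ i, E i) →ₗ[K] ⨁ i, E i := (Algebra.lsmul K K (⨁ i, E i)).toLinearMap
  have hsm : ∀ g y, sm g y = g • y := fun _ _ => rfl
  let lx : O →ₗ[K] ⨁ i, E i := sm.flip (DirectSum.lof K ℕ E i x)
  have hlx : ∀ g, lx g = g • DirectSum.lof K ℕ E i x := fun _ => rfl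
  let Hx := H ∘ₗ mulGen i x
  -- Four applications of the Leibniz rule are compared: `e1` expands the inner bracket at `f • x`,
  -- `e2` and `e3` expand the outer bracket on the two resulting terms, and `hH.leibniz` treats the
  -- terms with `x` outside the inner bracket.
  have e1 : H ∘ₗ mulGen i (f • x)
      = sm f ∘ₗ Hx + sgn K (deg i) • (lx ∘ₗ R.anchorAt f ∘ₗ pr K E) := by
    ext1 b
    exact hH.leibniz i x f b
  have e2 : conv S (sm f ∘ₗ Hx) LinearMap.id = sm f ∘ₗ conv S Hx LinearMap.id
      + conv sm.flip ((-sgn K (deg i)) • (Hx ∘ₗ (signAut K E (-1)).toLinearMap))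
        (R.anchorAt f ∘ₗ pr K E) := by
    rw [comp_conv]
    refine conv_eq_add fun d b hb c => ?_
    have hy : IsHomog (deg i + d + 1) (Hx b) := hH.hasDeg _ _ (gen_mul_mem hb i x)
    simp only [hS, LinearMap.comp_apply, LinearMap.id_apply, hsm, LinearMap.compr₂_apply,
      LinearMap.smul_apply, LinearMap.flip_apply, AlgHom.toLinearMap_apply]
    rw [hH.leibniz.ι_mul hy, signAut_of_mem _ hb]
    congr 1
    rw [map_smul, smul_smul, smul_comm, sgn_add, sgn_add, sgn_one, neg_one_mul, sgn_neg]
    rw [mul_neg_one, neg_mul]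
    rfl
  have e3 : conv S (lx ∘ₗ R.anchorAt f ∘ₗ pr K E) LinearMap.id
      = conv sm (R.anchorAt f ∘ₗ pr K E) Hx
        + sgn K (deg i) • (lx ∘ₗ conv R.act (R.anchorAt f ∘ₗ pr K E) (LinearMap.id ∘ₗ pr K E)) := by
    rw [comp_conv, show sgn K (deg i) • conv ((R.act).compr₂ lx) (R.anchorAt f ∘ₗ pr K E)
      (LinearMap.id ∘ₗ pr K E) = conv (sgn K (deg i) • (R.act).compr₂ lx)
      (R.anchorAt f ∘ₗ pr K E) (LinearMap.id ∘ₗ pr K E) by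
        rw [← conv_smul_left]; exact conv_congr fun d b _ c => by simp]
    refine conv_eq_add fun d b hb c => ?_
    simp only [hS, LinearMap.comp_apply, LinearMap.id_apply, hsm, hlx, LinearMap.compr₂_apply,
      LinearMap.smul_apply]
    rw [hH.leibniz.ι_mul (isHomog_lof i x)]
    rfl
  -- Cocommutativity identifies the anchor terms of `e2` and `e3`, which then cancel. The remaining
  -- second-order term of `e3` is evaluated by `conv_act` and cancels against the outer anchor term.
  have e4 : conv sm (R.anchorAt f ∘ₗ pr K E) Hx
      = conv sm.flip (Hx ∘ₗ (signAut K E (-1)).toLinearMap) (R.anchorAt f ∘ₗ pr K E) :=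
    LinearMap.ext fun b => conv_pr_comm sm _ (R.anchorAt_lof f) Hx b
  rw [LinearMap.comp_apply, LinearMap.comp_apply, coderivation_gen_mul hH.hasDeg,
    coderivation_gen_mul hH.hasDeg, map_add, map_add, hQ, hQ, e1, conv_add_left, conv_smul_left,
    e2, e3, e4, conv_smul_left, map_smul H, map_smul H, hH.leibniz, pr_coderivation, smul_add f]
  simp only [LinearMap.add_apply, LinearMap.smul_apply, LinearMap.comp_apply, hH.conv_act, hlx, hsm,
    smul_add, smul_smul, sgn_mul_self, one_smul, mul_one, neg_smul, LinearMap.id_apply]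
  rw [smul_comm f (sgn K (deg i))]
  abel

/-- If the Jacobiator vanishes in degrees `> d`, then it is a cocycle in degree `d`. -/
theorem D_jac (hH : R.IsAlmost H) {d : ℤ}
    (hd : ∀ e, d < e → ∀ b ∈ degreePart K E e, jac H b = 0) {a : GSym K E}
    (ha : a ∈ degreePart K E d) : R.D (jac H a) = 0 := by
  -- A Bianchi identity: in degree `d` the co-derivation of the Jacobiator reduces to its
  -- coefficient and equals the square of `coderivation H`. Hence `D (jac H a)` is `jac H` at
  -- `coderivation H a`, of degree `d + 1`.
  rw [← hH.unary, ← coderivation_eq_ι hH.hasDeg_jac ha hd, ← coderivation_sq hH.hasDeg]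
  exact hd (d + 1) (by omega) _ (coderivation_mem hH.hasDeg ha)

variable {s : ∀ i, E i →ₗ[O] O ⊗[K] E i} {σ : (⨁ i, E i) →ₗ[K] ⨁ i, E i}

/-- The correction of the brackets by means of a contraction `σ`. -/
def _root_.LieInfty.Resolution.improve (s : ∀ i, E i →ₗ[O] O ⊗[K] E i)
    (σ : (⨁ i, E i) →ₗ[K] ⨁ i, E i) (H : GSym K E →ₗ[K] ⨁ i, E i) : GSym K E →ₗ[K] ⨁ i, E i :=
  H + -multilin s (σ ∘ₗ jac H)

theorem hasDeg_correction (hH : R.IsAlmost H) (hσ : ∀ n y, IsHomog n y → IsHomog (n - 1) (σ y)) :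
    HasDeg 1 (-multilin s (σ ∘ₗ jac H)) := by
  have : HasDeg 1 (σ ∘ₗ jac H) := fun d a ha => by
    have := hσ _ _ (hH.hasDeg_jac d a ha)
    rwa [show d + 2 - 1 = d + 1 by ring] at this
  have h : (-1 : K) • multilin s (σ ∘ₗ jac H) = -multilin s (σ ∘ₗ jac H) :=
    LinearMap.ext fun a => by
      rw [LinearMap.smul_apply, neg_smul, one_smul, LinearMap.neg_apply]
  rw [← h]
  exact this.multilin.smul (-1)

theorem correction_ι (hH : R.IsAlmost H)
    (hs : ∀ i x, (LinearMap.id (R := K)).liftBaseChange O (s i x) = x) (y : ⨁ i, E i) :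
    (-multilin s (σ ∘ₗ jac H)) (ι K E y) = 0 := by
  have := multilin_ι hs (φ := σ ∘ₗ jac H) (g := (0 : (⨁ i, E i) →ₗ[O] ⨁ i, E i))
    (fun y => by rw [LinearMap.comp_apply, hH.jac_ι, map_zero]; rfl) y
  rw [LinearMap.neg_apply, this]; simp

theorem correction_eq_zero {e : ℤ} (he : ∀ b ∈ degreePart K E e, jac H b = 0) {b : GSym K E}
    (hb : b ∈ degreePart K E e) : (-multilin s (σ ∘ₗ jac H)) b = 0 := by
  rw [LinearMap.neg_apply, multilin_eq_zero (fun b hb => by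
    rw [LinearMap.comp_apply, he b hb, map_zero]) hb, neg_zero]

theorem improve (hH : R.IsAlmost H)
    (hs : ∀ i x, (LinearMap.id (R := K)).liftBaseChange O (s i x) = x)
    (hσ : ∀ n y, IsHomog n y → IsHomog (n - 1) (σ y)) (hσ' : ∀ y, R.aug (σ y) = 0) :
    R.IsAlmost (improve s σ H) where
  hasDeg := hH.hasDeg.add (hH.hasDeg_correction hσ)
  one := by
    rw [Resolution.improve, LinearMap.add_apply, hH.one, LinearMap.neg_apply, multilin_one,
      LinearMap.comp_apply, hH.jac_one, map_zero, neg_zero, add_zero]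
  unary y := by
    rw [Resolution.improve, LinearMap.add_apply, hH.unary, hH.correction_ι hs, add_zero]
  leibniz := hH.leibniz.add (isMultilinear_multilin _).neg
  aug a := by
    have h1 := LinearMap.congr_fun (comp_multilin (s := s) R.aug (σ ∘ₗ jac H)) a
    have h2 : R.aug.restrictScalars K ∘ₗ σ ∘ₗ jac H = 0 := LinearMap.ext fun b => hσ' _
    have h3 : multilin s (0 : GSym K E →ₗ[K] A) a = 0 := by
      have := multilin_sub (s := s) (0 : GSym K E →ₗ[K] A) 0
      rw [sub_self, sub_self] at this
      rw [this, LinearMap.zero_apply]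
    rw [h2, h3] at h1
    rw [Resolution.improve, LinearMap.add_apply, map_add, hH.aug, LinearMap.neg_apply, map_neg]
    have h4 : R.aug (multilin s (σ ∘ₗ jac H) a) = 0 := h1
    rw [h4, neg_zero, add_zero]

theorem improve_eq {d : ℤ} (hd : ∀ b ∈ degreePart K E d, jac H b = 0) {a : GSym K E}
    (ha : a ∈ degreePart K E d) : Resolution.improve s σ H a = H a := by
  rw [Resolution.improve, LinearMap.add_apply, correction_eq_zero hd ha, add_zero]

/-- With correction `G`, the Jacobiator in degrees `≥ d` becomes `jac H + D ∘ G`: the term `G ∘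
coderivation H` has its argument in degree above `d`, and `G` vanishes on single arguments. -/
theorem jac_improve (hH : R.IsAlmost H)
    (hs : ∀ i x, (LinearMap.id (R := K)).liftBaseChange O (s i x) = x)
    (hσ : ∀ n y, IsHomog n y → IsHomog (n - 1) (σ y))
    (hσ' : ∀ y, R.D y = 0 → R.aug y = 0 → R.D (σ y) = y) {d : ℤ}
    (hd : ∀ e, d < e → ∀ b ∈ degreePart K E e, jac H b = 0) {e : ℤ} (he : d ≤ e) {a : GSym K E}
    (ha : a ∈ degreePart K E e) : jac (Resolution.improve s σ H) a = 0 := by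
  set G := -multilin s (σ ∘ₗ jac H) with hG
  have hGdeg : HasDeg 1 G := hH.hasDeg_correction hσ
  have hGv : ∀ e, d < e → ∀ b ∈ degreePart K E e, G b = 0 := fun e he b hb =>
    correction_eq_zero (hd e he) hb
  have h1 : jac (Resolution.improve s σ H) a = jac H a + R.D (G a) := by
    have h2 : coderivation G a = ι K E (G a) :=
      coderivation_eq_ι hGdeg ha fun e' he' => hGv e' (by omega)
    rw [Resolution.improve, ← hG, LinearMap.comp_apply, coderivation_add, LinearMap.add_apply,
      LinearMap.add_apply, h2, map_add, map_add, hH.unary,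
      hGv (e + 1) (by omega) _ (coderivation_mem hH.hasDeg ha), hG, hH.correction_ι hs]
    rw [add_zero, add_zero]; rfl
  rw [h1]
  rcases he.lt_or_eq with he | rfl
  · rw [hGv e he a ha, hd e he a ha, map_zero, add_zero]
  -- Since `D` is `O`-linear it commutes with `multilin`; there `D ∘ σ` is the identity on the
  -- cocycle `jac H`, and `multilin` fixes `jac H`.
  · have h2 := LinearMap.congr_fun (comp_multilin (s := s) R.D (σ ∘ₗ jac H)) a
    have h3 : multilin s (R.D.restrictScalars K ∘ₗ σ ∘ₗ jac H) a = multilin s (jac H) a :=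
      multilin_congr (fun b hb => hσ' _ (hH.D_jac hd hb) (hH.aug_jac b)) ha
    rw [h3, multilin_eq_self hs hH.isMultilinear_jac] at h2
    have h4 : R.D (multilin s (σ ∘ₗ jac H) a) = jac H a := h2
    rw [hG, LinearMap.neg_apply, map_neg, h4, add_neg_cancel]

/-- Almost brackets can be corrected so that they satisfy the higher Jacobi identities. Any property
that is stable under corrections and under limits is preserved. -/
theorem exists_jac_eq_zero (hH : R.IsAlmost H)
    (hs : ∀ i x, (LinearMap.id (R := K)).liftBaseChange O (s i x) = x) :
    ∃ (σ : (⨁ i, E i) →ₗ[K] ⨁ i, E i) (G : GSym K E →ₗ[K] ⨁ i, E i), R.IsAlmost G ∧ jac G = 0 ∧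
      (∀ n : ℕ, R.IsAlmost ((Resolution.improve s σ)^[n] H)) ∧
      ∀ d, ∃ n : ℕ, ∀ a ∈ degreePart K E d, G a = (Resolution.improve s σ)^[n] H a := by
  obtain ⟨σ, hσ1, hσ2, hσ3⟩ := R.exists_contraction K
  let X : ℕ → GSym K E →ₗ[K] ⨁ i, E i := fun n => (Resolution.improve s σ)^[n] H
  have hX : ∀ n, X (n + 1) = Resolution.improve s σ (X n) := fun n =>
    Function.iterate_succ_apply' _ _ _
  have hA : ∀ n, R.IsAlmost (X n) := fun n => by
    induction n with
    | zero => exact hH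
    | succ n ih => rw [hX]; exact ih.improve hs hσ1 hσ2
  -- After `n` corrections the Jacobiator vanishes in degrees above `-n`; for `n = 0` these degrees
  -- are empty.
  have hJ : ∀ n : ℕ, ∀ e, -(n : ℤ) < e → ∀ b ∈ degreePart K E e, jac (X n) b = 0 := fun n => by
    induction n with
    | zero =>
      intro e he b hb
      rw [eq_zero_of_mem_degreePart (by simpa using he) hb, map_zero]
    | succ n ih =>
      intro e he b hb
      rw [hX]
      exact (hA n).jac_improve hs hσ1 hσ3 ih (by push_cast at he; omega) hb
  obtain ⟨G, hG⟩ := exists_limit (H := X) fun n d hd a ha => by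
    rw [hX]; exact improve_eq (hJ n d hd) ha
  have hN : ∀ d : ℤ, -(((-d).toNat + 1 : ℕ) : ℤ) < d := fun d => by push_cast; omega
  have hGdeg : HasDeg 1 G := fun d a ha => by
    rw [hG _ d (hN d) a ha]; exact (hA _).hasDeg d a ha
  refine ⟨σ, G, ⟨hGdeg, ?_, ?_, ?_, ?_⟩, ?_, hA, fun d => ⟨_, hG _ d (hN d)⟩⟩
  · rw [hG _ 0 (hN 0) 1 SetLike.GradedOne.one_mem, (hA _).one]
  · intro y
    induction y using DirectSum.induction_on with
    | zero => simp
    | add x y hx hy => simp only [map_add, hx, hy]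
    | of i x => exact (hG _ _ (hN _) _ (gen_mem K E i x)).trans ((hA _).unary _)
  · intro i x f a
    induction a using homogeneous_induction with
    | zero => simp
    | mem d a ha =>
      rw [hG _ _ (hN (deg i + d)) _ (gen_mul_mem ha i _),
        hG _ _ (hN (deg i + d)) _ (gen_mul_mem ha i _)]
      exact (hA _).leibniz i x f a
    | add a b ha hb =>
      rw [mul_add, map_add, ha, hb, mul_add, map_add, map_add, DirectSum.add_apply, map_add,
        Derivation.add_apply, add_smul, smul_add, smul_add]
      abel
  · intro a
    induction a using homogeneous_induction with
    | zero => simp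
    | mem d a ha => rw [hG _ _ (hN d) _ ha]; exact (hA _).aug a
    | add a b ha hb => simp only [map_add, ha, hb]
  · refine linearMap_ext fun d a ha => ?_
    -- The co-derivation in degree `d` uses coefficients in degrees `≥ d` only, and there `G` agrees
    -- with one fixed iterate.
    have h1 : coderivation G a = coderivation (X ((-d).toNat + 1)) a :=
      coderivation_eq_of_eq hGdeg (hA _).hasDeg ha fun e he b hb =>
        hG _ e (lt_of_lt_of_le (hN d) he) b hb
    rw [LinearMap.comp_apply, h1, hG _ (d + 1) (lt_trans (hN d) (by omega)) _
      (coderivation_mem (hA _).hasDeg ha)]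
    exact hJ _ d (hN d) a ha

end IsAlmost

end Approx

end Resolution
end LieInfty

namespace LieInfty

open GSym

/-! ### Consequences of the axioms of a Lie ∞-algebroid. -/

namespace LieInftyAlgebroid

variable {K : Type k} [Field K] {O : Type u} [CommRing O] [Algebra K O]
  {E : ℕ → Type w} [∀ i, AddCommGroup (E i)] [∀ i, Module O (E i)] [∀ i, Module K (E i)]
  [∀ i, IsScalarTower K O (E i)] (L : LieInftyAlgebroid K O E)

/-- On a monomial the Leibniz term can be nonzero only if exactly one further argument is present;
otherwise `pr` vanishes and `bracket_smul` applies. -/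
theorem isLeibniz_bracket : IsLeibniz L.anchor LinearMap.id L.bracket := by
  intro i x f a
  have hlof : DirectSum.lof K ℕ E i (f • x) = f • DirectSum.lof K ℕ E i x :=
    (DirectSum.lof O ℕ E i).map_smul f x
  have hgen : gen K E i (f • x) = ι K E (f • DirectSum.lof K ℕ E i x) := by
    rw [← hlof, ι_lof]
  rw [LinearMap.id_apply]
  induction a using mono_induction with
  | mono l =>
    rw [hgen, ← ι_lof, ← mono_cons, ← mono_cons]
    by_cases hl : l.length = 1
    · obtain ⟨y, rfl⟩ := List.length_eq_one_iff.1 hl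
      have h1 : ∀ y z : ⨁ i, E i, mono K [y, z] = ι K E y * ι K E z := fun y z => by
        rw [mono_cons, mono_cons, mono_nil, mul_one]
      have h2 : mono K [y] = ι K E y := by rw [mono_cons, mono_nil, mul_one]
      rw [h1, h1, h2, pr_ι, ← hlof, ι_lof, ι_lof]
      clear h2 hl
      induction y using DirectSum.induction_on with
      | zero => simp
      | add y z hy hz =>
        rw [map_add, mul_add, map_add, hy, hz, mul_add, map_add, DirectSum.add_apply, map_add,
          Derivation.add_apply, add_smul, smul_add, smul_add]
        abel
      | of j y =>
        have h3 := L.leibniz (DirectSum.lof K ℕ E j y) (DirectSum.lof K ℕ E i x) f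
        rw [h1, h1, ← hlof, ι_lof, ι_lof, ι_lof] at h3
        change L.bracket (gen K E i (f • x) * gen K E j y)
          = f • L.bracket (gen K E i x * gen K E j y)
          + sgn K (deg i) • L.anchor (DirectSum.lof K ℕ E j y 0) f • _
        rw [gen_mul_gen, gen_mul_gen i j x, map_smul L.bracket, map_smul L.bracket, h3,
          neg_one_pow_eq_sgn, smul_add, smul_comm f, add_comm]
        congr 1
        -- Exchanging the arguments gives the sign `(-1)^{|x||y|}` where `(-1)^{|x|}` is expected.
        -- These agree for `|y| = -1`; otherwise the anchor term is zero.
        by_cases hj : deg j = -1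
        · rw [hj, mul_neg_one, sgn_neg]
        · have h4 : DirectSum.lof K ℕ E j y 0 = 0 := by
            by_contra h
            exact hj (isHomog_lof j y 0 h).symm
          rw [h4, map_zero, Derivation.zero_apply, zero_smul, smul_zero, smul_zero]
    · rw [pr_mono_of_length_ne_one hl, DirectSum.zero_apply, map_zero, Derivation.zero_apply,
        zero_smul, smul_zero, add_zero]
      exact L.bracket_smul [] l f _ (by simp; omega)
  | add a b ha hb =>
    rw [mul_add, map_add, ha, hb, mul_add, map_add, map_add, DirectSum.add_apply, map_add,
      Derivation.add_apply, add_smul, smul_add, smul_add]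
    abel
  | smul c a ha =>
    rw [mul_smul_comm, map_smul L.bracket, ha, mul_smul_comm, map_smul L.bracket, map_smul (pr K E),
      DirectSum.smul_apply, ← algebraMap_smul O c (pr K E a 0), map_smul, Derivation.smul_apply,
      smul_add, smul_comm f c]
    congr 1
    rw [smul_assoc, smul_comm c, algebraMap_smul]

theorem bracket_gen (i : ℕ) (x : E (i + 1)) :
    L.bracket (gen K E (i + 1) x) = DirectSum.lof K ℕ E i (L.d i x) := by
  have h : IsHomog (deg i) (L.bracket (gen K E (i + 1) x)) := by
    have := L.bracket_degree _ _ (gen_mem K E (i + 1) x)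
    rwa [show deg (i + 1) + 1 = deg i by simp only [deg]; push_cast; ring] at this
  have h' : L.d i x = L.bracket (gen K E (i + 1) x) i := by
    change L.bracket (mono K [DirectSum.lof K ℕ E (i + 1) x]) i = _
    rw [mono_cons, mono_nil, mul_one, ι_lof]
  rw [h']
  rcases h.eq_lof (K := K) with h0 | ⟨j, hj, h0⟩
  · rw [h0, DirectSum.zero_apply, map_zero]
  · rwa [deg_injective hj] at h0

theorem bracket_gen_zero (x : E 0) : L.bracket (gen K E 0 x) = 0 := by
  have h := L.bracket_degree _ _ (gen_mem K E 0 x)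
  ext i
  by_contra hi
  have := h i hi
  simp only [deg] at this
  omega

/-- This is the higher Jacobi identity evaluated on one generator. -/
theorem d_d (i : ℕ) (x : E (i + 2)) : L.d i (L.d (i + 1) x) = 0 := by
  have h := LinearMap.congr_fun L.jacobi (gen K E (i + 2) x)
  have h1 : HasDeg 1 L.bracket := L.bracket_degree
  have h2 : coderivation L.bracket (gen K E (i + 2) x) = gen K E (i + 1) (L.d (i + 1) x) := by
    have := coderivation_gen_mul h1 (i + 2) x 1
    rw [mul_one, coderivation_one, coderivation_one, L.bracket_one, map_zero, mul_zero, smul_zero,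
      add_zero, LinearMap.comp_apply, LinearMap.mulLeft_apply, mul_one] at this
    rw [this, L.bracket_gen, ι_lof]
  rw [LinearMap.comp_apply, h2, L.bracket_gen] at h
  have := congrArg (fun y => y i) h
  simpa [DirectSum.lof_apply] using this

end LieInftyAlgebroid

namespace Resolution

variable {K : Type k} [Field K] [CharZero K] {O : Type u} [CommRing O] [Algebra K O]
  {A : Type v} [LieRing A] [Module O A] [LieRingModule A O] [LieRinehartRing O A]
  [LieAlgebra K A] [LieRinehartAlgebra K O A]
  {E : ℕ → Type w} [∀ i, AddCommGroup (E i)] [∀ i, Module O (E i)] [∀ i, Module K (E i)]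
  [∀ i, IsScalarTower K O (E i)] {R : Resolution O A E}

/-! ### From almost brackets without Jacobiator to a Lie ∞-algebroid. -/

section Algebroid

/-- After moving the argument to the front, the other arguments form a monomial of length different
from one, which `pr` kills. -/
theorem isLeibniz_mul_ι {ρ : E 0 →ₗ[O] Derivation K O O} {H : GSym K E →ₗ[K] ⨁ i, E i}
    (hH : IsLeibniz ρ LinearMap.id H) {l m : List (⨁ i, E i)} (hlm : l.length + m.length ≠ 1)
    (f : O) (x : ⨁ i, E i) :
    H (mono K l * (ι K E (f • x) * mono K m)) = f • H (mono K l * (ι K E x * mono K m)) := by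
  induction x using DirectSum.induction_on with
  | zero => simp
  | add x y hx hy =>
    rw [smul_add, map_add, add_mul, mul_add, map_add, hx, hy, map_add, add_mul, mul_add, map_add,
      smul_add]
  | of i x =>
    obtain ⟨l', hl', h⟩ := exists_signAut_mono (K := K) (deg i) l
    have h1 : f • DirectSum.of E i x = DirectSum.lof K ℕ E i (f • x) :=
      ((DirectSum.lof O ℕ E i).map_smul f x).symm
    rw [h1, ← DirectSum.lof_eq_of K, ι_lof, ι_lof, ← mul_assoc, ← mul_assoc, mul_gen, mul_gen, h,
      mul_assoc, mul_assoc, ← mono_append, hH, pr_mono_of_length_ne_one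
      (by rwa [List.length_append, hl']), DirectSum.zero_apply, map_zero]
    simp

theorem leibniz_right {ρ : E 0 →ₗ[O] Derivation K O O} {H : GSym K E →ₗ[K] ⨁ i, E i}
    (hH : IsLeibniz ρ LinearMap.id H) (x y : ⨁ i, E i) (f : O) :
    H (ι K E x * ι K E (f • y)) = ρ (x 0) f • y + f • H (ι K E x * ι K E y) := by
  induction y using DirectSum.induction_on with
  | zero => simp
  | add y z hy hz =>
    rw [smul_add, map_add, mul_add, map_add, hy, hz, map_add, mul_add, map_add, smul_add, smul_add]
    abel
  | of i y =>
    induction x using DirectSum.induction_on with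
    | zero => simp
    | add x z hx hz =>
      rw [map_add, add_mul, map_add, hx, hz, add_mul, map_add, DirectSum.add_apply, map_add,
        Derivation.add_apply, add_smul, smul_add]
      abel
    | of j x =>
      have h1 : f • DirectSum.of E i y = DirectSum.lof K ℕ E i (f • y) :=
        ((DirectSum.lof O ℕ E i).map_smul f y).symm
      rw [h1, ← DirectSum.lof_eq_of K, ← DirectSum.lof_eq_of K, ι_lof, ι_lof, ι_lof, gen_mul_gen,
        gen_mul_gen j i x, map_smul H, map_smul H, hH, pr_gen, neg_one_pow_eq_sgn, smul_add,
        smul_comm f, add_comm, LinearMap.id_apply]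
      congr 1
      by_cases hj : deg j = -1
      · rw [hj, neg_one_mul, sgn_neg, smul_smul, sgn_mul_self, one_smul]
      · rw [apply_zero_lof j x hj, map_zero, Derivation.zero_apply, zero_smul, smul_zero, smul_zero]

theorem mono_singleton (x : ⨁ i, E i) : mono K [x] = ι K E x := by
  rw [mono_cons, mono_nil, mul_one]

theorem mono_pair (x y : ⨁ i, E i) : mono K [x, y] = ι K E x * ι K E y := by
  rw [mono_cons, mono_singleton]

/-- The Lie ∞-algebroid on a resolution of a Lie-Rinehart algebra that is given by its brackets. -/
def toLieInftyAlgebroid (R : Resolution O A E) (hE : ∀ i, Module.Projective O (E i))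
    {H : GSym K E →ₗ[K] ⨁ i, E i} (hH : R.IsAlmost H) (hJ : jac H = 0) :
    LieInftyAlgebroid K O E where
  projective := hE
  bracket := H
  bracket_one := hH.one
  bracket_degree := hH.hasDeg
  anchor := R.anchor K
  jacobi := hJ
  bracket_smul l m f x hlm := by
    rw [mono_append, mono_append, mono_cons, mono_cons]
    exact isLeibniz_mul_ι hH.leibniz (by omega) f x
  leibniz x y f := by
    rw [mono_pair, mono_pair]
    exact leibniz_right hH.leibniz x y f
  anchor_bracket_unary x := by
    ext f
    rw [mono_singleton, anchor_eq_aug, hH.aug, lie_ι, zero_lie, Derivation.zero_apply]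
  anchor_bracket_binary x y := by
    ext f
    rw [mono_pair, anchor_eq_aug, hH.aug, lie_ι_mul, pr_ι, Derivation.commutator_apply, lie_lie]
    simp only [anchor_apply, aug_apply, DirectSum.lof_apply]

variable {hE : ∀ i, Module.Projective O (E i)} {H : GSym K E →ₗ[K] ⨁ i, E i}
  {hH : R.IsAlmost H} {hJ : jac H = 0}

theorem toLieInftyAlgebroid_d (i : ℕ) : (R.toLieInftyAlgebroid hE hH hJ).d i = R.d i := by
  ext x
  change H (mono K [DirectSum.lof K ℕ E (i + 1) x]) i = _
  rw [mono_singleton, hH.unary, D_apply, DirectSum.lof_apply]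

theorem toLieInftyAlgebroid_acyclic : (R.toLieInftyAlgebroid hE hH hJ).Acyclic := fun i => by
  rw [toLieInftyAlgebroid_d, toLieInftyAlgebroid_d]; exact R.exact_succ i

theorem toLieInftyAlgebroid_covers : (R.toLieInftyAlgebroid hE hH hJ).Covers R.hook where
  map_bracket x y := by
    change R.aug (H (mono K _)) = _
    rw [mono_pair, hH.aug, lie_ι_mul, pr_ι, aug_apply, aug_apply, DirectSum.lof_apply,
      DirectSum.lof_apply]
  anchor_comp _ := rfl
  comp_d x := by rw [toLieInftyAlgebroid_d]; exact R.exact_zero.apply_apply_eq_zero x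
  surjective := R.surjective

end Algebroid

/-! ### A connection and a first bracket with the Leibniz property. -/

section Start

variable {s : ∀ i, E i →ₗ[O] O ⊗[K] E i}

/-- The action of a derivation on the left factor, followed by multiplication. -/
def derivT (δ : Derivation K O O) (i : ℕ) : O ⊗[K] E i →ₗ[K] E i :=
  TensorProduct.lift ((Algebra.lsmul K K (E i)).toLinearMap ∘ₗ (δ : O →ₗ[K] O))

theorem derivT_tmul (δ : Derivation K O O) (i : ℕ) (c : O) (x : E i) :
    derivT δ i (c ⊗ₜ[K] x) = δ c • x := rfl

theorem derivT_smul (δ : Derivation K O O) (i : ℕ) (f : O) (p : O ⊗[K] E i) :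
    derivT δ i (f • p) = f • derivT δ i p + δ f • (LinearMap.id (R := K)).liftBaseChange O p := by
  induction p using TensorProduct.induction_on with
  | zero => simp
  | add p q hp hq => rw [smul_add, map_add, hp, hq, map_add, map_add, smul_add, smul_add]; abel
  | tmul c x =>
    rw [TensorProduct.smul_tmul', derivT_tmul, derivT_tmul, LinearMap.liftBaseChange_tmul,
      smul_eq_mul, Derivation.leibniz, add_smul, smul_eq_mul, smul_eq_mul, mul_smul, mul_smul,
      LinearMap.id_apply, smul_comm c]

variable (s) in
/-- A connection. -/
def nabla (δ : Derivation K O O) : (⨁ i, E i) →ₗ[K] ⨁ i, E i :=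
  DirectSum.lmap fun i => derivT δ i ∘ₗ (s i).restrictScalars K

theorem nabla_apply (δ : Derivation K O O) (y : ⨁ i, E i) (i : ℕ) :
    nabla s δ y i = derivT δ i (s i (y i)) := by
  rw [nabla, DirectSum.lmap_apply]; rfl

/-- The derivation acts on the coefficients in `O ⊗ E i`; the extra term `δ f` multiplies the image
of the splitting, which is the original element. -/
theorem nabla_smul (hs : ∀ i x, (LinearMap.id (R := K)).liftBaseChange O (s i x) = x)
    (δ : Derivation K O O) (f : O) (y : ⨁ i, E i) :
    nabla s δ (f • y) = f • nabla s δ y + δ f • y := by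
  ext i
  rw [nabla_apply, DirectSum.smul_apply, map_smul, derivT_smul, hs, DirectSum.add_apply,
    DirectSum.smul_apply, DirectSum.smul_apply, nabla_apply]

theorem nabla_isHomog (δ : Derivation K O O) {n : ℤ} {y : ⨁ i, E i} (hy : IsHomog n y) :
    IsHomog n (nabla s δ y) := fun i hi => hy i fun h => hi (by
  rw [nabla_apply, h, map_zero, map_zero])

theorem nabla_add (δ δ' : Derivation K O O) (y : ⨁ i, E i) :
    nabla s (δ + δ') y = nabla s δ y + nabla s δ' y := by
  ext i
  rw [nabla_apply, DirectSum.add_apply, nabla_apply, nabla_apply]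
  induction s i (y i) using TensorProduct.induction_on with
  | zero => simp
  | add p q hp hq => rw [map_add, hp, hq, map_add, map_add]; abel
  | tmul c x => rw [derivT_tmul, Derivation.add_apply, add_smul]; rfl

theorem nabla_smul_left (f : O) (δ : Derivation K O O) (y : ⨁ i, E i) :
    nabla s (f • δ) y = f • nabla s δ y := by
  ext i
  rw [nabla_apply, DirectSum.smul_apply, nabla_apply]
  induction s i (y i) using TensorProduct.induction_on with
  | zero => simp
  | add p q hp hq => rw [map_add, hp, hq, map_add, smul_add]
  | tmul c x => rw [derivT_tmul, Derivation.smul_apply, smul_assoc]; rfl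

variable (R s) in
/-- The connection along the anchor map. -/
def connection : E 0 →ₗ[K] (⨁ i, E i) →ₗ[K] ⨁ i, E i :=
  LinearMap.mk₂ K (fun y z => nabla s (R.anchor K y) z)
    (fun x y z => by rw [map_add, nabla_add])
    (fun c y z => by
      rw [← algebraMap_smul O c y, map_smul, nabla_smul_left, algebraMap_smul])
    (fun x y z => map_add _ _ _) (fun c y z => map_smul _ _ _)

variable (R s) in
/-- A binary bracket that satisfies the Leibniz identity. -/
def skewConnection : GSym K E →ₗ[K] ⨁ i, E i :=
  conv (connection R s) (DirectSum.component K ℕ E 0 ∘ₗ pr K E) (LinearMap.id ∘ₗ pr K E)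

theorem skewConnection_gen_mul (i : ℕ) (x : E i) (a : GSym K E) :
    skewConnection R s (gen K E i x * a)
      = nabla s (R.anchor K (DirectSum.lof K ℕ E i x 0)) (pr K E a)
        + sgn K (deg i) • nabla s (R.anchor K (pr K E a 0)) (DirectSum.lof K ℕ E i x) := by
  rw [skewConnection,
    conv_pr_pr_gen_mul _ _ _ (fun i x hi => apply_zero_lof (K := K) i x hi), mul_neg_one, sgn_neg]
  rfl

theorem skewConnection_one : skewConnection R s 1 = 0 := by
  rw [skewConnection, conv_one, LinearMap.comp_apply, pr_one]; simp

theorem skewConnection_ι (y : ⨁ i, E i) : skewConnection R s (ι K E y) = 0 := by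
  induction y using DirectSum.induction_on with
  | zero => simp
  | add x y hx hy => rw [map_add, map_add, hx, hy, add_zero]
  | of i x =>
    have := skewConnection_gen_mul (R := R) (s := s) i x 1
    rw [mul_one, pr_one, map_zero, DirectSum.zero_apply, map_zero] at this
    refine this.trans ?_
    have h := nabla_smul_left (s := s) (0 : O) (0 : Derivation K O O) (DirectSum.lof K ℕ E i x)
    rw [zero_smul, zero_smul] at h
    rw [h, smul_zero, add_zero]

/-- In `∇_{ρ(x)} a ± ∇_{ρ(a)} x` the first term is `O`-linear in `x` and the second is a derivation
along the anchor of `a`. -/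
theorem isLeibniz_skewConnection
    (hs : ∀ i x, (LinearMap.id (R := K)).liftBaseChange O (s i x) = x) :
    IsLeibniz (R.anchor K) LinearMap.id (skewConnection R s) := by
  intro i x f a
  have hlof : DirectSum.lof K ℕ E i (f • x) = f • DirectSum.lof K ℕ E i x :=
    (DirectSum.lof O ℕ E i).map_smul f x
  rw [skewConnection_gen_mul, skewConnection_gen_mul, hlof, DirectSum.smul_apply, map_smul,
    nabla_smul_left, nabla_smul hs, smul_add, smul_add, smul_comm f (sgn K (deg i)), add_assoc]
  rfl

theorem hasDeg_skewConnection : HasDeg 1 (skewConnection R s) := fun d a ha => by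
  refine degreePart_induction (P := fun d a => IsHomog (d + 1) (skewConnection R s a))
    ?_ ?_ ?_ ?_ ?_ ha
  · intro d; rw [map_zero]; exact IsHomog.zero _
  · rw [skewConnection_one]; exact IsHomog.zero _
  · intro d i x a ha _
    have hz : ∀ y, nabla s (0 : Derivation K O O) y = 0 := fun y => by
      have h := nabla_smul_left (s := s) (0 : O) (0 : Derivation K O O) y
      rwa [zero_smul, zero_smul] at h
    have hpr := hasDeg_pr d a ha
    rw [add_zero] at hpr
    rw [skewConnection_gen_mul]
    refine IsHomog.add ?_ (IsHomog.smul ?_ _)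
    · by_cases hi : deg i = -1
      · rw [hi, show -1 + d + 1 = d by ring]; exact nabla_isHomog _ hpr
      · rw [apply_zero_lof i x hi, map_zero, hz]; exact IsHomog.zero _
    · by_cases h0 : pr K E a 0 = 0
      · rw [h0, map_zero, hz]; exact IsHomog.zero _
      · have := hpr 0 h0
        rw [show deg i + d + 1 = deg i by rw [← this]; simp [deg]]
        exact nabla_isHomog _ (isHomog_lof i x)
  · intro d a b ha hb; rw [map_add]; exact ha.add hb
  · intro d c a ha; rw [map_smul]; exact ha.smul c

end Start

end Resolution
end LieInfty

namespace LieInfty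

open GSym

namespace GSym

variable {K : Type k} [Field K] {E : ℕ → Type w} [∀ i, AddCommGroup (E i)] [∀ i, Module K (E i)]
  {E' : ℕ → Type w'} [∀ i, AddCommGroup (E' i)] [∀ i, Module K (E' i)]

theorem HasDeg.sub {h : ℤ} {H G : GSym K E →ₗ[K] ⨁ i, E i} (hH : HasDeg h H) (hG : HasDeg h G) :
    HasDeg h (H - G) := by
  have : H - G = H + (-1 : K) • G := LinearMap.ext fun a => by
    rw [LinearMap.sub_apply, LinearMap.add_apply, LinearMap.smul_apply, neg_smul, one_smul,
      sub_eq_add_neg]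
  rw [this]
  exact hH.add (hG.smul _)

theorem IsHomog.lmap (f : ∀ i, E' i →ₗ[K] E i) {n : ℤ} {y : ⨁ i, E' i} (hy : IsHomog n y) :
    IsHomog n (DirectSum.lmap f y) := fun i hi => hy i fun h => hi (by
  rw [DirectSum.lmap_apply, h, map_zero])

theorem sum_deg_nonpos (l : List (Σ i, E i)) : (l.map fun p => deg p.1).sum ≤ 0 := by
  induction l with
  | nil => simp
  | cons p l ih =>
    rw [List.map_cons, List.sum_cons]
    have : deg p.1 < 0 := by simp only [deg]; omega
    omega

end GSym

/-! ### Extending the brackets of `E'` to a resolution that contains it. -/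

section Extension

variable {K : Type k} [Field K] [CharZero K] {O : Type u} [CommRing O] [Algebra K O]
  {A : Type v} [LieRing A] [Module O A] [LieRingModule A O] [LieRinehartRing O A]
  [LieAlgebra K A] [LieRinehartAlgebra K O A]
  {E : ℕ → Type w} [∀ i, AddCommGroup (E i)] [∀ i, Module O (E i)] [∀ i, Module K (E i)]
  [∀ i, IsScalarTower K O (E i)] {R : Resolution O A E}
  {E' : ℕ → Type w'} [∀ i, AddCommGroup (E' i)] [∀ i, Module O (E' i)]
  [∀ i, Module K (E' i)] [∀ i, IsScalarTower K O (E' i)]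
  {L' : LieInftyAlgebroid K O E'} {π' : E' 0 →ₗ[O] A} {inc : ∀ i, E' i →ₗ[O] E i}

variable (K) in
/-- A family of `O`-linear maps, regarded as a family of `K`-linear maps. -/
abbrev resK (f : ∀ i, E' i →ₗ[O] E i) (i : ℕ) : E' i →ₗ[K] E i := (f i).restrictScalars K

namespace LieInftyAlgebroid

/-- The strict morphism of Lie ∞-algebroids that is given by an `O`-linear map which is compatible
with all brackets and with the anchors. -/
def strictHom {L : LieInftyAlgebroid K O E} (inc : ∀ i, E' i →ₗ[O] E i)
    (hb : ∀ a, L.bracket (map (resK K inc) a) = DirectSum.lmap (resK K inc) (L'.bracket a))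
    (ha : ∀ x, L.anchor (inc 0 x) = L'.anchor x) : L'.Hom L where
  toCoalgHom := mapCoalgHom (resK K inc)
  map_one := _root_.map_one (map (resK K inc))
  map_degree d a h := map_mem _ h
  comp_Q := LinearMap.ext fun a =>
    (coderivation_map (resK K inc) L'.bracket_degree L.bracket_degree hb a).symm
  taylor_smul l m f x := by
    change pr K E (map _ _) = f • pr K E (map _ _)
    rw [pr_map, pr_map]
    by_cases h : (l ++ x :: m).length = 1
    · obtain ⟨rfl, rfl⟩ : l = [] ∧ m = [] := by
        simp only [List.length_append, List.length_cons] at h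
        exact ⟨List.length_eq_zero_iff.1 (by omega), List.length_eq_zero_iff.1 (by omega)⟩
      rw [List.nil_append, List.nil_append, mono_cons, mono_cons, mono_nil, mul_one, mul_one, pr_ι,
        pr_ι]
      exact (DirectSum.lmap inc).map_smul f x
    · rw [pr_mono_of_length_ne_one h, pr_mono_of_length_ne_one (by simpa using h), map_zero,
        smul_zero]
  anchor_comp x := by
    change L.anchor (pr K E (map _ _) 0) = _
    rw [mono_cons, mono_nil, mul_one, ι_lof, map_gen, pr_gen, DirectSum.lof_apply]
    exact ha x

variable {L : LieInftyAlgebroid K O E}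
  {hb : ∀ a, L.bracket (map (resK K inc) a) = DirectSum.lmap (resK K inc) (L'.bracket a)}
  {ha : ∀ x, L.anchor (inc 0 x) = L'.anchor x}

theorem strictHom_coeff (l : List (⨁ i, E' i)) :
    (strictHom inc hb ha).coeff l = DirectSum.lmap (resK K inc) (pr K E' (mono K l)) :=
  pr_map _ _

theorem strictHom_coeff_singleton (i : ℕ) (x : E' i) :
    (strictHom inc hb ha).coeff [DirectSum.lof K ℕ E' i x] = DirectSum.lof K ℕ E i (inc i x) := by
  rw [strictHom_coeff, mono_cons, mono_nil, mul_one, pr_ι, DirectSum.lmap_lof]; rfl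

theorem strictHom_coeff_eq_zero {l : List (⨁ i, E' i)} (hl : 2 ≤ l.length) :
    (strictHom inc hb ha).coeff l = 0 := by
  rw [strictHom_coeff, pr_mono_of_length_ne_one (by omega), map_zero]

end LieInftyAlgebroid

namespace Resolution

theorem anchor_inc (hπ' : L'.TerminatesIn π') (hπ : ∀ x, R.hook (inc 0 x) = π' x) (x : E' 0) :
    R.anchor K (inc 0 x) = L'.anchor x := by
  rw [← hπ'.anchor_comp, ← hπ]; rfl

/-- By degree, only the part of degree `-2` matters. Its monomials are an element of `E' 1`, handled
by `comp_d`, or a product of two elements of `E' 0`, handled by `map_bracket`. -/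
theorem hook_bracket (hπ' : L'.TerminatesIn π') (hπ : ∀ x, R.hook (inc 0 x) = π' x)
    (b : GSym K E') : π' (L'.bracket b 0) = R.lie K (map (resK K inc) b) := by
  induction b using homogeneous_induction with
  | zero => simp
  | add a b ha hb => rw [map_add, DirectSum.add_apply, map_add, ha, hb, map_add, map_add]
  | mem d b hb =>
    by_cases hd : d = -2
    · subst hd
      induction hb using Submodule.span_induction with
      | zero => simp
      | add a b _ _ ha hb => rw [map_add, DirectSum.add_apply, map_add, ha, hb, map_add, map_add]
      | smul c a _ ha =>
        rw [map_smul L'.bracket, DirectSum.smul_apply, map_smul (map (resK K inc)),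
          map_smul (R.lie K), ← ha, ← algebraMap_smul O c (L'.bracket a 0), map_smul,
          algebraMap_smul]
      | mem b h =>
        obtain ⟨l, hl, rfl⟩ := h
        rcases l with _ | ⟨⟨i, x⟩, _ | ⟨⟨j, y⟩, l⟩⟩
        · simp at hl
        · obtain rfl : i = 1 := by simp [deg] at hl; omega
          have h : mono K [DirectSum.lof K ℕ E' 1 x] = gen K E' 1 x := by
            rw [mono_cons, mono_nil, mul_one, ι_lof]
          simp only [List.map_cons, List.map_nil, List.prod_cons, List.prod_nil, mul_one]
          have h2 := R.lie_ι (K := K) (DirectSum.lof K ℕ E 1 (resK K inc 1 x))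
          rw [ι_lof] at h2
          rw [map_gen, h2, ← hπ'.comp_d x, ← h]
          rfl
        · have hs := sum_deg_nonpos l
          obtain rfl : l = [] := by
            cases l with
            | nil => rfl
            | cons p l =>
              have hs := sum_deg_nonpos l
              simp only [List.map_cons, List.sum_cons, deg] at hl hs
              omega
          obtain ⟨rfl, rfl⟩ : i = 0 ∧ j = 0 := by
            simp only [List.map_cons, List.map_nil, List.sum_cons, List.sum_nil, deg] at hl
            omega
          have h : mono K [DirectSum.lof K ℕ E' 0 x, DirectSum.lof K ℕ E' 0 y]
              = gen K E' 0 x * gen K E' 0 y := by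
            rw [mono_cons, mono_cons, mono_nil, mul_one, ι_lof, ι_lof]
          simp only [List.map_cons, List.map_nil, List.prod_cons, List.prod_nil, mul_one]
          rw [map_mul (map (resK K inc)), map_gen, map_gen, lie_gen_mul, pr_gen, aug_apply,
            aug_apply, DirectSum.lof_apply, DirectSum.lof_apply]
          change _ = ⁅R.hook (inc 0 x), R.hook (inc 0 y)⁆
          rw [hπ, hπ, ← hπ'.map_bracket, ← h]
          rfl
    · have h0 : L'.bracket b 0 = 0 := by
        by_contra h
        have := L'.bracket_degree d b hb 0 h
        simp only [deg] at this
        omega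
      rw [h0, map_zero, R.lie_eq_zero hd (map_mem _ hb)]

theorem lmap_bracket_ι (hd : ∀ i x, inc i (L'.d i x) = R.d i (inc (i + 1) x)) (y : ⨁ i, E' i) :
    DirectSum.lmap (resK K inc) (L'.bracket (ι K E' y)) = R.D (DirectSum.lmap (resK K inc) y) := by
  induction y using DirectSum.induction_on with
  | zero => simp
  | add x y hx hy => simp only [map_add, hx, hy]
  | of i x =>
    rw [← DirectSum.lof_eq_of K, ι_lof, DirectSum.lmap_lof]
    cases i with
    | zero =>
      rw [L'.bracket_gen_zero, map_zero]
      exact (DirectSum.toModule_lof (R := O) (φ := fun i => match i with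
        | 0 => 0
        | i + 1 => DirectSum.lof O ℕ E i ∘ₗ R.d i) 0 _).symm
    | succ i =>
      rw [L'.bracket_gen, DirectSum.lmap_lof]
      change DirectSum.lof K ℕ E i (inc i (L'.d i x)) = _
      rw [hd]
      exact (R.D_lof_succ i _).symm

/-- A map `H₀` with all required properties except Leibniz is easy over `K`, and a Leibniz map `B`
comes from a connection. The combination `B + multilin (H₀ - B)` is Leibniz and keeps every property
of `H₀` in which the deviation from `B` is already multilinear. -/
theorem exists_isAlmost (hπ' : L'.TerminatesIn π') (hπ : ∀ x, R.hook (inc 0 x) = π' x)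
    (hd : ∀ i x, inc i (L'.d i x) = R.d i (inc (i + 1) x))
    {ret : ∀ i, E i →ₗ[O] E' i} (hret : ∀ i x, ret i (inc i x) = x)
    {s : ∀ i, E i →ₗ[O] O ⊗[K] E i}
    (hs : ∀ i x, (LinearMap.id (R := K)).liftBaseChange O (s i x) = x)
    {s' : ∀ i, E' i →ₗ[O] O ⊗[K] E' i}
    (hs' : ∀ i x, (LinearMap.id (R := K)).liftBaseChange O (s' i x) = x)
    (hss : ∀ i x, s i (inc i x) = (resK K inc i).lTensor O (s' i x)) :
    ∃ H : GSym K E →ₗ[K] ⨁ i, E i, R.IsAlmost H ∧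
      ∀ b, H (map (resK K inc) b) = DirectSum.lmap (resK K inc) (L'.bracket b) := by
  obtain ⟨σ, hσ⟩ := LinearMap.exists_rightInverse_of_surjective (R.hook.restrictScalars K)
    (LinearMap.range_eq_top.2 R.surjective)
  have hσ' : ∀ z, R.hook (σ z) = z := fun z => LinearMap.congr_fun hσ z
  let B : GSym K E →ₗ[K] ⨁ i, E i := skewConnection R s
  have hB : IsLeibniz (R.anchor K) LinearMap.id B := isLeibniz_skewConnection hs
  -- The differential together with a `K`-linear lift of the bracket of `A` through the hook.
  let H₁ : GSym K E →ₗ[K] ⨁ i, E i :=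
    R.D.restrictScalars K ∘ₗ pr K E + DirectSum.lof K ℕ E 0 ∘ₗ σ ∘ₗ R.lie K
  have hH₁ : ∀ a, H₁ a = R.D (pr K E a) + DirectSum.lof K ℕ E 0 (σ (R.lie K a)) := fun _ => rfl
  have hH₁deg : HasDeg 1 H₁ := by
    refine HasDeg.add (fun d a ha => ?_) fun d a ha => ?_
    · have := R.D_isHomog (hasDeg_pr d a ha)
      rwa [add_zero] at this
    · change IsHomog _ (DirectSum.lof K ℕ E 0 (σ (R.lie K a)))
      by_cases hd : d = -2
      · subst hd; exact isHomog_lof 0 _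
      · rw [R.lie_eq_zero hd ha, map_zero, map_zero]; exact IsHomog.zero _
  have hH₁aug : ∀ a, R.aug (H₁ a) = R.lie K a := fun a => by
    rw [hH₁, map_add, aug_D, zero_add, aug_apply, DirectSum.lof_apply, hσ']
  have hH₁ι : ∀ y, H₁ (ι K E y) = R.D y := fun y => by
    rw [hH₁, pr_ι, R.lie_ι, map_zero, map_zero, add_zero]
  -- On the image of `E'` the bracket term extends `L'` and the bracketed difference vanishes, as
  -- `ret` inverts `inc`. Elsewhere the difference restores the correct augmentation.
  let H₀ : GSym K E →ₗ[K] ⨁ i, E i :=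
    DirectSum.lmap (resK K inc) ∘ₗ L'.bracket ∘ₗ (map (resK K ret)).toLinearMap
      + (H₁ - H₁ ∘ₗ (map (resK K inc)).toLinearMap ∘ₗ (map (resK K ret)).toLinearMap)
  have hH₀ : ∀ a, H₀ a = DirectSum.lmap (resK K inc) (L'.bracket (map (resK K ret) a))
      + (H₁ a - H₁ (map (resK K inc) (map (resK K ret) a))) := fun _ => rfl
  have hH₀deg : HasDeg 1 H₀ := HasDeg.add
    (fun d a ha => IsHomog.lmap _ (L'.bracket_degree d _ (map_mem _ ha)))
    (hH₁deg.sub fun d a ha => hH₁deg d _ (map_mem _ (map_mem _ ha)))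
  have hH₀one : H₀ 1 = 0 := by
    rw [hH₀, _root_.map_one (map (resK K ret)), _root_.map_one (map (resK K inc)),
      L'.bracket_one, sub_self, map_zero, add_zero]
  have hH₀ι : ∀ y, H₀ (ι K E y) = R.D y := fun y => by
    rw [hH₀, map_ι, map_ι, hH₁ι, hH₁ι, lmap_bracket_ι hd]; abel
  have hH₀aug : ∀ a, R.aug (H₀ a) = R.lie K a := fun a => by
    rw [hH₀, map_add, map_sub, hH₁aug, hH₁aug, ← hook_bracket hπ' hπ, aug_apply,
      DirectSum.lmap_apply]
    change R.hook (inc 0 _) + _ = _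
    rw [hπ]; abel
  have hmr : ∀ b, map (resK K ret) (map (resK K inc) b) = b := fun b => by
    have : (map (resK K ret)).comp (map (resK K inc)) = AlgHom.id K _ := algHom_ext fun i x => by
      rw [AlgHom.comp_apply, map_gen, map_gen]
      exact congrArg _ (hret i x)
    exact DFunLike.congr_fun this b
  have hH₀map : ∀ b, H₀ (map (resK K inc) b) = DirectSum.lmap (resK K inc) (L'.bracket b) :=
    fun b => by rw [hH₀, hmr, sub_self, add_zero]
  refine ⟨B + multilin s (H₀ - B), ⟨?_, ?_, fun y => ?_, ?_, fun a => ?_⟩, fun b => ?_⟩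
  · exact hasDeg_skewConnection.add (hH₀deg.sub hasDeg_skewConnection).multilin
  · rw [LinearMap.add_apply, multilin_one, LinearMap.sub_apply, hH₀one, skewConnection_one,
      sub_zero, add_zero]
  · rw [LinearMap.add_apply, skewConnection_ι, zero_add]
    exact multilin_ι hs (fun y => by
      rw [LinearMap.sub_apply, hH₀ι, skewConnection_ι, sub_zero]) y
  · exact hB.add (isMultilinear_multilin _)
  · have h1 := LinearMap.congr_fun (comp_multilin (s := s) R.aug (H₀ - B)) a
    have h2 : R.aug.restrictScalars K ∘ₗ (H₀ - B) = R.lie K - R.aug.restrictScalars K ∘ₗ B := by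
      ext b
      change R.aug (H₀ b - B b) = R.lie K b - R.aug (B b)
      rw [map_sub, hH₀aug]
    -- Both `R.lie` and the augmentation of `B` are Leibniz with the same anchor term, so `multilin`
    -- leaves their difference unchanged.
    have h3 : IsMultilinear O (R.lie K - R.aug.restrictScalars K ∘ₗ B) :=
      R.isLeibniz_lie.sub (hB.comp R.aug)
    rw [h2, multilin_eq_self hs h3] at h1
    change R.aug (B a + multilin s (H₀ - B) a) = _
    have h4 : R.aug (multilin s (H₀ - B) a) = R.lie K a - R.aug (B a) := h1
    rw [map_add, h4, add_sub_cancel]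
  · have h1 : IsLeibniz L'.anchor (DirectSum.lmap inc)
        (B ∘ₗ (map (resK K inc)).toLinearMap) := fun i x f a => by
      have h0 : DirectSum.lmap inc (DirectSum.lof K ℕ E' i x) = DirectSum.lof K ℕ E i (inc i x) :=
        DirectSum.lmap_lof inc i x
      have h2 := hB i (inc i x) f (map (resK K inc) a)
      rw [pr_map, DirectSum.lmap_apply] at h2
      change B (map _ (gen K E' i (f • x) * a)) = f • B (map _ (gen K E' i x * a)) + _
      rw [map_mul (map (resK K inc)), map_mul (map (resK K inc)), map_gen, map_gen,
        LinearMap.restrictScalars_apply, LinearMap.restrictScalars_apply, map_smul, h2,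
        ← anchor_inc hπ' hπ,
        h0]
      rfl
    -- On `E'` the map `H₀` is the bracket of `L'`, so here too two maps with the same Leibniz term
    -- are subtracted.
    have h2 : IsMultilinear O ((H₀ - B) ∘ₗ (map (resK K inc)).toLinearMap) := by
      have h3 : (H₀ - B) ∘ₗ (map (resK K inc)).toLinearMap
          = (DirectSum.lmap inc).restrictScalars K ∘ₗ L'.bracket
            - B ∘ₗ (map (resK K inc)).toLinearMap := by
        ext1 b
        change H₀ (map _ b) - B (map _ b) = _
        rw [hH₀map]; rfl
      rw [h3]
      exact (L'.isLeibniz_bracket.comp (DirectSum.lmap inc)).sub h1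
    rw [LinearMap.add_apply, multilin_map (s' := s') (resK K inc) hss, multilin_eq_self hs' h2]
    change B (map _ b) + (H₀ (map _ b) - B (map _ b)) = _
    rw [hH₀map, add_sub_cancel]

/-- A Lie ∞-algebroid that terminates in `A` extends to every resolution of `A` that contains it
as a direct summand. -/
theorem exists_extension (hπ' : L'.TerminatesIn π') (hπ : ∀ x, R.hook (inc 0 x) = π' x)
    (hd : ∀ i x, inc i (L'.d i x) = R.d i (inc (i + 1) x))
    {ret : ∀ i, E i →ₗ[O] E' i} (hret : ∀ i x, ret i (inc i x) = x)
    {s : ∀ i, E i →ₗ[O] O ⊗[K] E i}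
    (hs : ∀ i x, (LinearMap.id (R := K)).liftBaseChange O (s i x) = x)
    {s' : ∀ i, E' i →ₗ[O] O ⊗[K] E' i}
    (hs' : ∀ i x, (LinearMap.id (R := K)).liftBaseChange O (s' i x) = x)
    (hss : ∀ i x, s i (inc i x) = (resK K inc i).lTensor O (s' i x)) :
    ∃ H : GSym K E →ₗ[K] ⨁ i, E i, R.IsAlmost H ∧ jac H = 0 ∧
      ∀ b, H (map (resK K inc) b) = DirectSum.lmap (resK K inc) (L'.bracket b) := by
  obtain ⟨H, hH, hmap⟩ := exists_isAlmost hπ' hπ hd hret hs hs' hss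
  obtain ⟨σ, G, hG, hJ, hA, hGn⟩ := hH.exists_jac_eq_zero hs
  refine ⟨G, hG, hJ, fun b => ?_⟩
  -- If `X` extends the brackets of `L'`, its Jacobiator vanishes on `E'` by the identities of `L'`.
  -- By the compatibility of `s` and `s'` so does the correction.
  have key : ∀ X : GSym K E →ₗ[K] ⨁ i, E i, HasDeg 1 X →
      (∀ b, X (map (resK K inc) b) = DirectSum.lmap (resK K inc) (L'.bracket b)) →
      ∀ b, improve s σ X (map (resK K inc) b) = DirectSum.lmap (resK K inc) (L'.bracket b) := by
    intro X hX h b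
    have h1 : (σ ∘ₗ jac X) ∘ₗ (map (resK K inc)).toLinearMap = 0 := LinearMap.ext fun c => by
      have h2 : L'.bracket (coderivation L'.bracket c) = 0 := LinearMap.congr_fun L'.jacobi c
      simp only [LinearMap.comp_apply, AlgHom.toLinearMap_apply]
      rw [coderivation_map _ L'.bracket_degree hX h, h, h2, map_zero, map_zero,
        LinearMap.zero_apply]
    have h3 : multilin s' (0 : GSym K E' →ₗ[K] ⨁ i, E i) b = 0 := by
      have := multilin_sub (s := s') (0 : GSym K E' →ₗ[K] ⨁ i, E i) 0
      rw [sub_self, sub_self] at this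
      rw [this, LinearMap.zero_apply]
    rw [improve, LinearMap.add_apply, LinearMap.neg_apply,
      multilin_map (s' := s') (resK K inc) hss, h1, h3, neg_zero, add_zero, h]
  have hX : ∀ n b, (improve s σ)^[n] H (map (resK K inc) b)
      = DirectSum.lmap (resK K inc) (L'.bracket b) := fun n => by
    induction n with
    | zero => exact hmap
    | succ n ih => rw [Function.iterate_succ_apply']; exact key _ (hA n).hasDeg ih
  induction b using homogeneous_induction with
  | zero => simp
  | add a b ha hb => simp only [map_add, ha, hb]
  | mem d b hb =>
    obtain ⟨n, hn⟩ := hGn d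
    rw [hn _ (map_mem _ hb), hX]

end Resolution

end Extension

end LieInfty

namespace LieInfty

open GSym

/-! ### Splittings of the action of `O`. -/

section Splitting

variable {K : Type k} [Field K] {O : Type u} [CommRing O] [Algebra K O]
  {M : Type w} [AddCommGroup M] [Module O M] [Module K M] [IsScalarTower K O M]
  {M' : Type w'} [AddCommGroup M'] [Module O M'] [Module K M'] [IsScalarTower K O M']

variable (K O M) in
/-- The action `O ⊗ M → M` of `O` on a projective module splits. -/
theorem exists_splitting [Module.Projective O M] :
    ∃ s : M →ₗ[O] O ⊗[K] M, ∀ x, (LinearMap.id (R := K)).liftBaseChange O (s x) = x := by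
  have h : Function.Surjective ((LinearMap.id (R := K) (M := M)).liftBaseChange O) := fun x =>
    ⟨1 ⊗ₜ x, by simp⟩
  obtain ⟨s, hs⟩ := Module.projective_lifting_property _ LinearMap.id h
  exact ⟨s, LinearMap.congr_fun hs⟩

/-- A splitting of the action on a direct summand extends. -/
theorem exists_splitting_extension [Module.Projective O M] {inc : M' →ₗ[O] M} {ret : M →ₗ[O] M'}
    (hret : ∀ x, ret (inc x) = x) {s' : M' →ₗ[O] O ⊗[K] M'}
    (hs' : ∀ x, (LinearMap.id (R := K)).liftBaseChange O (s' x) = x) :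
    ∃ s : M →ₗ[O] O ⊗[K] M, (∀ x, (LinearMap.id (R := K)).liftBaseChange O (s x) = x) ∧
      ∀ x, s (inc x) = (inc.restrictScalars K).lTensor O (s' x) := by
  obtain ⟨s₀, hs₀⟩ := exists_splitting K O M
  have h1 : ∀ t, (LinearMap.id (R := K)).liftBaseChange O
      ((inc.restrictScalars K).lTensor O t) = inc ((LinearMap.id (R := K)).liftBaseChange O t) :=
    fun t => by
      induction t with
      | zero => simp
      | add x y hx hy => simp only [map_add, hx, hy]
      | tmul f x => simp
  -- The given splitting is used on the summand, and an arbitrary one on the complement, which is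
  -- the image of `id - inc ∘ ret`.
  refine ⟨(inc.restrictScalars K).baseChange O ∘ₗ s' ∘ₗ ret + s₀ ∘ₗ (LinearMap.id - inc ∘ₗ ret),
    fun x => ?_, fun x => ?_⟩
  · have h2 : (LinearMap.id (R := K)).liftBaseChange O
        ((inc.restrictScalars K).baseChange O (s' (ret x))) = inc (ret x) :=
      (h1 _).trans (by rw [hs'])
    simp only [LinearMap.add_apply, LinearMap.comp_apply, LinearMap.sub_apply, LinearMap.id_apply,
      map_add, h2, hs₀]
    abel
  · simp only [LinearMap.add_apply, LinearMap.comp_apply, LinearMap.sub_apply, LinearMap.id_apply,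
      hret, sub_self, map_zero, add_zero]
    rfl

end Splitting

/-! ### A resolution with `E'` as a direct summand. -/

namespace LieInftyAlgebroid

variable {K : Type k} [Field K] {O : Type u} [CommRing O] [Algebra K O]
  {A : Type v} [LieRing A] [Module O A] [LieRingModule A O] [LieRinehartRing O A]
  [LieAlgebra K A] [LieRinehartAlgebra K O A]
  {E' : ℕ → Type w} [∀ i, AddCommGroup (E' i)] [∀ i, Module O (E' i)]
  [∀ i, Module K (E' i)] [∀ i, IsScalarTower K O (E' i)]
  (L' : LieInftyAlgebroid K O E')

/-- One step in the construction of a resolution: a basis of the complement of `E' i`, and the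
submodule of cycles. -/
structure Stage (i : ℕ) where
  /-- A basis of the complement. -/
  S : Type (max u v w)
  /-- The cycles. -/
  Z : Submodule O (E' i × (S →₀ O))
  mem : ∀ x : E' (i + 1), (L'.d i x, 0) ∈ Z

namespace Stage

variable {L'}

/-- The differential onto the cycles of a given step. -/
def boundary {i : ℕ} (T : Stage.{k, u, v, w} L' i) :
    E' (i + 1) × (T.Z →₀ O) →ₗ[O] E' i × (T.S →₀ O) :=
  (LinearMap.inl O (E' i) (T.S →₀ O) ∘ₗ L'.d i).coprod
    (Finsupp.linearCombination O Subtype.val)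

/-- Each cycle is the image of the basis element that it indexes; in the other direction `T.mem`
ensures that `E' (i + 1)` is mapped into the cycles. -/
theorem range_boundary {i : ℕ} (T : Stage.{k, u, v, w} L' i) :
    LinearMap.range T.boundary = T.Z := by
  apply le_antisymm
  · rintro _ ⟨x, rfl⟩
    refine T.Z.add_mem (T.mem x.1) ?_
    change Finsupp.linearCombination O Subtype.val x.2 ∈ _
    rw [Finsupp.linearCombination_apply]
    exact T.Z.sum_mem fun z _ => T.Z.smul_mem _ z.2
  · intro z hz
    refine ⟨(0, Finsupp.single ⟨z, hz⟩ 1), ?_⟩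
    simp [boundary]

/-- The next step. -/
def next {i : ℕ} (T : Stage.{k, u, v, w} L' i) : Stage.{k, u, v, w} L' (i + 1) where
  S := T.Z
  Z := LinearMap.ker T.boundary
  mem x := by simp [boundary, L'.d_d]

theorem boundary_inl {i : ℕ} (T : Stage.{k, u, v, w} L' i) (x : E' (i + 1)) :
    T.boundary (x, 0) = (L'.d i x, 0) := by
  simp [boundary]

theorem exact_boundary {i : ℕ} (T : Stage.{k, u, v, w} L' i) :
    Function.Exact T.next.boundary T.boundary :=
  LinearMap.exact_iff.2 T.next.range_boundary.symm

/-- The augmentation in the first step. -/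
def augmentation (π' : E' 0 →ₗ[O] A) : E' 0 × (ULift.{max u w} A →₀ O) →ₗ[O] A :=
  π'.coprod (Finsupp.linearCombination O ULift.down)

theorem augmentation_inl (π' : E' 0 →ₗ[O] A) (x : E' 0) :
    augmentation.{u, v, w} π' (x, 0) = π' x := by
  simp [augmentation]

theorem augmentation_surjective (π' : E' 0 →ₗ[O] A) :
    Function.Surjective (augmentation.{u, v, w} π') := fun a =>
  ⟨(0, Finsupp.single ⟨a⟩ 1), by
    rw [augmentation, LinearMap.coprod_apply, map_zero, zero_add,
      Finsupp.linearCombination_single, one_smul]⟩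

/-- The first step. -/
def first {π' : E' 0 →ₗ[O] A} (hπ' : L'.TerminatesIn π') : Stage.{k, u, v, w} L' 0 where
  S := ULift.{max u w} A
  Z := LinearMap.ker (augmentation π')
  mem x := by simp [augmentation, hπ'.comp_d]

theorem exact_first {π' : E' 0 →ₗ[O] A} (hπ' : L'.TerminatesIn π') :
    Function.Exact (first hπ').boundary (augmentation.{u, v, w} π') :=
  LinearMap.exact_iff.2 (first hπ').range_boundary.symm

end Stage

variable {L'} {π' : E' 0 →ₗ[O] A} (hπ' : L'.TerminatesIn π')

/-- All steps of the construction. -/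
def stage (i : ℕ) : Stage.{k, u, v, w} L' i :=
  Nat.rec (Stage.first hπ') (fun _ T => T.next) i

/-- A resolution of `A` that contains `E'` as a direct summand with free complements. -/
def resolution : Resolution O A fun i => E' i × ((stage hπ' i).S →₀ O) where
  d i := (stage hπ' i).boundary
  hook := Stage.augmentation π'
  surjective := Stage.augmentation_surjective π'
  exact_zero := Stage.exact_first hπ'
  exact_succ i := (stage hπ' i).exact_boundary

end LieInftyAlgebroid

end LieInfty

end

/-! ### The proposition. -/

theorem mainTheorem4 {K : Type k} [Field K] [CharZero K]
    {O : Type u} [CommRing O] [Algebra K O]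
    {A : Type v} [LieRing A] [Module O A] [LieRingModule A O] [LieRinehartRing O A]
    [LieAlgebra K A] [LieRinehartAlgebra K O A]
    {E' : ℕ → Type w} [∀ i, AddCommGroup (E' i)] [∀ i, Module O (E' i)] [∀ i, Module K (E' i)]
    [∀ i, IsScalarTower K O (E' i)]
    (L' : LieInfty.LieInftyAlgebroid K O E') (π' : E' 0 →ₗ[O] A) (hπ' : L'.TerminatesIn π') :
    ∃ (E : ℕ → Type (max u v w)) (_ : ∀ i, AddCommGroup (E i)) (_ : ∀ i, Module O (E i))
      (_ : ∀ i, Module K (E i)) (_ : ∀ i, IsScalarTower K O (E i))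
      (L : LieInfty.LieInftyAlgebroid K O E) (π : E 0 →ₗ[O] A)
      (incl : ∀ i, E' i →ₗ[O] E i) (Φ : L'.Hom L),
      -- `L` is acyclic and covers `A` through `π`, and its complex is a resolution of `A`
      L.Acyclic ∧ L.Covers π ∧ Function.Exact (L.d 0) π ∧
      -- the complex of `L'` is a subcomplex over `A`, with a complement in each degree
      (∀ i, Function.Injective (incl i)) ∧
      (∀ i x, incl i (L'.d i x) = L.d i (incl (i + 1) x)) ∧
      (∀ x, π (incl 0 x) = π' x) ∧
      (∀ i, ∃ C : Submodule O (E i), Module.Projective O C ∧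
        IsCompl (LinearMap.range (incl i)) C) ∧
      -- the only non-vanishing Taylor coefficient of the morphism `Φ` over `A` is the inclusion
      Φ.IsOver π' π ∧
      (∀ i (x : E' i), Φ.coeff [DirectSum.lof K ℕ E' i x] = DirectSum.lof K ℕ E i (incl i x)) ∧
      (∀ l : List (⨁ i, E' i), 2 ≤ l.length → Φ.coeff l = 0) := by
  have hproj : ∀ i, Module.Projective O (E' i) := L'.projective
  let S := fun i => (LieInfty.LieInftyAlgebroid.stage hπ' i).S →₀ O
  let R := LieInfty.LieInftyAlgebroid.resolution hπ'
  let inc : ∀ i, E' i →ₗ[O] E' i × S i := fun i => LinearMap.inl O (E' i) (S i)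
  have hπ : ∀ x, R.hook (inc 0 x) = π' x :=
    LieInfty.LieInftyAlgebroid.Stage.augmentation_inl π'
  have hd : ∀ i x, inc i (L'.d i x) = R.d i (inc (i + 1) x) := fun i x =>
    ((LieInfty.LieInftyAlgebroid.stage hπ' i).boundary_inl x).symm
  have hret : ∀ i x, LinearMap.fst O (E' i) (S i) (inc i x) = x := fun _ _ => rfl
  -- The splittings on `E'` are chosen before those on `E`, so that the latter can extend them.
  choose s' hs' using fun i => LieInfty.exists_splitting K O (E' i)
  choose s hs hss using fun i =>
    LieInfty.exists_splitting_extension (M := E' i × S i) (hret i) (hs' i)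
  obtain ⟨H, hH, hJ, hb⟩ :=
    LieInfty.Resolution.exists_extension (R := R) hπ' hπ hd hret hs hs' hss
  -- Each module is the product of `E' i`, projective by `hproj`, and a free module.
  let L := R.toLieInftyAlgebroid (fun _ => inferInstance) hH hJ
  have hL : L.Covers R.hook := R.toLieInftyAlgebroid_covers
  have hLd : ∀ i, L.d i = R.d i := R.toLieInftyAlgebroid_d
  refine ⟨fun i => E' i × S i, inferInstance, inferInstance, inferInstance, inferInstance, L,
    R.hook, inc, LieInfty.LieInftyAlgebroid.strictHom inc hb
      (LieInfty.Resolution.anchor_inc hπ' hπ), R.toLieInftyAlgebroid_acyclic, hL, ?_,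
    fun i => LinearMap.inl_injective, fun i x => ?_, hπ,
    fun i => ⟨LinearMap.range (LinearMap.inr O (E' i) (S i)), ?_,
      LinearMap.isCompl_range_inl_inr⟩, fun x => ?_,
    LieInfty.LieInftyAlgebroid.strictHom_coeff_singleton,
    fun l => LieInfty.LieInftyAlgebroid.strictHom_coeff_eq_zero⟩
  · rw [hLd]; exact R.exact_zero
  · rw [hLd]; exact hd i x
  · exact Module.Projective.of_equiv (LinearEquiv.ofInjective _ LinearMap.inr_injective)
  · exact ((congrArg (fun y : ⨁ i, E' i × S i => R.hook (y 0))
      (LieInfty.LieInftyAlgebroid.strictHom_coeff_singleton 0 x)).trans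
        (congrArg R.hook (DirectSum.lof_apply K 0 _))).trans (hπ x)
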